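/- Let $\alpha,\beta,\gamma\ge 0$ be real with $\alpha+\beta+\gamma<1$, and put $$V(s)=\frac{1-\alpha^2}{s^2}+\frac{1-\beta^2}{(s-1)^2}+\frac{\alpha^2+\beta^2-\gamma^2-1}{s(s-1)}.$$ Let $z(s)=u_1(s)/u_2(s)$ be a ratio of two linearly independent solutions of $u''+\tfrac14Vu=0$ that maps the upper half $s$-plane univalently onto a circular triangle $T$ with vertices $z(0),z(1),z(\infty)$, with interior angles $\alpha\pi,\beta\pi,\gamma\pi$, and let $D\supset T$ be the disk of the extended $z$-plane (a disk, a half-plane or the exterior of a disk) whose boundary circle is orthogonal to the three sides of $T$. Let $s(z)=S(\alpha,\beta,\gamma;z)$ be the inverse map on $T$ (the triangle function; it need not be single-valued on $D$), and put $$w_1=\tfrac12\Big[\log\frac{s'}{s}\Big]',\qquad w_2=\tfrac12\Big[\log\frac{s'}{s-1}\Big]',\qquad w_3=\tfrac12\Big[\log\frac{s'}{s(s-1)}\Big]'.$$ Let $a_1,a_2,a_3\in\mathbb C$ with $a_1+a_2+a_3=6$, let $y=a_1w_1+a_2w_2+a_3w_3$ on $T$, and put $b_1=1-a_1/6$, $b_2=1-a_2/6$.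 Then $y=3\phi'/\phi$ on $T$ with $\phi=s'/\big((s-1)^{b_1}s^{b_2}\big)$. Moreover, let $q=\frac{b_1}{s-1}+\frac{b_2}{s}$, $V_2=\tfrac12V+q'+\tfrac12q^2$ and $V_{n+1}=V_n'+n\,q\,V_n$ for $n\ge2$. Then the following are equivalent. 1. $y$ continues to a (single-valued) holomorphic function on $D\cap\mathbb C$ that solves the Chazy equation $y'''=2yy''-3y'^2$ there. 2. $V_4=12V_2^2$ for all $s\in\mathbb C\setminus\{0,1\}$, and the residues of $y$ at the vertices with non-zero angle vanish, that is, $a_2=6\alpha$ if $\alpha\ne0$, $a_1=6\beta$ if $\beta\neq0$, and $a_3=6\gamma$ if $\gamma\ne0$. 3. Up to a permutation of the three vertices, i.e. a simultaneous permutation of the three pairs $(\alpha,a_2),(\beta,a_1),(\gamma,a_3)$, the data $(\alpha,\beta,\gamma;\,a_1,a_2,a_3)$ are one of: - $S(0,\tfrac12,\tfrac13)$: $y=3w_1+w_2+2w_3$; - $S(0,\tfrac13,\tfrac13)$: $y=2w_1+2w_2+2w_3$; - $S(0,\tfrac12,0)$: $y=3w_1+2w_2+w_3$ or $y=3w_1+w_2+2w_3$;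 - $S(0,\tfrac13,0)$: $y=2w_1+3w_2+w_3$ or $y=2w_1+w_2+3w_3$; - $S(0,\tfrac23,0)$: $y=4w_1+w_2+w_3$; - $S(0,0,0)$: $y=w_1+w_2+4w_3$ (so $b_1=b_2=\tfrac56$) or $y=2w_1+2w_2+2w_3$ (so $b_1=b_2=\tfrac23$). -/

import Mathlib

open Set Filter Topology
open UpperHalfPlane (upperHalfPlaneSet)

noncomputable section

namespace Chazy

/-- The potential of the Fuchsian equation `u'' + (V/4) u = 0` with exponent differences
`α, β, γ` at the regular singular points `0, 1, ∞`. -/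
def V (α β γ : ℝ) (s : ℂ) : ℂ :=
  (1 - (α : ℂ) ^ 2) / s ^ 2 + (1 - (β : ℂ) ^ 2) / (s - 1) ^ 2 +
    ((α : ℂ) ^ 2 + (β : ℂ) ^ 2 - (γ : ℂ) ^ 2 - 1) / (s * (s - 1))

/-- `u` is a holomorphic solution of `u'' + (V/4) u = 0` on the upper half `s`-plane. -/
def IsFuchsianSolution (α β γ : ℝ) (u : ℂ → ℂ) : Prop :=
  DifferentiableOn ℂ u upperHalfPlaneSet ∧
    ∀ s ∈ upperHalfPlaneSet, deriv (deriv u) s + V α β γ s / 4 * u s = 0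

/-- Hyperbolic lines of the upper half-plane: the arcs in the upper half-plane of the circles and
straight lines orthogonal to the real axis. -/
def IsHyperbolicLine (L : Set ℂ) : Prop :=
  ∃ A B C : ℝ, 0 < B ^ 2 - 4 * A * C ∧
    L = {z | 0 < z.im ∧ A * Complex.normSq z + B * z.re + C = 0}

/-- `Z` is a Schwarz map with parameters `α, β, γ`, normalized so that the circle orthogonal to the
sides of the triangle is the real axis: a univalent ratio `u₁ / u₂` of two linearly independent
solutions of the Fuchsian equation, mapping the upper half-plane onto a hyperbolic triangle
contained in the upper half-plane. The three intervals between the singular points `0, 1, ∞` are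
carried to the sides of the triangle, which lie on hyperbolic lines. -/
structure IsSchwarzMap (α β γ : ℝ) (Z : ℂ → ℂ) : Prop where
  ratio : ∃ u₁ u₂ : ℂ → ℂ,
    IsFuchsianSolution α β γ u₁ ∧ IsFuchsianSolution α β γ u₂ ∧
    (∀ s ∈ upperHalfPlaneSet, u₁ s * deriv u₂ s - deriv u₁ s * u₂ s ≠ 0) ∧
    (∀ s ∈ upperHalfPlaneSet, u₂ s ≠ 0) ∧
    ∀ s ∈ upperHalfPlaneSet, Z s = u₁ s / u₂ s
  injOn : InjOn Z upperHalfPlaneSet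
  mapsTo : MapsTo Z upperHalfPlaneSet upperHalfPlaneSet
  sides : ∀ I ∈ ({Iio 0, Ioo 0 1, Ioi 1} : Set (Set ℝ)), ∃ L, IsHyperbolicLine L ∧
    ∀ x ∈ I, ∃ p ∈ L, Tendsto Z (𝓝[upperHalfPlaneSet] (x : ℂ)) (𝓝 p)

/-- The fractional linear transformation of the matrix `g`. -/
def moebius (g : GL (Fin 2) ℂ) (z : ℂ) : ℂ :=
  (g 0 0 * z + g 0 1) / (g 1 0 * z + g 1 1)

/-- The finite points of the preimage of a set `U` of (finite) complex numbers under `g`. -/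
def pullback (g : GL (Fin 2) ℂ) (U : Set ℂ) : Set ℂ :=
  {z | g 1 0 * z + g 1 1 ≠ 0 ∧ moebius g z ∈ U}

/-- The domain `D` of the extended plane (its finite points): the disk, half-plane or exterior of a
disk that `g` maps onto the upper half-plane. -/
def domainD (g : GL (Fin 2) ℂ) : Set ℂ := pullback g upperHalfPlaneSet

/-- The circular triangle `T ⊆ D` (its finite points) that `g` maps onto the image of the
normalized Schwarz map `Z`. -/
def triangleT (g : GL (Fin 2) ℂ) (Z : ℂ → ℂ) : Set ℂ := pullback g (Z '' upperHalfPlaneSet)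

/-- `s` is the triangle function `S(α, β, γ; ·)` on the triangle `T = triangleT g Z`: the inverse
of the Schwarz map `g⁻¹ ∘ Z`. As `g` varies this is the whole three-parameter family. -/
def IsTriangleFunction (α β γ : ℝ) (g : GL (Fin 2) ℂ) (Z s : ℂ → ℂ) : Prop :=
  IsSchwarzMap α β γ Z ∧
    ∀ z ∈ triangleT g Z, s z ∈ upperHalfPlaneSet ∧ Z (s z) = moebius g z

/-- `w₁ = ½ [log (s' / s)]'` -/
def w₁ (s : ℂ → ℂ) (z : ℂ) : ℂ := 1 / 2 * logDeriv (fun z => deriv s z / s z) z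

/-- `w₂ = ½ [log (s' / (s - 1))]'` -/
def w₂ (s : ℂ → ℂ) (z : ℂ) : ℂ := 1 / 2 * logDeriv (fun z => deriv s z / (s z - 1)) z

/-- `w₃ = ½ [log (s' / (s (s - 1)))]'` -/
def w₃ (s : ℂ → ℂ) (z : ℂ) : ℂ := 1 / 2 * logDeriv (fun z => deriv s z / (s z * (s z - 1))) z

/-- `y = a₁ w₁ + a₂ w₂ + a₃ w₃` -/
def y (a₁ a₂ a₃ : ℂ) (s : ℂ → ℂ) (z : ℂ) : ℂ := a₁ * w₁ s z + a₂ * w₂ s z + a₃ * w₃ s z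

/-- `φ = s' / ((s - 1) ^ b₁ s ^ b₂)`, with principal powers (`s` and `s - 1` lie in the upper
half-plane on the triangle). -/
def φ (b₁ b₂ : ℂ) (s : ℂ → ℂ) (z : ℂ) : ℂ := deriv s z / ((s z - 1) ^ b₁ * s z ^ b₂)

/-- `Y` is a holomorphic solution of `Y''' = 2 Y Y'' - 3 Y' ^ 2` on the open set `D`. -/
def IsChazySolutionOn (Y : ℂ → ℂ) (D : Set ℂ) : Prop :=
  DifferentiableOn ℂ Y D ∧
    ∀ z ∈ D, deriv (deriv (deriv Y)) z = 2 * Y z * deriv (deriv Y) z - 3 * deriv Y z ^ 2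

/-- `q(s) = b₁ / (s - 1) + b₂ / s` -/
def q (b₁ b₂ : ℂ) (s : ℂ) : ℂ := b₁ / (s - 1) + b₂ / s

/-- `VSeq n` is the rational function `V_{n+2}`, where `V₂ = V/2 + q' + q²/2` and
`V_{m+1} = V_m' + m q V_m`. -/
def VSeq (α β γ : ℝ) (b₁ b₂ : ℂ) : ℕ → ℂ → ℂ
  | 0 => fun s => 1 / 2 * V α β γ s + deriv (q b₁ b₂) s + 1 / 2 * q b₁ b₂ s ^ 2
  | n + 1 => fun s =>
      deriv (VSeq α β γ b₁ b₂ n) s + ((n : ℂ) + 2) * q b₁ b₂ s * VSeq α β γ b₁ b₂ n s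

/-- The rows of the classification table: the parameters `α, β, γ` of the triangle function
and the coefficients `a₁, a₂, a₃`. -/
inductive TableRow : ℝ → ℝ → ℝ → ℂ → ℂ → ℂ → Prop
  | case1 : TableRow 0 (1 / 2) (1 / 3) 3 1 2
  | case2 : TableRow 0 (1 / 3) (1 / 3) 2 2 2
  | case3i : TableRow 0 (1 / 2) 0 3 2 1
  | case3ii : TableRow 0 (1 / 2) 0 3 1 2
  | case4i : TableRow 0 (1 / 3) 0 2 3 1
  | case4ii : TableRow 0 (1 / 3) 0 2 1 3
  | case5 : TableRow 0 (2 / 3) 0 4 1 1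
  | case6a : TableRow 0 0 0 1 1 4
  | case6b : TableRow 0 0 0 2 2 2

/-- The parameters occur in the table up to a permutation of the three vertices
`z(0), z(1), z(∞)`. The angle parameters at these vertices are `α, β, γ`, and the coefficients
that go with them are `a₂, a₁, a₃` respectively (`s ↦ 1 - s` interchanges `w₁` and `w₂`, and
`s ↦ 1 / s` interchanges `w₂` and `w₃`). -/
def InTable (α β γ : ℝ) (a₁ a₂ a₃ : ℂ) : Prop :=
  ∃ σ : Equiv.Perm (Fin 3),
    TableRow (![α, β, γ] (σ 0)) (![α, β, γ] (σ 1)) (![α, β, γ] (σ 2))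
      (![a₂, a₁, a₃] (σ 1)) (![a₂, a₁, a₃] (σ 0)) (![a₂, a₁, a₃] (σ 2))

end Chazy

end

/-! Put u, v, w = a₂/6, a₁/6, a₃/6, so that u + v + w = 1.

Reduction to an identity. On the triangle, y = 3 (s''/s' - q(s) s'). The Schwarzian equation of the
inverse map then makes f₄ = V₂(s) s'², f₆ = V₃(s) s'³, f₈ = V₄(s) s'⁴ covariants of y: y' = y²/6 - 3
f₄, f₄' = f₆ + (2/3) y f₄, f₆' = f₈ + y f₆. Eliminating them, y''' - 2 y y'' + 3 y'² = -3 (f₈ - 12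
f₄²). So the Chazy equation on the triangle means V₄ = 12 V₂² on an open set, hence identically
(`IsInverseOn.covariantSystem`, `CovariantSystem.chazy`, `VSeq_identity_of_triangleT`).

Classification. After clearing denominators the identity is a quartic, equivalent to
`IndicialSystem`. One equation at each vertex says that the angle vanishes or, for instance at s =
0, that u² = α². As α + β + γ < 1 = u + v + w, some angle is zero, and the cases of one, two and
three cusps leave exactly the table (`inTable_of_vertexSystem`).

Continuation. The model solution is `modE` = π i E₂ on the upper half-plane H. Its covariants
`modF`, `modG` are multiples of E₄, E₆, and the weight eight relation is the Chazy equation. For a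
row of the table a map T into H is sought with modG(T)²/modF(T)³ = V₃²/V₂³, that is, with j(T) a
prescribed rational function of s. At a cusp 8 V₂³ - V₃² vanishes like the discriminant, so the
equation is solved by T = (k log s + ℓ)/(2πi) with ℓ holomorphic (`CuspData.exists_local_lift`).
Such a T has the Schwarzian derivative of Z, hence T = M ∘ Z for a fractional linear M, and y is the
transform of `modE` by M g.

It remains that M maps H into H, for then this transform is holomorphic on all of D. The two sides
at the cusp become vertical lines, so after a real inversion M is z ↦ ρ z + σ with ρ > 0, and Im σ ≥
0 is needed. Since `modE` is unbounded near every real point, the continued T cannot leave H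
(`HasSchwarzian.lift_continuation`). If Im σ < 0, the third side is not vertical
(`not_three_vertical_sides`), so it lies on a circle centred below the real axis. Reflection in that
circle gives a functional equation that bounds `modE` near a real point, a contradiction
(`exists_circle_relation`, `not_frequently_circle_relation`). -/

noncomputable section

namespace Chazy

/-! ### The rational functions `V₂, V₃, V₄` -/

/-- Numerator of `V₂` over `s ^ 2 * (s - 1) ^ 2`. -/
def numer₂ (p₀ p₁ p₂ s : ℂ) : ℂ := p₀ + p₁ * s + p₂ * s ^ 2

/-- Numerator of `V₃` over `s ^ 3 * (s - 1) ^ 3`. -/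
def numer₃ (u v p₀ p₁ p₂ s : ℂ) : ℂ :=
  s * (s - 1) * (p₁ + 2 * p₂ * s) - 2 * ((u + v) * s - u) * numer₂ p₀ p₁ p₂ s

/-- Numerator of `V₄` over `s ^ 4 * (s - 1) ^ 4`. -/
def numer₄ (u v p₀ p₁ p₂ s : ℂ) : ℂ :=
  s * (s - 1) * ((2 * s - 1) * (p₁ + 2 * p₂ * s) + s * (s - 1) * (2 * p₂) -
      2 * (u + v) * numer₂ p₀ p₁ p₂ s - 2 * ((u + v) * s - u) * (p₁ + 2 * p₂ * s)) -
    3 * ((u + v) * s - u) * numer₃ u v p₀ p₁ p₂ s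

/-- The constant coefficient of the numerator of `V₂`. -/
def coeffZero (α : ℝ) (a₂ : ℂ) : ℂ := ((a₂ / 6) ^ 2 - (α : ℂ) ^ 2) / 2

/-- The leading coefficient of the numerator of `V₂`. -/
def coeffTwo (γ : ℝ) (a₁ a₂ : ℂ) : ℂ := ((1 - a₁ / 6 - a₂ / 6) ^ 2 - (γ : ℂ) ^ 2) / 2

/-- The middle coefficient of the numerator of `V₂`. -/
def coeffOne (α β γ : ℝ) (a₁ a₂ : ℂ) : ℂ :=
  ((a₁ / 6) ^ 2 - (β : ℂ) ^ 2) / 2 - coeffZero α a₂ - coeffTwo γ a₁ a₂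

lemma hasDerivAt_q (b₁ b₂ : ℂ) {s : ℂ} (h0 : s ≠ 0) (h1 : s ≠ 1) :
    HasDerivAt (q b₁ b₂) (-b₁ / (s - 1) ^ 2 - b₂ / s ^ 2) s := by
  have h1' : s - 1 ≠ 0 := sub_ne_zero.2 h1
  have := ((hasDerivAt_const s b₁).div ((hasDerivAt_id s).sub_const 1) h1').add
    ((hasDerivAt_const s b₂).div (hasDerivAt_id s) h0)
  refine HasDerivAt.congr_deriv this ?_
  simp only [id]
  field_simp
  ring

lemma VSeq_zero_eq (α β γ : ℝ) (a₁ a₂ : ℂ) {s : ℂ} (h0 : s ≠ 0) (h1 : s ≠ 1) :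
    VSeq α β γ (1 - a₁ / 6) (1 - a₂ / 6) 0 s =
      numer₂ (coeffZero α a₂) (coeffOne α β γ a₁ a₂) (coeffTwo γ a₁ a₂) s /
        (s ^ 2 * (s - 1) ^ 2) := by
  have h1' : s - 1 ≠ 0 := sub_ne_zero.2 h1
  simp only [VSeq, (hasDerivAt_q _ _ h0 h1).deriv, V, q, numer₂, coeffOne, coeffZero, coeffTwo]
  field_simp
  ring

lemma isOpen_compl_zero_one : IsOpen {s : ℂ | s ≠ 0 ∧ s ≠ 1} :=
  isOpen_ne.inter isOpen_ne

lemma hasDerivAt_VSeq_zero (α β γ : ℝ) (a₁ a₂ : ℂ) {s : ℂ} (h0 : s ≠ 0) (h1 : s ≠ 1) :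
    HasDerivAt (VSeq α β γ (1 - a₁ / 6) (1 - a₂ / 6) 0)
      (numer₃ (a₂ / 6) (a₁ / 6) (coeffZero α a₂) (coeffOne α β γ a₁ a₂) (coeffTwo γ a₁ a₂) s /
        (s ^ 3 * (s - 1) ^ 3) - 2 * q (1 - a₁ / 6) (1 - a₂ / 6) s *
          VSeq α β γ (1 - a₁ / 6) (1 - a₂ / 6) 0 s) s := by
  have h1' : s - 1 ≠ 0 := sub_ne_zero.2 h1
  rw [VSeq_zero_eq α β γ a₁ a₂ h0 h1]
  have hev : VSeq α β γ (1 - a₁ / 6) (1 - a₂ / 6) 0 =ᶠ[𝓝 s] fun s =>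
      numer₂ (coeffZero α a₂) (coeffOne α β γ a₁ a₂) (coeffTwo γ a₁ a₂) s /
        (s ^ 2 * (s - 1) ^ 2) := by
    filter_upwards [isOpen_compl_zero_one.mem_nhds ⟨h0, h1⟩] with x hx
    exact VSeq_zero_eq α β γ a₁ a₂ hx.1 hx.2
  refine HasDerivAt.congr_of_eventuallyEq ?_ hev
  generalize coeffZero α a₂ = p₀
  generalize coeffOne α β γ a₁ a₂ = p₁
  generalize coeffTwo γ a₁ a₂ = p₂
  have hn : HasDerivAt (numer₂ p₀ p₁ p₂) (p₁ + 2 * p₂ * s) s := by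
    have := (((hasDerivAt_id s).const_mul p₁).const_add p₀).add
      (((hasDerivAt_id s).pow 2).const_mul p₂)
    refine HasDerivAt.congr_deriv this ?_
    simp; ring
  have hd : HasDerivAt (fun s : ℂ => s ^ 2 * (s - 1) ^ 2)
      (2 * s * (s - 1) ^ 2 + s ^ 2 * (2 * (s - 1))) s := by
    have := ((hasDerivAt_id s).pow 2).mul (((hasDerivAt_id s).sub_const 1).pow 2)
    refine HasDerivAt.congr_deriv this ?_
    simp
  refine HasDerivAt.congr_deriv (hn.div hd (by positivity)) ?_
  simp only [numer₃, numer₂, q]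
  field_simp
  ring

lemma VSeq_one_eq (α β γ : ℝ) (a₁ a₂ : ℂ) {s : ℂ} (h0 : s ≠ 0) (h1 : s ≠ 1) :
    VSeq α β γ (1 - a₁ / 6) (1 - a₂ / 6) 1 s =
      numer₃ (a₂ / 6) (a₁ / 6) (coeffZero α a₂) (coeffOne α β γ a₁ a₂) (coeffTwo γ a₁ a₂) s /
        (s ^ 3 * (s - 1) ^ 3) := by
  rw [VSeq]
  beta_reduce
  rw [(hasDerivAt_VSeq_zero α β γ a₁ a₂ h0 h1).deriv]
  simp

lemma hasDerivAt_VSeq_one (α β γ : ℝ) (a₁ a₂ : ℂ) {s : ℂ} (h0 : s ≠ 0) (h1 : s ≠ 1) :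
    HasDerivAt (VSeq α β γ (1 - a₁ / 6) (1 - a₂ / 6) 1)
      (numer₄ (a₂ / 6) (a₁ / 6) (coeffZero α a₂) (coeffOne α β γ a₁ a₂) (coeffTwo γ a₁ a₂) s /
        (s ^ 4 * (s - 1) ^ 4) - 3 * q (1 - a₁ / 6) (1 - a₂ / 6) s *
          VSeq α β γ (1 - a₁ / 6) (1 - a₂ / 6) 1 s) s := by
  have h1' : s - 1 ≠ 0 := sub_ne_zero.2 h1
  rw [VSeq_one_eq α β γ a₁ a₂ h0 h1]
  have hev : VSeq α β γ (1 - a₁ / 6) (1 - a₂ / 6) 1 =ᶠ[𝓝 s] fun s =>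
      numer₃ (a₂ / 6) (a₁ / 6) (coeffZero α a₂) (coeffOne α β γ a₁ a₂) (coeffTwo γ a₁ a₂) s /
        (s ^ 3 * (s - 1) ^ 3) := by
    filter_upwards [isOpen_compl_zero_one.mem_nhds ⟨h0, h1⟩] with x hx
    exact VSeq_one_eq α β γ a₁ a₂ hx.1 hx.2
  refine HasDerivAt.congr_of_eventuallyEq ?_ hev
  generalize coeffZero α a₂ = p₀
  generalize coeffOne α β γ a₁ a₂ = p₁
  generalize coeffTwo γ a₁ a₂ = p₂
  have hn : HasDerivAt (numer₂ p₀ p₁ p₂) (p₁ + 2 * p₂ * s) s := by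
    have := (((hasDerivAt_id s).const_mul p₁).const_add p₀).add
      (((hasDerivAt_id s).pow 2).const_mul p₂)
    refine HasDerivAt.congr_deriv this ?_
    simp; ring
  have hn3 : HasDerivAt (numer₃ (a₂ / 6) (a₁ / 6) p₀ p₁ p₂)
      ((2 * s - 1) * (p₁ + 2 * p₂ * s) + s * (s - 1) * (2 * p₂) -
      2 * (a₂ / 6 + a₁ / 6) * numer₂ p₀ p₁ p₂ s -
      2 * ((a₂ / 6 + a₁ / 6) * s - a₂ / 6) * (p₁ + 2 * p₂ * s)) s := by
    have h := (((hasDerivAt_id s).mul ((hasDerivAt_id s).sub_const 1)).mul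
      (((hasDerivAt_id s).const_mul (2 * p₂)).const_add p₁)).sub
      (((((hasDerivAt_id s).const_mul (a₂ / 6 + a₁ / 6)).sub_const (a₂ / 6)).const_mul 2).mul hn)
    refine HasDerivAt.congr_deriv h ?_
    simp; ring
  have hd : HasDerivAt (fun s : ℂ => s ^ 3 * (s - 1) ^ 3)
      (3 * s ^ 2 * (s - 1) ^ 3 + s ^ 3 * (3 * (s - 1) ^ 2)) s := by
    have := ((hasDerivAt_id s).pow 3).mul (((hasDerivAt_id s).sub_const 1).pow 3)
    refine HasDerivAt.congr_deriv this ?_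
    simp
  refine HasDerivAt.congr_deriv (hn3.div hd (by positivity)) ?_
  simp only [numer₄, numer₃, numer₂, q]
  field_simp
  ring

lemma VSeq_two_eq (α β γ : ℝ) (a₁ a₂ : ℂ) {s : ℂ} (h0 : s ≠ 0) (h1 : s ≠ 1) :
    VSeq α β γ (1 - a₁ / 6) (1 - a₂ / 6) 2 s =
      numer₄ (a₂ / 6) (a₁ / 6) (coeffZero α a₂) (coeffOne α β γ a₁ a₂) (coeffTwo γ a₁ a₂) s /
        (s ^ 4 * (s - 1) ^ 4) := by
  rw [VSeq]
  beta_reduce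
  rw [(hasDerivAt_VSeq_one α β γ a₁ a₂ h0 h1).deriv]
  push_cast
  ring

lemma VSeq_identity_iff (α β γ : ℝ) (a₁ a₂ : ℂ) {s : ℂ} (h0 : s ≠ 0) (h1 : s ≠ 1) :
    VSeq α β γ (1 - a₁ / 6) (1 - a₂ / 6) 2 s =
        12 * VSeq α β γ (1 - a₁ / 6) (1 - a₂ / 6) 0 s ^ 2 ↔
      numer₄ (a₂ / 6) (a₁ / 6) (coeffZero α a₂) (coeffOne α β γ a₁ a₂) (coeffTwo γ a₁ a₂) s -
        12 * numer₂ (coeffZero α a₂) (coeffOne α β γ a₁ a₂) (coeffTwo γ a₁ a₂) s ^ 2 = 0 := by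
  have h1' : s - 1 ≠ 0 := sub_ne_zero.2 h1
  rw [VSeq_two_eq α β γ a₁ a₂ h0 h1, VSeq_zero_eq α β γ a₁ a₂ h0 h1, div_pow, ← mul_div_assoc,
    show (s ^ 2 * (s - 1) ^ 2) ^ 2 = s ^ 4 * (s - 1) ^ 4 by ring,
    div_left_inj' (by positivity), sub_eq_zero]

/-- Five nodes determine a quartic; they avoid 0 and 1, where the rational identity gives no
information. -/
lemma quartic_eq_zero {c₀ c₁ c₂ c₃ c₄ : ℂ}
    (h : ∀ s ∈ ({2, 3, 4, 5, -1} : Set ℂ),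
      c₀ + c₁ * s + c₂ * s ^ 2 + c₃ * s ^ 3 + c₄ * s ^ 4 = 0) :
    c₀ = 0 ∧ c₁ = 0 ∧ c₂ = 0 ∧ c₃ = 0 ∧ c₄ = 0 := by
  have e2 := h 2 (by simp)
  have e3 := h 3 (by simp)
  have e4 := h 4 (by simp)
  have e5 := h 5 (by simp)
  have e1 := h (-1) (by simp)
  grind

/-- The system of equations equivalent to `V₄ = 12 V₂ ^ 2`: one pair for each of the singular
points `0, ∞` and one for the singular point `1`. -/
def IndicialSystem (u v w p₀ p₁ p₂ : ℂ) : Prop :=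
  p₀ * (u ^ 2 - 2 * p₀) = 0 ∧ p₂ * (w ^ 2 - 2 * p₂) = 0 ∧
  (p₀ + p₁ + p₂) * (v ^ 2 - 2 * (p₀ + p₁ + p₂)) = 0 ∧
  (3 * u - 1) * (2 * u - 1) * p₁ - (1 - w) * (12 * u - 2) * p₀ = 24 * p₀ * p₁ ∧
  (3 * w - 1) * (2 * w - 1) * p₁ - (1 - u) * (12 * w - 2) * p₂ = 24 * p₂ * p₁

/-- The five coefficients of the quartic are c₀, …, c₄. The middle one is traded for their sum, the
value at s = 1, so that the three singular points enter symmetrically. -/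
lemma indicialSystem_iff {u v w p₀ p₁ p₂ : ℂ} (hw : u + v + w = 1) :
    IndicialSystem u v w p₀ p₁ p₂ ↔
      ∀ s, s ≠ 0 → s ≠ 1 → numer₄ u v p₀ p₁ p₂ s - 12 * numer₂ p₀ p₁ p₂ s ^ 2 = 0 := by
  obtain rfl : w = 1 - u - v := by linear_combination hw
  set n₁ := (2 * u - 1) * p₁ - 2 * (u + v) * p₀ with hn1
  set n₂ := p₁ - 2 * p₂ - 2 * (u + v) * p₁ + 2 * u * p₂ with hn2
  have key : ∀ s, numer₄ u v p₀ p₁ p₂ s - 12 * numer₂ p₀ p₁ p₂ s ^ 2 =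
      (6 * u ^ 2 * p₀ - 12 * p₀ ^ 2) +
      ((3 * u - 1) * n₁ - 6 * (u + v) * u * p₀ - 24 * p₀ * p₁) * s +
      (n₁ - 2 * n₂ - 3 * (u + v) * n₁ + 3 * u * n₂ - 12 * (p₁ ^ 2 + 2 * p₀ * p₂)) * s ^ 2 +
      ((2 - 3 * (u + v)) * n₂ + (3 * u - 3) * (2 * (1 - u - v) * p₂) - 24 * p₁ * p₂) * s ^ 3 +
      (6 * (1 - u - v) ^ 2 * p₂ - 12 * p₂ ^ 2) * s ^ 4 := by
    intro s
    simp only [numer₄, numer₃, numer₂, hn1, hn2]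
    ring
  simp only [key, IndicialSystem]
  constructor
  · rintro ⟨h0, h2, h1, d0, d2⟩ s - -
    have e0 : 6 * u ^ 2 * p₀ - 12 * p₀ ^ 2 = 0 := by linear_combination 6 * h0
    have e4 : 6 * (1 - u - v) ^ 2 * p₂ - 12 * p₂ ^ 2 = 0 := by linear_combination 6 * h2
    have e1 : (3 * u - 1) * n₁ - 6 * (u + v) * u * p₀ - 24 * p₀ * p₁ = 0 := by
      rw [hn1]; linear_combination d0
    have e3 : (2 - 3 * (u + v)) * n₂ + (3 * u - 3) * (2 * (1 - u - v) * p₂) - 24 * p₁ * p₂ = 0 := by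
      rw [hn2]; linear_combination d2
    have e2 : n₁ - 2 * n₂ - 3 * (u + v) * n₁ + 3 * u * n₂ - 12 * (p₁ ^ 2 + 2 * p₀ * p₂) = 0 := by
      rw [hn1] at e1 ⊢; rw [hn2] at e3 ⊢
      linear_combination 6 * h1 - e0 - e1 - e3 - e4
    rw [e0, e1, e2, e3, e4]; ring
  · intro h
    obtain ⟨e0, e1, e2, e3, e4⟩ := quartic_eq_zero (fun s hs => h s
      (by rintro rfl; norm_num at hs) (by rintro rfl; norm_num at hs))
    rw [hn1] at e1 e2; rw [hn2] at e2 e3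
    refine ⟨by linear_combination e0 / 6, by linear_combination e4 / 6,
      by linear_combination (e0 + e1 + e2 + e3 + e4) / 6, by linear_combination e1,
      by linear_combination e3⟩


/-! ### Classification of the solutions of `V₄ = 12 V₂ ^ 2` -/

/-- In terms of the vertex values A₀, A₁ = p₀ + p₁ + p₂, A₂ of the numerator at 0, 1, ∞, this is the
substitution s ↦ 1/s. Together with `rotate` it generates all permutations of the vertices. -/
lemma IndicialSystem.swap {u v w A₀ A₁ A₂ : ℂ}
    (h : IndicialSystem u v w A₀ (A₁ - A₀ - A₂) A₂) :
    IndicialSystem w v u A₂ (A₁ - A₂ - A₀) A₀ := by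
  obtain ⟨h0, h2, h1, d0, d2⟩ := h
  exact ⟨h2, h0, by linear_combination h1, by linear_combination d2, by linear_combination d0⟩

/-- The system contains linear-coefficient equations only at 0 and ∞. The one at 1 is a combination
of the others, which is what makes cyclic symmetry hold. -/
lemma IndicialSystem.rotate {u v w A₀ A₁ A₂ : ℂ} (hw : u + v + w = 1)
    (h : IndicialSystem u v w A₀ (A₁ - A₀ - A₂) A₂) :
    IndicialSystem v w u A₁ (A₂ - A₁ - A₀) A₀ := by
  obtain ⟨h0, h2, h1, d0, d2⟩ := h
  obtain rfl : w = 1 - u - v := by linear_combination hw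
  refine ⟨by linear_combination h1, h0, by linear_combination h2, ?_, ?_⟩
  · linear_combination 12 * h2 - 12 * h1 - 12 * h0 - d0 + d2
  · linear_combination -d0 - 24 * h0

lemma IndicialSystem.eq_of_three_cusps {u v w : ℂ} (hw : u + v + w = 1)
    (h : IndicialSystem u v w (u ^ 2 / 2) (v ^ 2 / 2 - u ^ 2 / 2 - w ^ 2 / 2) (w ^ 2 / 2)) :
    (u = 1 / 3 ∧ v = 1 / 3 ∧ w = 1 / 3) ∨ (u = 1 / 6 ∧ v = 1 / 6 ∧ w = 2 / 3) ∨
      (u = 1 / 6 ∧ v = 2 / 3 ∧ w = 1 / 6) ∨ (u = 2 / 3 ∧ v = 1 / 6 ∧ w = 1 / 6) := by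
  obtain rfl : w = 1 - u - v := by linear_combination hw
  obtain ⟨-, -, -, d0, d2⟩ := h
  have e0 : (6 * u - 1) * (v - (1 - u - v)) = 0 := by linear_combination -2 * d0
  have e2 : (6 * (1 - u - v) - 1) * (v - u) = 0 := by linear_combination -2 * d2
  grind

lemma IndicialSystem.eq_of_two_cusps {u v w : ℂ} (hw : u + v + w = 1) (hv : v ≠ 1)
    (h : IndicialSystem u v w (u ^ 2 / 2) (0 - u ^ 2 / 2 - w ^ 2 / 2) (w ^ 2 / 2)) :
    (u = 1 / 6 ∧ v = 2 / 3 ∧ w = 1 / 6) ∨ (u = 1 / 2 ∧ v = 1 / 3 ∧ w = 1 / 6) ∨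
      (u = 1 / 6 ∧ v = 1 / 3 ∧ w = 1 / 2) ∨ (u = 1 / 3 ∧ v = 1 / 2 ∧ w = 1 / 6) ∨
      (u = 1 / 6 ∧ v = 1 / 2 ∧ w = 1 / 3) := by
  obtain ⟨-, -, -, d1, -⟩ := h.rotate hw
  obtain ⟨-, -, -, d0, d2⟩ := h
  obtain rfl : v = 1 - u - w := by linear_combination hw
  have hs : u + w ≠ 0 := fun h => hv (by linear_combination -h)
  have e0 : (u + w) * ((6 * u - 1) * (u - w - u * (u + w))) = 0 := by
    linear_combination -2 * d0
  have e2 : (u + w) * ((6 * w - 1) * (w - u - w * (u + w))) = 0 := by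
    linear_combination -2 * d2
  have e1 : (u + w) * ((3 * (1 - u - w) - 1) * (2 * (1 - u - w) - 1) * (u - w)) = 0 := by
    linear_combination -2 * d1
  replace e0 := (mul_eq_zero.1 e0).resolve_left hs
  replace e1 := (mul_eq_zero.1 e1).resolve_left hs
  replace e2 := (mul_eq_zero.1 e2).resolve_left hs
  -- The two brackets add up to -(u + w)², so they cannot both vanish; hence u = 1/6 or w = 1/6.
  have hsum : (u - w - u * (u + w)) ≠ 0 ∨ (w - u - w * (u + w)) ≠ 0 := by
    by_contra hcon
    push Not at hcon
    have : (u + w) ^ 2 = 0 := by linear_combination -hcon.1 - hcon.2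
    exact hs (pow_eq_zero_iff (two_ne_zero) |>.1 this)
  grind

lemma IndicialSystem.eq_of_one_cusp {u v w : ℂ} (hw : u + v + w = 1) (hu : u ≠ 0)
    (h : IndicialSystem u v w (u ^ 2 / 2) (0 - u ^ 2 / 2) 0) :
    (v = 1 / 2 ∨ v = 1 / 3) ∧ (w = 1 / 2 ∨ w = 1 / 3) := by
  rw [← sub_zero (0 - u ^ 2 / 2)] at h
  obtain ⟨-, -, -, d1, -⟩ := h.rotate hw
  obtain ⟨-, -, -, d0, d2⟩ := h
  have hu2 : u ^ 2 ≠ 0 := pow_ne_zero 2 hu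
  have e2 : u ^ 2 * ((3 * w - 1) * (2 * w - 1)) = 0 := by linear_combination -2 * d2
  have e1 : u ^ 2 * ((3 * v - 1) * (2 * v - 1)) = 0 := by linear_combination -2 * d1
  replace e1 := (mul_eq_zero.1 e1).resolve_left hu2
  replace e2 := (mul_eq_zero.1 e2).resolve_left hu2
  grind

lemma inTable_iff (α β γ : ℝ) (a₁ a₂ a₃ : ℂ) : InTable α β γ a₁ a₂ a₃ ↔
    TableRow α β γ a₁ a₂ a₃ ∨ TableRow α γ β a₃ a₂ a₁ ∨ TableRow β α γ a₂ a₁ a₃ ∨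
      TableRow γ β α a₁ a₃ a₂ ∨ TableRow β γ α a₃ a₁ a₂ ∨ TableRow γ α β a₂ a₃ a₁ := by
  constructor
  · rintro ⟨σ, h⟩
    have h01 : σ 0 ≠ σ 1 := fun h => by simpa using σ.injective h
    have h02 : σ 0 ≠ σ 2 := fun h => by simpa using σ.injective h
    have h12 : σ 1 ≠ σ 2 := fun h => by simpa using σ.injective h
    generalize σ 0 = i at *
    generalize σ 1 = j at *
    generalize σ 2 = k at *
    fin_cases i <;> fin_cases j <;> first | exact absurd rfl h01 | skip
    all_goals fin_cases k <;> first | exact absurd rfl h02 | exact absurd rfl h12 | skip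
    all_goals simp at h; tauto
  · rintro (h | h | h | h | h | h)
    · exact ⟨1, h⟩
    · exact ⟨Equiv.swap 1 2, h⟩
    · exact ⟨Equiv.swap 0 1, h⟩
    · exact ⟨Equiv.swap 0 2, h⟩
    · exact ⟨finRotate 3, h⟩
    · exact ⟨(finRotate 3)⁻¹, h⟩

lemma inTable_rotate {α β γ : ℝ} {a₁ a₂ a₃ : ℂ} :
    InTable β γ α a₃ a₁ a₂ ↔ InTable α β γ a₁ a₂ a₃ := by
  simp only [inTable_iff]; tauto

lemma inTable_swap {α β γ : ℝ} {a₁ a₂ a₃ : ℂ} :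
    InTable γ β α a₁ a₃ a₂ ↔ InTable α β γ a₁ a₂ a₃ := by
  simp only [inTable_iff]; tauto

lemma eq_of_sq_eq_ofReal_sq {x : ℝ} {c : ℝ} (hx : 0 ≤ x) (hc : 0 ≤ c) {v : ℂ} (hv : v = (c : ℂ))
    (h : v ^ 2 = (x : ℂ) ^ 2) : x = c := by
  subst hv
  have : c ^ 2 = x ^ 2 := by exact_mod_cast h
  exact ((pow_left_inj₀ hc hx two_ne_zero).1 this).symm

/-- The sign of the root is not known at this stage, but only the upper bound matters: it is
compared with u + v + w = 1. -/
lemma abs_re_of_sq_eq {x : ℝ} (hx : 0 ≤ x) {v : ℂ} (h : v ^ 2 = (x : ℂ) ^ 2) : v.re ≤ x := by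
  rcases sq_eq_sq_iff_eq_or_eq_neg.1 h with rfl | rfl
  · simp
  · simp; linarith

/-- The system attached to the data `(α, u), (β, v), (γ, w)` at the three vertices. -/
def VertexSystem (α β γ : ℝ) (u v w : ℂ) : Prop :=
  IndicialSystem u v w ((u ^ 2 - (α : ℂ) ^ 2) / 2)
    ((v ^ 2 - (β : ℂ) ^ 2) / 2 - (u ^ 2 - (α : ℂ) ^ 2) / 2 - (w ^ 2 - (γ : ℂ) ^ 2) / 2)
    ((w ^ 2 - (γ : ℂ) ^ 2) / 2)

/-- With p₀ = (u² - α²)/2 the factor u² - 2 p₀ is α², so the first equation reads (u² - α²) α² = 0.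
-/
lemma VertexSystem.sq_eq {α β γ : ℝ} {u v w : ℂ} (h : VertexSystem α β γ u v w) (hα : α ≠ 0) :
    u ^ 2 = (α : ℂ) ^ 2 := by
  have h0 := h.1
  have : (α : ℂ) ^ 2 ≠ 0 := by simpa using hα
  have h' : (u ^ 2 - (α : ℂ) ^ 2) * (α : ℂ) ^ 2 = 0 := by linear_combination 2 * h0
  exact sub_eq_zero.1 ((mul_eq_zero.1 h').resolve_right this)

lemma VertexSystem.rotate {α β γ : ℝ} {u v w : ℂ} (hw : u + v + w = 1)
    (h : VertexSystem α β γ u v w) : VertexSystem β γ α v w u :=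
  IndicialSystem.rotate hw h

lemma VertexSystem.swap {α β γ : ℝ} {u v w : ℂ} (h : VertexSystem α β γ u v w) :
    VertexSystem γ β α w v u :=
  IndicialSystem.swap h

/-- The hypothesis `hβ0` orders the vertices: a second cusp, if there is only one more, is at ∞.
This leaves the cases of cusps at all vertices, at 0 and ∞, or at 0 alone. -/
lemma inTable_of_alpha_eq_zero {β γ : ℝ} (hβ : 0 ≤ β) (hγ : 0 ≤ γ) (hhyp : β + γ < 1) {u v w : ℂ}
    (hw : u + v + w = 1) (h : VertexSystem 0 β γ u v w) (hβ0 : β = 0 → γ = 0) :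
    InTable 0 β γ (6 * v) (6 * u) (6 * w) := by
  by_cases hb : β = 0
  · obtain rfl := hb
    obtain rfl := hβ0 rfl
    simp only [VertexSystem, Complex.ofReal_zero, ne_eq, OfNat.ofNat_ne_zero, not_false_eq_true,
      zero_pow, sub_zero] at h
    rw [inTable_iff]
    rcases h.eq_of_three_cusps hw with ⟨rfl, rfl, rfl⟩ | ⟨rfl, rfl, rfl⟩ | ⟨rfl, rfl, rfl⟩ |
      ⟨rfl, rfl, rfl⟩
    · left; convert TableRow.case6b using 1 <;> norm_num
    · left; convert TableRow.case6a using 1 <;> norm_num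
    · right; left; convert TableRow.case6a using 1 <;> norm_num
    · right; right; right; right; left; convert TableRow.case6a using 1 <;> norm_num
  have hv := (h.rotate hw).sq_eq hb
  by_cases hc : γ = 0
  · obtain rfl := hc
    have hv1 : v ≠ 1 := by
      intro hv1
      have := abs_re_of_sq_eq hβ hv
      rw [hv1] at this
      norm_num at this; linarith
    simp only [VertexSystem, hv, Complex.ofReal_zero, ne_eq, OfNat.ofNat_ne_zero, not_false_eq_true,
      zero_pow, sub_zero, sub_self, zero_div] at h
    rw [inTable_iff]
    rcases h.eq_of_two_cusps hw hv1 with ⟨rfl, rfl, rfl⟩ | ⟨rfl, rfl, rfl⟩ | ⟨rfl, rfl, rfl⟩ |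
      ⟨rfl, rfl, rfl⟩ | ⟨rfl, rfl, rfl⟩
    · obtain rfl := eq_of_sq_eq_ofReal_sq (c := 2 / 3) hβ (by norm_num) (by norm_num) hv
      left; convert TableRow.case5 using 1 <;> norm_num
    · obtain rfl := eq_of_sq_eq_ofReal_sq (c := 1 / 3) hβ (by norm_num) (by norm_num) hv
      left; convert TableRow.case4i using 1 <;> norm_num
    · obtain rfl := eq_of_sq_eq_ofReal_sq (c := 1 / 3) hβ (by norm_num) (by norm_num) hv
      left; convert TableRow.case4ii using 1 <;> norm_num
    · obtain rfl := eq_of_sq_eq_ofReal_sq (c := 1 / 2) hβ (by norm_num) (by norm_num) hv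
      left; convert TableRow.case3i using 1 <;> norm_num
    · obtain rfl := eq_of_sq_eq_ofReal_sq (c := 1 / 2) hβ (by norm_num) (by norm_num) hv
      left; convert TableRow.case3ii using 1 <;> norm_num
  · have hw2 := h.swap.sq_eq hc
    -- Otherwise 1 = v + w has real part at most β + γ < 1.
    have hu : u ≠ 0 := by
      rintro rfl
      have h1 := abs_re_of_sq_eq hβ hv
      have h2 := abs_re_of_sq_eq hγ hw2
      have := congrArg Complex.re hw
      simp at this
      linarith
    simp only [VertexSystem, hv, hw2, Complex.ofReal_zero, ne_eq, OfNat.ofNat_ne_zero,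
      not_false_eq_true, zero_pow, sub_zero, sub_self, zero_div] at h
    have h' := h.eq_of_one_cusp hw hu
    rw [inTable_iff]
    obtain rfl : u = 1 - v - w := by linear_combination hw
    rcases h' with ⟨rfl | rfl, rfl | rfl⟩
    · obtain rfl := eq_of_sq_eq_ofReal_sq (c := 1 / 2) hβ (by norm_num) (by norm_num) hv
      obtain rfl := eq_of_sq_eq_ofReal_sq (c := 1 / 2) hγ (by norm_num) (by norm_num) hw2
      norm_num at hhyp
    · obtain rfl := eq_of_sq_eq_ofReal_sq (c := 1 / 2) hβ (by norm_num) (by norm_num) hv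
      obtain rfl := eq_of_sq_eq_ofReal_sq (c := 1 / 3) hγ (by norm_num) (by norm_num) hw2
      left; convert TableRow.case1 using 1 <;> norm_num
    · obtain rfl := eq_of_sq_eq_ofReal_sq (c := 1 / 3) hβ (by norm_num) (by norm_num) hv
      obtain rfl := eq_of_sq_eq_ofReal_sq (c := 1 / 2) hγ (by norm_num) (by norm_num) hw2
      right; left; convert TableRow.case1 using 1 <;> norm_num
    · obtain rfl := eq_of_sq_eq_ofReal_sq (c := 1 / 3) hβ (by norm_num) (by norm_num) hv
      obtain rfl := eq_of_sq_eq_ofReal_sq (c := 1 / 3) hγ (by norm_num) (by norm_num) hw2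
      left; convert TableRow.case2 using 1 <;> norm_num

lemma inTable_of_vertexSystem {α β γ : ℝ} (hα : 0 ≤ α) (hβ : 0 ≤ β) (hγ : 0 ≤ γ)
    (hhyp : α + β + γ < 1) {u v w : ℂ} (hw : u + v + w = 1) (h : VertexSystem α β γ u v w) :
    InTable α β γ (6 * v) (6 * u) (6 * w) := by
  have hw' : v + w + u = 1 := by linear_combination hw
  have hw'' : w + u + v = 1 := by linear_combination hw
  have hws : w + v + u = 1 := by linear_combination hw
  by_cases ha : α = 0
  · subst ha
    by_cases hbc : β = 0 → γ = 0
    · exact inTable_of_alpha_eq_zero hβ hγ (by linarith) hw h hbc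
    · push Not at hbc
      have h' := (h.swap.rotate hws).rotate (by linear_combination hw)
      have := inTable_of_alpha_eq_zero hγ hβ (by linarith) (by linear_combination hw) h'
        (fun h0 => absurd h0 hbc.2)
      rw [← inTable_rotate, ← inTable_swap]
      exact this
  have hu := h.sq_eq ha
  by_cases hb : β = 0
  · subst hb
    have h' := h.rotate hw
    rw [← inTable_rotate]
    by_cases hc : γ = 0 → α = 0
    · exact inTable_of_alpha_eq_zero hγ hα (by linarith) hw' h' hc
    · push Not at hc
      by_cases hc' : γ = 0
      · have h'' := h.swap.rotate hws
        have := inTable_of_alpha_eq_zero hα hγ (by linarith) (by linear_combination hw) h''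
          (fun h0 => absurd h0 ha)
        simp only [inTable_iff] at this ⊢
        tauto
      · exact inTable_of_alpha_eq_zero hγ hα (by linarith) hw' h' (fun h0 => absurd h0 hc')
  have hv := (h.rotate hw).sq_eq hb
  by_cases hc : γ = 0
  · subst hc
    have h' := (h.rotate hw).rotate hw'
    have := inTable_of_alpha_eq_zero hα hβ (by linarith) hw'' h' (fun h0 => absurd h0 ha)
    rw [← inTable_rotate, ← inTable_rotate]
    exact this
  -- Without cusps all three squares are known, and 1 = Re (u + v + w) ≤ α + β + γ < 1.
  · have hw2 := h.swap.sq_eq hc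
    exfalso
    have h0 := abs_re_of_sq_eq hα hu
    have h1 := abs_re_of_sq_eq hβ hv
    have h2 := abs_re_of_sq_eq hγ hw2
    have := congrArg Complex.re hw
    simp at this
    linarith

lemma vertexSystem_iff {α β γ : ℝ} {a₁ a₂ a₃ : ℂ} (hp : a₁ + a₂ + a₃ = 6) :
    VertexSystem α β γ (a₂ / 6) (a₁ / 6) (a₃ / 6) ↔ ∀ x : ℂ, x ≠ 0 → x ≠ 1 →
      VSeq α β γ (1 - a₁ / 6) (1 - a₂ / 6) 2 x =
        12 * VSeq α β γ (1 - a₁ / 6) (1 - a₂ / 6) 0 x ^ 2 := by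
  have h3 : 1 - a₁ / 6 - a₂ / 6 = a₃ / 6 := by linear_combination -hp / 6
  have : VertexSystem α β γ (a₂ / 6) (a₁ / 6) (a₃ / 6) ↔
      IndicialSystem (a₂ / 6) (a₁ / 6) (a₃ / 6) (coeffZero α a₂) (coeffOne α β γ a₁ a₂)
        (coeffTwo γ a₁ a₂) := by
    simp only [coeffOne, coeffZero, coeffTwo, h3, VertexSystem]
  rw [this, indicialSystem_iff (by linear_combination hp / 6)]
  refine forall_congr' fun x => forall_congr' fun h0 => forall_congr' fun h1 => ?_
  rw [VSeq_identity_iff α β γ a₁ a₂ h0 h1]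

lemma TableRow.vertexSystem {α β γ : ℝ} {a₁ a₂ a₃ : ℂ} (h : TableRow α β γ a₁ a₂ a₃) :
    VertexSystem α β γ (a₂ / 6) (a₁ / 6) (a₃ / 6) := by
  cases h <;> norm_num [VertexSystem, IndicialSystem]

lemma TableRow.sum_eq {α β γ : ℝ} {a₁ a₂ a₃ : ℂ} (h : TableRow α β γ a₁ a₂ a₃) :
    a₁ + a₂ + a₃ = 6 := by
  cases h <;> norm_num

lemma TableRow.residues {α β γ : ℝ} {a₁ a₂ a₃ : ℂ} (h : TableRow α β γ a₁ a₂ a₃) :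
    (α ≠ 0 → a₂ = 6 * (α : ℂ)) ∧ (β ≠ 0 → a₁ = 6 * (β : ℂ)) ∧ (γ ≠ 0 → a₃ = 6 * (γ : ℂ)) := by
  cases h <;> norm_num

lemma InTable.residues {α β γ : ℝ} {a₁ a₂ a₃ : ℂ} (h : InTable α β γ a₁ a₂ a₃) :
    (α ≠ 0 → a₂ = 6 * (α : ℂ)) ∧ (β ≠ 0 → a₁ = 6 * (β : ℂ)) ∧ (γ ≠ 0 → a₃ = 6 * (γ : ℂ)) := by
  rw [inTable_iff] at h
  rcases h with h | h | h | h | h | h <;> have := h.residues <;> tauto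

lemma InTable.vertexSystem {α β γ : ℝ} {a₁ a₂ a₃ : ℂ} (h : InTable α β γ a₁ a₂ a₃) :
    VertexSystem α β γ (a₂ / 6) (a₁ / 6) (a₃ / 6) := by
  rw [inTable_iff] at h
  rcases h with h | h | h | h | h | h <;> have h' := h.vertexSystem <;> have hs := h.sum_eq
  · exact h'
  · exact (h'.swap.rotate (by linear_combination hs / 6)).rotate (by linear_combination hs / 6)
  · exact h'.swap.rotate (by linear_combination hs / 6)
  · exact h'.swap
  · exact (h'.rotate (by linear_combination hs / 6)).rotate (by linear_combination hs / 6)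
  · exact h'.rotate (by linear_combination hs / 6)

/-- The data at a cusp placed at `s = 0` that the continuation argument uses. -/
structure CuspData (α β γ : ℝ) (a₁ a₂ a₃ : ℂ) (k n : ℕ) (K : ℝ) : Prop where
  alpha_eq : α = 0
  pos : 0 < k
  ne_zero : K ≠ 0
  sum_eq : a₁ + a₂ + a₃ = 6
  a₁_real : a₁.im = 0
  a₂_eq : a₂ = k
  system : VertexSystem α β γ (a₂ / 6) (a₁ / 6) (a₃ / 6)
  discr : ∀ s, 8 * numer₂ (coeffZero α a₂) (coeffOne α β γ a₁ a₂) (coeffTwo γ a₁ a₂) s ^ 3 -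
    numer₃ (a₂ / 6) (a₁ / 6) (coeffZero α a₂) (coeffOne α β γ a₁ a₂) (coeffTwo γ a₁ a₂) s ^ 2 =
      K * s ^ k * (s - 1) ^ n

/-- Every row has its cusp at 0 with a positive integer a₂. In each of them 8 P³ - N², for the
numerators P, N of V₂, V₃, turns out to vanish only at 0 and 1, to the orders k = a₂ and n = a₁,
like a modular discriminant; K is read off from the expansion. -/
lemma TableRow.cuspData {α β γ : ℝ} {a₁ a₂ a₃ : ℂ} (h : TableRow α β γ a₁ a₂ a₃) :
    ∃ k n K, CuspData α β γ a₁ a₂ a₃ k n K := by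
  have hv := h.vertexSystem
  have hs := h.sum_eq
  cases h
  · exact ⟨1, 3, -1 / 46656, rfl, by norm_num, by norm_num, hs, by norm_num, by norm_num,
      hv, fun s => by norm_num [numer₂, numer₃, coeffZero, coeffOne, coeffTwo]; ring⟩
  · exact ⟨2, 2, -1 / 2916, rfl, by norm_num, by norm_num, hs, by norm_num, by norm_num,
      hv, fun s => by norm_num [numer₂, numer₃, coeffZero, coeffOne, coeffTwo]; ring⟩
  · exact ⟨2, 3, -1 / 1728, rfl, by norm_num, by norm_num, hs, by norm_num, by norm_num,
      hv, fun s => by norm_num [numer₂, numer₃, coeffZero, coeffOne, coeffTwo]; ring⟩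
  · exact ⟨1, 3, 1 / 1728, rfl, by norm_num, by norm_num, hs, by norm_num, by norm_num,
      hv, fun s => by norm_num [numer₂, numer₃, coeffZero, coeffOne, coeffTwo]; ring⟩
  · exact ⟨3, 2, -1 / 729, rfl, by norm_num, by norm_num, hs, by norm_num, by norm_num,
      hv, fun s => by norm_num [numer₂, numer₃, coeffZero, coeffOne, coeffTwo]; ring⟩
  · exact ⟨1, 2, -1 / 729, rfl, by norm_num, by norm_num, hs, by norm_num, by norm_num,
      hv, fun s => by norm_num [numer₂, numer₃, coeffZero, coeffOne, coeffTwo]; ring⟩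
  · exact ⟨1, 4, -1 / 11664, rfl, by norm_num, by norm_num, hs, by norm_num, by norm_num,
      hv, fun s => by norm_num [numer₂, numer₃, coeffZero, coeffOne, coeffTwo]; ring⟩
  · exact ⟨1, 1, 1 / 432, rfl, by norm_num, by norm_num, hs, by norm_num, by norm_num,
      hv, fun s => by norm_num [numer₂, numer₃, coeffZero, coeffOne, coeffTwo]; ring⟩
  · exact ⟨2, 2, 1 / 108, rfl, by norm_num, by norm_num, hs, by norm_num, by norm_num,
      hv, fun s => by norm_num [numer₂, numer₃, coeffZero, coeffOne, coeffTwo]; ring⟩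

/-- The rows with the vertices at 1 and ∞ interchanged. Treating them here leaves only cyclic
permutations, which move the cusp to 0, for the analytic part. -/
lemma TableRow.cuspData_swap {α β γ : ℝ} {a₁ a₂ a₃ : ℂ} (h : TableRow α γ β a₃ a₂ a₁) :
    ∃ k n K, CuspData α β γ a₁ a₂ a₃ k n K := by
  have hs : a₁ + a₂ + a₃ = 6 := by linear_combination h.sum_eq
  have hv : VertexSystem α β γ (a₂ / 6) (a₁ / 6) (a₃ / 6) :=
    (h.vertexSystem.swap.rotate (by linear_combination hs / 6)).rotate
      (by linear_combination hs / 6)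
  cases h
  · exact ⟨1, 2, -1 / 46656, rfl, by norm_num, by norm_num, hs, by norm_num, by norm_num,
      hv, fun s => by norm_num [numer₂, numer₃, coeffZero, coeffOne, coeffTwo]; ring⟩
  · exact ⟨2, 2, -1 / 2916, rfl, by norm_num, by norm_num, hs, by norm_num, by norm_num,
      hv, fun s => by norm_num [numer₂, numer₃, coeffZero, coeffOne, coeffTwo]; ring⟩
  · exact ⟨2, 1, -1 / 1728, rfl, by norm_num, by norm_num, hs, by norm_num, by norm_num,
      hv, fun s => by norm_num [numer₂, numer₃, coeffZero, coeffOne, coeffTwo]; ring⟩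
  · exact ⟨1, 2, 1 / 1728, rfl, by norm_num, by norm_num, hs, by norm_num, by norm_num,
      hv, fun s => by norm_num [numer₂, numer₃, coeffZero, coeffOne, coeffTwo]; ring⟩
  · exact ⟨3, 1, -1 / 729, rfl, by norm_num, by norm_num, hs, by norm_num, by norm_num,
      hv, fun s => by norm_num [numer₂, numer₃, coeffZero, coeffOne, coeffTwo]; ring⟩
  · exact ⟨1, 3, -1 / 729, rfl, by norm_num, by norm_num, hs, by norm_num, by norm_num,
      hv, fun s => by norm_num [numer₂, numer₃, coeffZero, coeffOne, coeffTwo]; ring⟩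
  · exact ⟨1, 1, -1 / 11664, rfl, by norm_num, by norm_num, hs, by norm_num, by norm_num,
      hv, fun s => by norm_num [numer₂, numer₃, coeffZero, coeffOne, coeffTwo]; ring⟩
  · exact ⟨1, 4, 1 / 432, rfl, by norm_num, by norm_num, hs, by norm_num, by norm_num,
      hv, fun s => by norm_num [numer₂, numer₃, coeffZero, coeffOne, coeffTwo]; ring⟩
  · exact ⟨2, 2, 1 / 108, rfl, by norm_num, by norm_num, hs, by norm_num, by norm_num,
      hv, fun s => by norm_num [numer₂, numer₃, coeffZero, coeffOne, coeffTwo]; ring⟩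

lemma InTable.exists_cuspData {α β γ : ℝ} {a₁ a₂ a₃ : ℂ} (h : InTable α β γ a₁ a₂ a₃) :
    ∃ k n K, CuspData α β γ a₁ a₂ a₃ k n K ∨ CuspData β γ α a₃ a₁ a₂ k n K ∨
      CuspData γ α β a₂ a₃ a₁ k n K := by
  rw [inTable_iff] at h
  rcases h with h | h | h | h | h | h
  · obtain ⟨k, n, K, h⟩ := h.cuspData; exact ⟨k, n, K, .inl h⟩
  · obtain ⟨k, n, K, h⟩ := h.cuspData_swap; exact ⟨k, n, K, .inl h⟩
  · obtain ⟨k, n, K, h⟩ := h.cuspData_swap; exact ⟨k, n, K, .inr (.inl h)⟩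
  · obtain ⟨k, n, K, h⟩ := h.cuspData_swap; exact ⟨k, n, K, .inr (.inr h)⟩
  · obtain ⟨k, n, K, h⟩ := h.cuspData; exact ⟨k, n, K, .inr (.inl h)⟩
  · obtain ⟨k, n, K, h⟩ := h.cuspData; exact ⟨k, n, K, .inr (.inr h)⟩


/-! ### The Chazy equation as a first-order system -/

/-- The first-order system satisfied by `y` and its covariants `f₄, f₆, f₈`. -/
def CovariantSystem (y f₄ f₆ f₈ : ℂ → ℂ) (U : Set ℂ) : Prop :=
  ∀ z ∈ U, HasDerivAt y (y z ^ 2 / 6 - 3 * f₄ z) z ∧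
    HasDerivAt f₄ (f₆ z + 2 / 3 * y z * f₄ z) z ∧ HasDerivAt f₆ (f₈ z + y z * f₆ z) z

/-- Differentiating y' = y²/6 - 3 f₄ twice and inserting the system leaves f₈ - 12 f₄² as the only
defect. -/
lemma CovariantSystem.chazy {y f₄ f₆ f₈ : ℂ → ℂ} {U : Set ℂ} (hU : IsOpen U)
    (h : CovariantSystem y f₄ f₆ f₈ U) {z : ℂ} (hz : z ∈ U) :
    deriv (deriv (deriv y)) z - (2 * y z * deriv (deriv y) z - 3 * deriv y z ^ 2) =
      -3 * (f₈ z - 12 * f₄ z ^ 2) := by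
  have hd1 : ∀ z ∈ U, deriv y z = y z ^ 2 / 6 - 3 * f₄ z := fun z hz => (h z hz).1.deriv
  have hd2 : ∀ z ∈ U, deriv (deriv y) z =
      y z * (y z ^ 2 / 6 - 3 * f₄ z) / 3 - 3 * (f₆ z + 2 / 3 * y z * f₄ z) := by
    intro z hz
    have hev : deriv y =ᶠ[𝓝 z] fun z => y z ^ 2 / 6 - 3 * f₄ z := by
      filter_upwards [hU.mem_nhds hz] with x hx using hd1 x hx
    rw [hev.deriv_eq]
    have := (((h z hz).1.pow 2).div_const 6).sub ((h z hz).2.1.const_mul 3)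
    refine (this.congr_deriv ?_).deriv
    simp; ring
  have hd3 : deriv (deriv (deriv y)) z =
      ((y z ^ 2 / 6 - 3 * f₄ z) * (y z ^ 2 / 6 - 3 * f₄ z) + y z * (y z *
        (y z ^ 2 / 6 - 3 * f₄ z) / 3 - 3 * (f₆ z + 2 / 3 * y z * f₄ z))) / 3 -
        3 * ((f₈ z + y z * f₆ z) + 2 / 3 * (y z ^ 2 / 6 - 3 * f₄ z) * f₄ z +
          2 / 3 * y z * (f₆ z + 2 / 3 * y z * f₄ z)) := by
    have hev : deriv (deriv y) =ᶠ[𝓝 z] fun z =>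
        y z * (y z ^ 2 / 6 - 3 * f₄ z) / 3 - 3 * (f₆ z + 2 / 3 * y z * f₄ z) := by
      filter_upwards [hU.mem_nhds hz] with x hx using hd2 x hx
    rw [hev.deriv_eq]
    obtain ⟨hy, h4, h6⟩ := h z hz
    have := ((hy.mul (((hy.pow 2).div_const 6).sub (h4.const_mul 3))).div_const 3).sub
      ((h6.add ((hy.const_mul (2 / 3)).mul h4)).const_mul 3)
    refine (this.congr_deriv ?_).deriv
    simp; ring
  rw [hd3, hd2 z hz, hd1 z hz]
  ring

lemma CovariantSystem.isChazySolutionOn {y f₄ f₆ f₈ : ℂ → ℂ} {U : Set ℂ} (hU : IsOpen U)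
    (h : CovariantSystem y f₄ f₆ f₈ U) (h8 : ∀ z ∈ U, f₈ z = 12 * f₄ z ^ 2) :
    IsChazySolutionOn y U := by
  refine ⟨fun z hz => (h z hz).1.differentiableAt.differentiableWithinAt, fun z hz => ?_⟩
  have := h.chazy hU hz
  rw [h8 z hz] at this
  linear_combination this

/-! ### Fractional linear transformations -/

lemma hasDerivAt_moebius (M : GL (Fin 2) ℂ) {z : ℂ} (hz : M 1 0 * z + M 1 1 ≠ 0) :
    HasDerivAt (moebius M) (M.1.det / (M 1 0 * z + M 1 1) ^ 2) z := by
  have hn : HasDerivAt (fun z : ℂ => M 0 0 * z + M 0 1) (M 0 0) z := by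
    simpa using ((hasDerivAt_id z).const_mul (M 0 0)).add_const (M 0 1)
  have hd : HasDerivAt (fun z : ℂ => M 1 0 * z + M 1 1) (M 1 0) z := by
    simpa using ((hasDerivAt_id z).const_mul (M 1 0)).add_const (M 1 1)
  refine (hn.div hd hz).congr_deriv ?_
  rw [Matrix.det_fin_two]
  congr 1
  ring

lemma det_ne_zero (M : GL (Fin 2) ℂ) : M.1.det ≠ 0 := by
  have := M.det.ne_zero
  simpa using this

/-- The derivative of `moebius M`. -/
def moebiusDeriv (M : GL (Fin 2) ℂ) (z : ℂ) : ℂ := M.1.det / (M 1 0 * z + M 1 1) ^ 2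

/-- The logarithmic derivative of `moebiusDeriv M`. -/
def moebiusNonlin (M : GL (Fin 2) ℂ) (z : ℂ) : ℂ := -2 * M 1 0 / (M 1 0 * z + M 1 1)

lemma moebiusDeriv_ne_zero (M : GL (Fin 2) ℂ) {z : ℂ} (hz : M 1 0 * z + M 1 1 ≠ 0) :
    moebiusDeriv M z ≠ 0 :=
  div_ne_zero (det_ne_zero M) (pow_ne_zero 2 hz)

lemma hasDerivAt_moebiusDeriv (M : GL (Fin 2) ℂ) {z : ℂ} (hz : M 1 0 * z + M 1 1 ≠ 0) :
    HasDerivAt (moebiusDeriv M) (moebiusNonlin M z * moebiusDeriv M z) z := by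
  have hd : HasDerivAt (fun z : ℂ => M 1 0 * z + M 1 1) (M 1 0) z := by
    simpa using ((hasDerivAt_id z).const_mul (M 1 0)).add_const (M 1 1)
  refine ((hasDerivAt_const z M.1.det).div (hd.pow 2) (pow_ne_zero 2 hz)).congr_deriv ?_
  simp only [moebiusNonlin, moebiusDeriv]
  field_simp
  simp
  ring

lemma hasDerivAt_moebiusNonlin (M : GL (Fin 2) ℂ) {z : ℂ} (hz : M 1 0 * z + M 1 1 ≠ 0) :
    HasDerivAt (moebiusNonlin M) (moebiusNonlin M z ^ 2 / 2) z := by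
  have hd : HasDerivAt (fun z : ℂ => M 1 0 * z + M 1 1) (M 1 0) z := by
    simpa using ((hasDerivAt_id z).const_mul (M 1 0)).add_const (M 1 1)
  refine ((hasDerivAt_const z (-2 * M 1 0)).div hd hz).congr_deriv ?_
  simp only [moebiusNonlin]
  field_simp
  ring

lemma isOpen_denom_ne_zero (M : GL (Fin 2) ℂ) : IsOpen {z : ℂ | M 1 0 * z + M 1 1 ≠ 0} :=
  isOpen_ne_fun (by fun_prop) continuous_const

lemma isOpen_pullback (M : GL (Fin 2) ℂ) {U : Set ℂ} (hU : IsOpen U) : IsOpen (pullback M U) := by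
  rw [isOpen_iff_mem_nhds]
  rintro z ⟨hz, hzU⟩
  filter_upwards [(isOpen_denom_ne_zero M).mem_nhds hz,
    (hasDerivAt_moebius M hz).continuousAt.preimage_mem_nhds (hU.mem_nhds hzU)] with x hx hx'
  exact ⟨hx, hx'⟩

/-- The transform of `Y` under `M`, which preserves the Chazy equation. -/
def chazyTransform (M : GL (Fin 2) ℂ) (Y : ℂ → ℂ) (z : ℂ) : ℂ :=
  Y (moebius M z) * moebiusDeriv M z + 3 * moebiusNonlin M z

/-- The functions f₄, f₆, f₈ have weights 4, 6, 8, while y has weight 2 up to the term 3 M''/M'. The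
extra terms cancel because (M''/M')' = (M''/M')²/2 for a fractional linear M. -/
lemma CovariantSystem.transform {y f₄ f₆ f₈ : ℂ → ℂ} {U : Set ℂ}
    (h : CovariantSystem y f₄ f₆ f₈ U) (M : GL (Fin 2) ℂ) :
    CovariantSystem (chazyTransform M y) (fun z => f₄ (moebius M z) * moebiusDeriv M z ^ 2)
      (fun z => f₆ (moebius M z) * moebiusDeriv M z ^ 3)
      (fun z => f₈ (moebius M z) * moebiusDeriv M z ^ 4) (pullback M U) := by
  rintro z ⟨hz, hzU⟩
  obtain ⟨hy, h4, h6⟩ := h _ hzU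
  have hM := hasDerivAt_moebius M hz
  have hD := hasDerivAt_moebiusDeriv M hz
  have hG := hasDerivAt_moebiusNonlin M hz
  have e : M.1.det / (M 1 0 * z + M 1 1) ^ 2 = moebiusDeriv M z := rfl
  refine ⟨?_, ?_, ?_⟩
  · refine (((hy.comp z hM).mul hD).add (hG.const_mul 3)).congr_deriv ?_
    simp only [chazyTransform, Function.comp_apply, e]
    ring
  · refine ((h4.comp z hM).mul (hD.pow 2)).congr_deriv ?_
    simp only [chazyTransform, Function.comp_apply, e]
    simp
    ring
  · refine ((h6.comp z hM).mul (hD.pow 3)).congr_deriv ?_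
    simp only [chazyTransform, Function.comp_apply, e]
    simp
    ring

/-! ### Schwarz maps and the triangle function -/

/-- The pre-Schwarzian derivative `Z'' / Z'`. -/
def nonlin (Z : ℂ → ℂ) (s : ℂ) : ℂ := deriv (deriv Z) s / deriv Z s

/-- `Z` is holomorphic and locally injective on `U` with Schwarzian derivative `W / 2`. -/
structure HasSchwarzian (W Z : ℂ → ℂ) (U : Set ℂ) : Prop where
  diff : DifferentiableOn ℂ Z U
  deriv_ne : ∀ s ∈ U, deriv Z s ≠ 0
  eqn : ∀ s ∈ U, HasDerivAt (nonlin Z) (nonlin Z s ^ 2 / 2 + W s / 2) s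

lemma isOpen_uhp : IsOpen upperHalfPlaneSet := UpperHalfPlane.isOpen_upperHalfPlaneSet

lemma ne_zero_of_mem {s : ℂ} (hs : s ∈ upperHalfPlaneSet) : s ≠ 0 := by
  rintro rfl; simp at hs

lemma ne_one_of_mem {s : ℂ} (hs : s ∈ upperHalfPlaneSet) : s ≠ 1 := by
  rintro rfl; simp at hs

lemma hasDerivAt_of_diff {f : ℂ → ℂ} {U : Set ℂ} (hU : IsOpen U) (h : DifferentiableOn ℂ f U)
    {s : ℂ} (hs : s ∈ U) : HasDerivAt f (deriv f s) s :=
  (h.differentiableAt (hU.mem_nhds hs)).hasDerivAt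

lemma HasSchwarzian.hasDerivAt {W Z : ℂ → ℂ} {U : Set ℂ} (hU : IsOpen U)
    (h : HasSchwarzian W Z U) {s : ℂ} (hs : s ∈ U) : HasDerivAt Z (deriv Z s) s :=
  hasDerivAt_of_diff hU h.diff hs

lemma HasSchwarzian.hasDerivAt_deriv {W Z : ℂ → ℂ} {U : Set ℂ} (hU : IsOpen U)
    (h : HasSchwarzian W Z U) {s : ℂ} (hs : s ∈ U) :
    HasDerivAt (deriv Z) (nonlin Z s * deriv Z s) s := by
  have := hasDerivAt_of_diff hU (h.diff.deriv hU) hs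
  rwa [nonlin, div_mul_cancel₀ _ (h.deriv_ne s hs)]

/-- The Wronskian is constant, so Z' is a constant multiple of u₂⁻² and Z''/Z' = -2 u₂'/u₂; the
equation for u₂ becomes the Riccati equation. -/
lemma IsSchwarzMap.hasSchwarzian {α β γ : ℝ} {Z : ℂ → ℂ} (h : IsSchwarzMap α β γ Z) :
    HasSchwarzian (V α β γ) Z upperHalfPlaneSet := by
  obtain ⟨u₁, u₂, ⟨hd1, he1⟩, ⟨hd2, he2⟩, hW, hu2, hZ⟩ := h.ratio
  set W : ℂ → ℂ := fun s => u₁ s * deriv u₂ s - deriv u₁ s * u₂ s with hWdef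
  have hO := isOpen_uhp
  have h1 : ∀ s ∈ upperHalfPlaneSet, HasDerivAt u₁ (deriv u₁ s) s :=
    fun s hs => hasDerivAt_of_diff hO hd1 hs
  have h2 : ∀ s ∈ upperHalfPlaneSet, HasDerivAt u₂ (deriv u₂ s) s :=
    fun s hs => hasDerivAt_of_diff hO hd2 hs
  have h1' : ∀ s ∈ upperHalfPlaneSet, HasDerivAt (deriv u₁) (-(V α β γ s / 4 * u₁ s)) s :=
    fun s hs => (hasDerivAt_of_diff hO (hd1.deriv hO) hs).congr_deriv
      (by linear_combination he1 s hs)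
  have h2' : ∀ s ∈ upperHalfPlaneSet, HasDerivAt (deriv u₂) (-(V α β γ s / 4 * u₂ s)) s :=
    fun s hs => (hasDerivAt_of_diff hO (hd2.deriv hO) hs).congr_deriv
      (by linear_combination he2 s hs)
  have hWd : ∀ s ∈ upperHalfPlaneSet, HasDerivAt W 0 s := fun s hs =>
    (((h1 s hs).mul (h2' s hs)).sub ((h1' s hs).mul (h2 s hs))).congr_deriv (by ring)
  have hZd : ∀ s ∈ upperHalfPlaneSet, HasDerivAt Z (-W s / u₂ s ^ 2) s := by
    intro s hs
    have hev : Z =ᶠ[𝓝 s] fun s => u₁ s / u₂ s := by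
      filter_upwards [hO.mem_nhds hs] with x hx using hZ x hx
    refine HasDerivAt.congr_of_eventuallyEq ?_ hev
    refine ((h1 s hs).div (h2 s hs) (hu2 s hs)).congr_deriv ?_
    simp only [hWdef]; ring
  have hZd' : ∀ s ∈ upperHalfPlaneSet,
      HasDerivAt (deriv Z) (2 * W s * deriv u₂ s / u₂ s ^ 3) s := by
    intro s hs
    have hev : deriv Z =ᶠ[𝓝 s] fun s => -W s / u₂ s ^ 2 := by
      filter_upwards [hO.mem_nhds hs] with x hx using (hZd x hx).deriv
    refine HasDerivAt.congr_of_eventuallyEq ?_ hev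
    have := hu2 s hs
    refine ((hWd s hs).neg.div ((h2 s hs).pow 2) (pow_ne_zero 2 this)).congr_deriv ?_
    field_simp
    simp
    ring
  have hnl : ∀ s ∈ upperHalfPlaneSet, nonlin Z s = -2 * deriv u₂ s / u₂ s := by
    intro s hs
    have := hu2 s hs
    have := hW s hs
    change W s ≠ 0 at this
    rw [nonlin, (hZd' s hs).deriv, (hZd s hs).deriv]
    field_simp
  refine ⟨fun s hs => (hZd s hs).differentiableAt.differentiableWithinAt, fun s hs => ?_,
    fun s hs => ?_⟩
  · rw [(hZd s hs).deriv]
    exact div_ne_zero (neg_ne_zero.2 (hW s hs)) (pow_ne_zero 2 (hu2 s hs))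
  · have hev : nonlin Z =ᶠ[𝓝 s] fun s => -2 * deriv u₂ s / u₂ s := by
      filter_upwards [hO.mem_nhds hs] with x hx using hnl x hx
    refine HasDerivAt.congr_of_eventuallyEq ?_ hev
    have := hu2 s hs
    refine ((((h2' s hs)).const_mul (-2)).div (h2 s hs) this).congr_deriv ?_
    rw [hnl s hs]
    field_simp
    ring

/-- `s` is a holomorphic local inverse of `Z` in the sense that `Z ∘ s = moebius M` on `T`. -/
structure IsInverseOn (M : GL (Fin 2) ℂ) (Z s : ℂ → ℂ) (T : Set ℂ) : Prop where
  isOpen : IsOpen T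
  denom_ne : ∀ z ∈ T, M 1 0 * z + M 1 1 ≠ 0
  mem : ∀ z ∈ T, s z ∈ upperHalfPlaneSet
  hasDerivAt : ∀ z ∈ T, HasDerivAt s (moebiusDeriv M z / deriv Z (s z)) z

lemma isOpen_image_of_hasSchwarzian {W Z : ℂ → ℂ} {U : Set ℂ} (hU : IsOpen U)
    (h : HasSchwarzian W Z U) : IsOpen (Z '' U) := by
  rw [isOpen_iff_mem_nhds]
  rintro _ ⟨s, hs, rfl⟩
  have ha : AnalyticAt ℂ Z s := h.diff.analyticAt (hU.mem_nhds hs)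
  have hst := ha.hasStrictDerivAt
  rw [← hst.map_nhds_eq (h.deriv_ne s hs)]
  exact image_mem_map (hU.mem_nhds hs)

lemma IsTriangleFunction.isInverseOn {α β γ : ℝ} {g : GL (Fin 2) ℂ} {Z s : ℂ → ℂ}
    (h : IsTriangleFunction α β γ g Z s) : IsInverseOn g Z s (triangleT g Z) := by
  obtain ⟨hZ, hs⟩ := h
  have hS := hZ.hasSchwarzian
  have hopen : IsOpen (triangleT g Z) :=
    isOpen_pullback g (isOpen_image_of_hasSchwarzian isOpen_uhp hS)
  refine ⟨hopen, fun z hz => hz.1, fun z hz => (hs z hz).1, fun z hz => ?_⟩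
  obtain ⟨hsz, hZs⟩ := hs z hz
  have hst : HasStrictDerivAt Z (deriv Z (s z)) (s z) :=
    (hS.diff.analyticAt (isOpen_uhp.mem_nhds hsz)).hasStrictDerivAt
  have hne := hS.deriv_ne _ hsz
  -- The derivative of s is obtained from the local inverse ζ of Z: near z, global injectivity of Z
  -- forces s = ζ ∘ `moebius g`. No continuity of s has to be assumed.
  set ζ := hst.localInverse Z _ _ hne with hζ
  have hζd : HasDerivAt ζ (deriv Z (s z))⁻¹ (moebius g z) := by
    rw [← hZs]; exact (hst.to_localInverse hne).hasDerivAt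
  have hζ0 : ζ (moebius g z) = s z := by
    rw [← hZs]; exact HasStrictFDerivAt.localInverse_apply_image _
  have hM := hasDerivAt_moebius g hz.1
  have hcomp := hζd.comp z hM
  refine (hcomp.congr_of_eventuallyEq ?_).congr_deriv
    (by rw [moebiusDeriv]; ring)
  have hr : ∀ᶠ w in 𝓝 (moebius g z), Z (ζ w) = w := by
    rw [← hZs]; exact HasStrictFDerivAt.eventually_right_inverse _
  have hmem : ∀ᶠ w in 𝓝 (moebius g z), ζ w ∈ upperHalfPlaneSet := by
    apply hζd.continuousAt.eventually_mem
    rw [hζ0]; exact isOpen_uhp.mem_nhds hsz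
  filter_upwards [hM.continuousAt.eventually hr, hM.continuousAt.eventually hmem,
    hopen.mem_nhds hz] with x hx hx' hxT
  refine hZ.injOn (hs x hxT).1 hx' ?_
  rw [(hs x hxT).2]
  exact hx.symm

section Inverse

variable {M : GL (Fin 2) ℂ} {W Z s : ℂ → ℂ} {T : Set ℂ}

/-- The logarithmic derivative of `s'`, expressed through `Z` and `M`. -/
def logDerivInverse (M : GL (Fin 2) ℂ) (Z s : ℂ → ℂ) (z : ℂ) : ℂ :=
  moebiusNonlin M z - nonlin Z (s z) * deriv s z

lemma IsInverseOn.hasDerivAt' (h : IsInverseOn M Z s T) {z : ℂ} (hz : z ∈ T) :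
    HasDerivAt s (deriv s z) z :=
  (h.hasDerivAt z hz).differentiableAt.hasDerivAt

lemma IsInverseOn.deriv_ne (h : IsInverseOn M Z s T) (hZ : HasSchwarzian W Z upperHalfPlaneSet)
    {z : ℂ} (hz : z ∈ T) : deriv s z ≠ 0 := by
  rw [(h.hasDerivAt z hz).deriv]
  exact div_ne_zero (moebiusDeriv_ne_zero M (h.denom_ne z hz)) (hZ.deriv_ne _ (h.mem z hz))

lemma IsInverseOn.hasDerivAt_deriv (h : IsInverseOn M Z s T)
    (hZ : HasSchwarzian W Z upperHalfPlaneSet) {z : ℂ} (hz : z ∈ T) :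
    HasDerivAt (deriv s) (logDerivInverse M Z s z * deriv s z) z := by
  have hev : deriv s =ᶠ[𝓝 z] fun z => moebiusDeriv M z / deriv Z (s z) := by
    filter_upwards [h.isOpen.mem_nhds hz] with x hx using (h.hasDerivAt x hx).deriv
  refine HasDerivAt.congr_of_eventuallyEq ?_ hev
  have hne := hZ.deriv_ne _ (h.mem z hz)
  have hc : HasDerivAt (fun z => deriv Z (s z)) _ z :=
    (hZ.hasDerivAt_deriv isOpen_uhp (h.mem z hz)).comp z (h.hasDerivAt' hz)
  refine ((hasDerivAt_moebiusDeriv M (h.denom_ne z hz)).div hc hne).congr_deriv ?_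
  rw [logDerivInverse, (h.hasDerivAt z hz).deriv]
  field_simp

/-- The Schwarzian equation of the inverse: {s, z} = -{Z, s} s'², the outer map M contributing
nothing. -/
lemma IsInverseOn.hasDerivAt_logDerivInverse (h : IsInverseOn M Z s T)
    (hZ : HasSchwarzian W Z upperHalfPlaneSet) {z : ℂ} (hz : z ∈ T) :
    HasDerivAt (logDerivInverse M Z s)
      (logDerivInverse M Z s z ^ 2 / 2 - W (s z) / 2 * deriv s z ^ 2) z := by
  have hc : HasDerivAt (fun z => nonlin Z (s z)) _ z :=
    (hZ.eqn _ (h.mem z hz)).comp z (h.hasDerivAt' hz)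
  refine ((hasDerivAt_moebiusNonlin M (h.denom_ne z hz)).sub
    (hc.mul (h.hasDerivAt_deriv hZ hz))).congr_deriv ?_
  simp only [logDerivInverse]
  ring

lemma logDeriv_div_of_hasDerivAt {f g : ℂ → ℂ} {f' g' z : ℂ} (hf : HasDerivAt f f' z)
    (hg : HasDerivAt g g' z) (hf0 : f z ≠ 0) (hg0 : g z ≠ 0) :
    logDeriv (fun z => f z / g z) z = f' / f z - g' / g z := by
  rw [logDeriv_div z hf0 hg0 hf.differentiableAt hg.differentiableAt, logDeriv_apply,
    logDeriv_apply, hf.deriv, hg.deriv]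

/-- The coefficient of s''/s' is (a₁ + a₂ + a₃)/2 = 3; the remaining terms collect to -3 q(s) s'. -/
lemma IsInverseOn.y_eq (h : IsInverseOn M Z s T) (hZ : HasSchwarzian W Z upperHalfPlaneSet)
    {a₁ a₂ a₃ : ℂ} (hp : a₁ + a₂ + a₃ = 6) {z : ℂ} (hz : z ∈ T) :
    y a₁ a₂ a₃ s z =
      3 * (logDerivInverse M Z s z - q (1 - a₁ / 6) (1 - a₂ / 6) (s z) * deriv s z) := by
  have h0 := ne_zero_of_mem (h.mem z hz)
  have h1 := sub_ne_zero.2 (ne_one_of_mem (h.mem z hz))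
  have hd := h.deriv_ne hZ hz
  have hs := h.hasDerivAt' hz
  have hs' := h.hasDerivAt_deriv hZ hz
  have hm : HasDerivAt (fun z => s z * (s z - 1)) _ z := hs.mul (hs.sub_const 1)
  rw [y, w₁, w₂, w₃, logDeriv_div_of_hasDerivAt hs' hs hd h0,
    logDeriv_div_of_hasDerivAt hs' (hs.sub_const 1) hd h1,
    logDeriv_div_of_hasDerivAt hs' hm hd (mul_ne_zero h0 h1), q]
  obtain rfl : a₃ = 6 - a₁ - a₂ := by linear_combination hp
  field_simp
  ring

lemma IsInverseOn.y_eq_logDeriv (h : IsInverseOn M Z s T)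
    (hZ : HasSchwarzian W Z upperHalfPlaneSet)
    {a₁ a₂ a₃ : ℂ} (hp : a₁ + a₂ + a₃ = 6) {z : ℂ} (hz : z ∈ T) :
    y a₁ a₂ a₃ s z = 3 * logDeriv (φ (1 - a₁ / 6) (1 - a₂ / 6) s) z := by
  have h0 := ne_zero_of_mem (h.mem z hz)
  have h1 := sub_ne_zero.2 (ne_one_of_mem (h.mem z hz))
  have hd := h.deriv_ne hZ hz
  have hs := h.hasDerivAt' hz
  have hs' := h.hasDerivAt_deriv hZ hz
  have hm : (0 : ℝ) < (s z).im := h.mem z hz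
  have hsl : s z ∈ Complex.slitPlane := Complex.mem_slitPlane_iff.2 (.inr hm.ne')
  have hsl1 : s z - 1 ∈ Complex.slitPlane :=
    Complex.mem_slitPlane_iff.2 (.inr (by simpa using hm.ne'))
  have e1 := (hs.sub_const 1).cpow (hasDerivAt_const z (1 - a₁ / 6)) hsl1
  have e2 := hs.cpow (hasDerivAt_const z (1 - a₂ / 6)) hsl
  have n1 : (s z - 1) ^ (1 - a₁ / 6) ≠ 0 := by simp [Complex.cpow_eq_zero_iff, h1]
  have n2 : (s z) ^ (1 - a₂ / 6) ≠ 0 := by simp [Complex.cpow_eq_zero_iff, h0]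
  have := logDeriv_div_of_hasDerivAt hs' (e1.mul e2) hd (mul_ne_zero n1 n2)
  have hphi : φ (1 - a₁ / 6) (1 - a₂ / 6) s = fun z => deriv s z /
    ((fun z => (s z - 1) ^ (1 - a₁ / 6)) * fun z => s z ^ (1 - a₂ / 6)) z := rfl
  rw [h.y_eq hZ hp hz, hphi, this, q]
  simp only [Pi.mul_apply]
  have p1 : (s z - 1) ^ (1 - a₁ / 6 - 1) = (s z - 1) ^ (1 - a₁ / 6) / (s z - 1) := by
    rw [Complex.cpow_sub _ _ h1, Complex.cpow_one]
  have p2 : (s z) ^ (1 - a₂ / 6 - 1) = (s z) ^ (1 - a₂ / 6) / s z := by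
    rw [Complex.cpow_sub _ _ h0, Complex.cpow_one]
  rw [p1, p2]
  generalize (s z - 1) ^ (1 - a₁ / 6) = A at n1 ⊢
  generalize (s z) ^ (1 - a₂ / 6) = B at n2 ⊢
  field_simp
  ring

/-- If `Z` pulls the function `E` back to `-3 (Z''/Z' + q) / Z'`, then `y` is a transform
of `E`. -/
lemma IsInverseOn.y_eq_chazyTransform (h : IsInverseOn M Z s T)
    (hZ : HasSchwarzian W Z upperHalfPlaneSet)
    {a₁ a₂ a₃ : ℂ} (hp : a₁ + a₂ + a₃ = 6) {E : ℂ → ℂ} {z : ℂ} (hz : z ∈ T)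
    (hE : E (moebius M z) * deriv Z (s z) =
      -3 * (nonlin Z (s z) + q (1 - a₁ / 6) (1 - a₂ / 6) (s z))) :
    y a₁ a₂ a₃ s z = chazyTransform M E z := by
  have hne := hZ.deriv_ne _ (h.mem z hz)
  have hE' : E (moebius M z) =
      -3 * (nonlin Z (s z) + q (1 - a₁ / 6) (1 - a₂ / 6) (s z)) / deriv Z (s z) := by
    rw [eq_div_iff hne, hE]
  rw [h.y_eq hZ hp hz, chazyTransform, hE', logDerivInverse, (h.hasDerivAt z hz).deriv]
  field_simp
  ring

/-- The recursion V_{n+1} = V_n' + n q V_n is designed for this: differentiating V_n(s) s'ⁿ produces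
n (s''/s') = n (y/3 + q(s) s'), whose q-part is absorbed in V_{n+1}. The formula for V₂ comes from
the Schwarzian equation. -/
lemma IsInverseOn.covariantSystem {α β γ : ℝ} (h : IsInverseOn M Z s T)
    (hZ : HasSchwarzian (V α β γ) Z upperHalfPlaneSet)
    {a₁ a₂ a₃ : ℂ} (hp : a₁ + a₂ + a₃ = 6) :
    CovariantSystem (y a₁ a₂ a₃ s)
      (fun z => VSeq α β γ (1 - a₁ / 6) (1 - a₂ / 6) 0 (s z) * deriv s z ^ 2)
      (fun z => VSeq α β γ (1 - a₁ / 6) (1 - a₂ / 6) 1 (s z) * deriv s z ^ 3)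
      (fun z => VSeq α β γ (1 - a₁ / 6) (1 - a₂ / 6) 2 (s z) * deriv s z ^ 4) T := by
  intro z hz
  have h0 := ne_zero_of_mem (h.mem z hz)
  have h1 := ne_one_of_mem (h.mem z hz)
  have hs := h.hasDerivAt' hz
  have hs' := h.hasDerivAt_deriv hZ hz
  have hL := h.hasDerivAt_logDerivInverse hZ hz
  have hq : HasDerivAt (fun z => q (1 - a₁ / 6) (1 - a₂ / 6) (s z)) _ z :=
    (hasDerivAt_q (1 - a₁ / 6) (1 - a₂ / 6) h0 h1).comp z hs
  have hv0 : HasDerivAt (fun z => VSeq α β γ (1 - a₁ / 6) (1 - a₂ / 6) 0 (s z)) _ z :=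
    (hasDerivAt_VSeq_zero α β γ a₁ a₂ h0 h1).comp z hs
  have hv1 : HasDerivAt (fun z => VSeq α β γ (1 - a₁ / 6) (1 - a₂ / 6) 1 (s z)) _ z :=
    (hasDerivAt_VSeq_one α β γ a₁ a₂ h0 h1).comp z hs
  rw [← VSeq_one_eq α β γ a₁ a₂ h0 h1] at hv0
  rw [← VSeq_two_eq α β γ a₁ a₂ h0 h1] at hv1
  refine ⟨?_, ?_, ?_⟩
  · have hev : y a₁ a₂ a₃ s =ᶠ[𝓝 z] fun z =>
        3 * (logDerivInverse M Z s z - q (1 - a₁ / 6) (1 - a₂ / 6) (s z) * deriv s z) := by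
      filter_upwards [h.isOpen.mem_nhds hz] with x hx using h.y_eq hZ hp hx
    refine HasDerivAt.congr_of_eventuallyEq ?_ hev
    refine ((hL.sub (hq.mul hs')).const_mul 3).congr_deriv ?_
    rw [h.y_eq hZ hp hz]
    simp only [VSeq, (hasDerivAt_q (1 - a₁ / 6) (1 - a₂ / 6) h0 h1).deriv]
    ring
  · refine (hv0.mul (hs'.pow 2)).congr_deriv ?_
    rw [h.y_eq hZ hp hz]
    simp only [Pi.pow_apply]
    push_cast
    ring
  · refine (hv1.mul (hs'.pow 3)).congr_deriv ?_
    rw [h.y_eq hZ hp hz]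
    simp only [Pi.pow_apply]
    push_cast
    ring

end Inverse

/-- A holomorphic continuation of `y` that solves the Chazy equation forces `V₄ = 12 V₂ ^ 2`. -/
lemma VSeq_identity_of_chazy {α β γ : ℝ} {a₁ a₂ a₃ : ℂ} (hp : a₁ + a₂ + a₃ = 6)
    {g : GL (Fin 2) ℂ} {Z s : ℂ → ℂ} (hs : IsTriangleFunction α β γ g Z s) {Y : ℂ → ℂ}
    (hY : IsChazySolutionOn Y (domainD g)) (hYy : EqOn Y (y a₁ a₂ a₃ s) (triangleT g Z)) :
    ∀ z ∈ triangleT g Z, VSeq α β γ (1 - a₁ / 6) (1 - a₂ / 6) 2 (s z) =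
      12 * VSeq α β γ (1 - a₁ / 6) (1 - a₂ / 6) 0 (s z) ^ 2 := by
  intro z hz
  have hinv := hs.isInverseOn
  have hS := hs.1.hasSchwarzian
  have hsys := hinv.covariantSystem hS hp
  have e1 : ∀ x ∈ triangleT g Z, y a₁ a₂ a₃ s =ᶠ[𝓝 x] Y := fun x hx => by
    filter_upwards [hinv.isOpen.mem_nhds hx] with x hx using (hYy hx).symm
  have hzD : z ∈ domainD g := by
    obtain ⟨h1, x, hx, h2⟩ := hz
    exact ⟨h1, h2 ▸ hs.1.mapsTo hx⟩
  have key := hsys.chazy hinv.isOpen hz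
  rw [(e1 z hz).deriv.deriv.deriv_eq, (e1 z hz).deriv.deriv_eq, (e1 z hz).deriv_eq,
    (e1 z hz).eq_of_nhds, hY.2 z hzD, sub_self] at key
  have hne := hinv.deriv_ne hS hz
  -- The Chazy defect of y is -3 (V₄ - 12 V₂²)(s) s'⁴, and s' has no zeros.
  have : (VSeq α β γ (1 - a₁ / 6) (1 - a₂ / 6) 2 (s z) -
      12 * VSeq α β γ (1 - a₁ / 6) (1 - a₂ / 6) 0 (s z) ^ 2) * deriv s z ^ 4 = 0 := by
    linear_combination key / 3
  exact sub_eq_zero.1 ((mul_eq_zero.1 this).resolve_right (pow_ne_zero 4 hne))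


/-! ### The quasimodular solution of the Chazy equation -/

section Modular

open UpperHalfPlane hiding I
open Complex Derivative EisensteinSeries
open scoped Real Manifold MatrixGroups ModularForm ComplexConjugate

/-- The weight four covariant of `E₂`. -/
def covariantFour (z : ℍ) : ℂ := D E2 z - E2 z ^ 2 / 12

/-- The weight six covariant of `E₂`. -/
def covariantSix : ℍ → ℂ := serreDerivative 4 covariantFour

/-- The weight eight covariant of `E₂`. -/
def covariantEight : ℍ → ℂ := serreDerivative 6 covariantSix

lemma mdifferentiable_covariantFour : MDiff covariantFour := by
  have h1 := normalizedDerivOfComplex_mdifferentiable E2_mdifferentiable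
  have h2 := (E2_mdifferentiable.mul E2_mdifferentiable).mul
    (mdifferentiable_const (c := (1 / 12 : ℂ)))
  convert h1.sub h2 using 1
  ext z
  simp only [covariantFour, Pi.sub_apply, Pi.mul_apply]
  ring

lemma mdifferentiable_covariantSix : MDiff covariantSix :=
  serreDerivative_mdifferentiable 4 mdifferentiable_covariantFour

lemma mdifferentiable_covariantEight : MDiff covariantEight :=
  serreDerivative_mdifferentiable 6 mdifferentiable_covariantSix

lemma E2_slash (γ : SL(2, ℤ)) (z : ℍ) :
    (E2 ∣[(2 : ℤ)] γ) z = E2 z - 6 * I / π * (γ 1 0 / denom γ z) := by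
  have := congrFun (E2_slash_action γ) z
  rw [this]
  have hp : (π : ℂ) ≠ 0 := by simp
  simp only [Pi.sub_apply, Pi.smul_apply, D2, smul_eq_mul, riemannZeta_two]
  field_simp

/-- Both D E₂ and E₂²/12 fail to be modular because of the term c/(cz + d) in the law of E₂; the
failures are equal. -/
lemma covariantFour_slash (γ : SL(2, ℤ)) : covariantFour ∣[(4 : ℤ)] γ = covariantFour := by
  ext z
  have hp : (π : ℂ) ≠ 0 := by simp
  have hj := denom_ne_zero γ z
  have hD := congrFun (normalizedDerivOfComplex_SL_slash (k := 2) E2_mdifferentiable (γ := γ)) z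
  -- The derivative of -(6i/π) c/(cz + d), divided by 2πi.
  have hL : D (E2 ∣[(2 : ℤ)] γ) z = D E2 z + 3 / π ^ 2 * (γ 1 0 / denom γ z) ^ 2 := by
    have hden : HasDerivAt (fun w : ℂ => (denom γ w)⁻¹)
        (-(γ 1 0 : ℂ) * (denom γ z ^ 2)⁻¹) z := by
      have := hasDerivAt_denom_zpow γ (-1) z
      simpa [zpow_neg, show (-1 - 1 : ℤ) = -2 by norm_num, zpow_ofNat] using this
    have hE : HasDerivAt (E2 ∘ ofComplex) (deriv (E2 ∘ ofComplex) z) z :=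
      (mdifferentiableAt_iff.mp (E2_mdifferentiable z)).hasDerivAt
    have hev : (E2 ∣[(2 : ℤ)] γ) ∘ ofComplex =ᶠ[𝓝 (z : ℂ)]
        fun w => (E2 ∘ ofComplex) w - 6 * I / π * (γ 1 0 * (denom γ w)⁻¹) := by
      filter_upwards [isOpen_upperHalfPlaneSet.mem_nhds z.im_pos] with w hw
      simp only [Function.comp_apply, E2_slash, div_eq_mul_inv, ofComplex_apply_of_im_pos hw]
    rw [normalizedDerivOfComplex, normalizedDerivOfComplex,
      ((hE.sub ((hden.const_mul (γ 1 0 : ℂ)).const_mul (6 * I / π))).congr_of_eventuallyEq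
        hev).deriv]
    field_simp
    ring_nf
  have h4 : (covariantFour ∣[(4 : ℤ)] γ) z =
      (D E2 ∣[(4 : ℤ)] γ) z - (E2 ∣[(2 : ℤ)] γ) z ^ 2 / 12 := by
    simp only [ModularForm.SL_slash_apply, covariantFour]
    have : denom γ z ^ (-4 : ℤ) = (denom γ z ^ (-2 : ℤ)) ^ 2 := by
      rw [← zpow_natCast, ← zpow_mul]; norm_num
    rw [this]; ring
  rw [hL] at hD
  simp only [Pi.sub_apply] at hD
  have hD' := eq_add_of_sub_eq hD.symm
  rw [show (2 + 2 : ℤ) = 4 by norm_num] at hD'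
  rw [h4, hD', E2_slash, covariantFour]
  push_cast
  field_simp
  ring_nf
  simp only [I_sq, I_pow_three]
  ring

lemma covariantSix_slash (γ : SL(2, ℤ)) : covariantSix ∣[(6 : ℤ)] γ = covariantSix := by
  have := serreDerivative_slash_invariant (k := 4) mdifferentiable_covariantFour
    (covariantFour_slash γ)
  simpa [covariantSix] using this

lemma covariantEight_slash (γ : SL(2, ℤ)) : covariantEight ∣[(8 : ℤ)] γ = covariantEight := by
  have := serreDerivative_slash_invariant (k := 6) mdifferentiable_covariantSix
    (covariantSix_slash γ)
  simpa [covariantEight] using this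

/-- The `q`-expansion of `E₂`, as a function on the unit disc. -/
def epsTwo : ℂ → ℂ := cuspFunction 1 E2

lemma periodic_E2 : Function.Periodic (E2 ∘ ofComplex) ((1 : ℝ) : ℂ) := by
  intro w
  by_cases! hw : 0 < im w
  · have h1 : 0 < im (w + ((1 : ℝ) : ℂ)) := by simp [hw]
    simp only [Function.comp_apply, ofComplex_apply_of_im_pos h1, ofComplex_apply_of_im_pos hw]
    refine (hasSum_qExpansion_E2 (z := ⟨_, h1⟩)).unique ?_
    convert hasSum_qExpansion_E2 (z := ⟨_, hw⟩) using 4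
    simp only []
    rw [show 2 * (π : ℂ) * I * (w + ((1 : ℝ) : ℂ)) = 2 * π * I * w + 2 * π * I by
      push_cast; ring, exp_periodic]
  -- Off the upper half-plane `ofComplex` takes one fixed default value, so periodicity is trivial
  -- there.
  · have h1 : im (w + ((1 : ℝ) : ℂ)) ≤ 0 := by simpa using hw
    simp only [Function.comp_apply, ofComplex_apply_of_im_nonpos h1,
      ofComplex_apply_of_im_nonpos hw]

lemma differentiableOn_epsTwo : DifferentiableOn ℂ epsTwo (Metric.ball 0 1) :=
  differentiableOn_cuspFunction_ball one_pos periodic_E2 E2_mdifferentiable isBoundedAtImInfty_E2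

lemma epsTwo_qParam (z : ℍ) : epsTwo (Function.Periodic.qParam 1 z) = E2 z :=
  eq_cuspFunction z one_ne_zero periodic_E2

lemma hasFPowerSeriesOnBall_epsTwo : HasFPowerSeriesOnBall epsTwo
    (.ofScalars ℂ fun m : ℕ => (if m = 0 then 1 else -24 * ArithmeticFunction.sigma 1 m : ℂ))
    0 1 :=
  hasFPowerSeriesOnBall_cuspFunction one_pos
    (analyticAt_cuspFunction_zero one_pos periodic_E2 E2_mdifferentiable isBoundedAtImInfty_E2)
    fun τ => by
      simpa only [Function.Periodic.qParam, ofReal_one, div_one] using hasSum_qExpansion_E2 (z := τ)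

lemma hasSum_epsTwo {x : ℂ} (hx : x ∈ Metric.ball (0 : ℂ) 1) :
    HasSum (fun m : ℕ => (if m = 0 then 1 else -24 * ArithmeticFunction.sigma 1 m : ℂ) * x ^ m)
      (epsTwo x) := by
  have := hasFPowerSeriesOnBall_epsTwo.hasSum (y := x) (by
    rw [mem_ball_zero_iff] at hx
    simpa [enorm_eq_nnnorm, ← NNReal.coe_lt_coe] using hx)
  simpa [FormalMultilinearSeries.ofScalars_apply_eq, mul_comm] using this

lemma epsTwo_zero : epsTwo 0 = 1 := by
  refine (hasSum_epsTwo (by simp)).unique ?_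
  convert hasSum_ite_eq (0 : ℕ) (1 : ℂ) using 2 with m
  by_cases hm : m = 0 <;> simp [hm]

lemma deriv_epsTwo_zero : deriv epsTwo 0 = -24 := by
  have := hasFPowerSeriesOnBall_epsTwo.hasFPowerSeriesAt.deriv
  simpa [FormalMultilinearSeries.ofScalars_apply_eq] using this

/-- The q-expansion has real coefficients. This reality is what later keeps Im ℓ constant on the
real axis near the cusp. -/
lemma epsTwo_conj {x : ℂ} (hx : x ∈ Metric.ball (0 : ℂ) 1) :
    epsTwo (conj x) = conj (epsTwo x) := by
  refine (hasSum_epsTwo (by simpa using hx)).unique ?_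
  convert ((hasSum_epsTwo hx).map (starRingEnd ℂ) continuous_conj) using 2 with m
  by_cases hm : m = 0 <;> simp [hm, map_ofNat]

/-- The Euler operator `x d/dx`. -/
def euler (A : ℂ → ℂ) (x : ℂ) : ℂ := x * deriv A x

/-- `F` has the `q`-expansion `A`. -/
structure HasQExpansion (A : ℂ → ℂ) (F : ℍ → ℂ) : Prop where
  diff : DifferentiableOn ℂ A (Metric.ball 0 1)
  eq : ∀ z : ℍ, F z = A (Function.Periodic.qParam 1 z)

lemma qParam_mem_ball {w : ℂ} (hw : 0 < w.im) :
    Function.Periodic.qParam 1 w ∈ Metric.ball (0 : ℂ) 1 := by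
  rw [mem_ball_zero_iff]
  exact Function.Periodic.norm_qParam_lt_one one_pos hw

lemma hasDerivAt_qParam (w : ℂ) : HasDerivAt (Function.Periodic.qParam 1)
    (2 * π * I * Function.Periodic.qParam 1 w) w := by
  have : HasDerivAt (fun w : ℂ => cexp (2 * π * I * w / ((1 : ℝ) : ℂ))) _ w :=
    (((hasDerivAt_id w).const_mul (2 * π * I)).div_const _).cexp
  refine this.congr_deriv ?_
  simp [Function.Periodic.qParam, mul_comm]

lemma hasDerivAt_comp_qParam {A : ℂ → ℂ} (hA : DifferentiableOn ℂ A (Metric.ball 0 1)) {w : ℂ}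
    (hw : 0 < w.im) : HasDerivAt (fun w => A (Function.Periodic.qParam 1 w))
      (2 * π * I * euler A (Function.Periodic.qParam 1 w)) w := by
  have h1 := hasDerivAt_of_diff Metric.isOpen_ball hA (qParam_mem_ball hw)
  refine (h1.comp w (hasDerivAt_qParam w)).congr_deriv ?_
  simp only [euler]; ring

lemma differentiableOn_euler {A : ℂ → ℂ} (hA : DifferentiableOn ℂ A (Metric.ball 0 1)) :
    DifferentiableOn ℂ (euler A) (Metric.ball 0 1) :=
  differentiableOn_id.mul (hA.deriv Metric.isOpen_ball)

lemma HasQExpansion.normalizedDeriv {A : ℂ → ℂ} {F : ℍ → ℂ} (h : HasQExpansion A F) :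
    HasQExpansion (euler A) (D F) := by
  refine ⟨differentiableOn_euler h.diff, fun z => ?_⟩
  have hev : F ∘ ofComplex =ᶠ[𝓝 (z : ℂ)] fun w => A (Function.Periodic.qParam 1 w) := by
    filter_upwards [isOpen_upperHalfPlaneSet.mem_nhds z.im_pos] with w hw
    simp only [Function.comp_apply, h.eq, ofComplex_apply_of_im_pos hw]
  rw [normalizedDerivOfComplex, ((hasDerivAt_comp_qParam h.diff z.im_pos).congr_of_eventuallyEq
    hev).deriv]
  have hp : (π : ℂ) ≠ 0 := by simp
  field_simp

lemma hasQExpansion_E2 : HasQExpansion epsTwo E2 :=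
  ⟨differentiableOn_epsTwo, fun z => (epsTwo_qParam z).symm⟩

/-- The `q`-expansion of `covariantFour`. -/
def epsFour (x : ℂ) : ℂ := euler epsTwo x - epsTwo x ^ 2 / 12

/-- The `q`-expansion of `covariantSix`. -/
def epsSix (x : ℂ) : ℂ := euler epsFour x - epsTwo x * epsFour x / 3

/-- The `q`-expansion of `covariantEight`. -/
def epsEight (x : ℂ) : ℂ := euler epsSix x - epsTwo x * epsSix x / 2

lemma hasQExpansion_covariantFour : HasQExpansion epsFour covariantFour := by
  have h := hasQExpansion_E2.normalizedDeriv
  refine ⟨h.diff.sub ((differentiableOn_epsTwo.pow 2).div_const 12), fun z => ?_⟩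
  rw [covariantFour, epsFour, h.eq, hasQExpansion_E2.eq]

lemma hasQExpansion_covariantSix : HasQExpansion epsSix covariantSix := by
  have h4 := hasQExpansion_covariantFour
  have h := h4.normalizedDeriv
  refine ⟨h.diff.sub ((differentiableOn_epsTwo.mul h4.diff).div_const 3), fun z => ?_⟩
  rw [covariantSix, epsSix, serreDerivative_apply, h.eq, h4.eq, hasQExpansion_E2.eq]
  ring

lemma hasQExpansion_covariantEight : HasQExpansion epsEight covariantEight := by
  have h4 := hasQExpansion_covariantSix
  have h := h4.normalizedDeriv
  refine ⟨h.diff.sub ((differentiableOn_epsTwo.mul h4.diff).div_const 2), fun z => ?_⟩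
  rw [covariantEight, epsEight, serreDerivative_apply, h.eq, h4.eq, hasQExpansion_E2.eq]
  ring

lemma epsFour_zero : epsFour 0 = -1 / 12 := by
  simp [epsFour, euler, epsTwo_zero]; norm_num

lemma epsSix_zero : epsSix 0 = 1 / 36 := by
  simp [epsSix, euler, epsTwo_zero, epsFour_zero]; norm_num

lemma epsEight_zero : epsEight 0 = -1 / 72 := by
  simp [epsEight, euler, epsTwo_zero, epsSix_zero]; norm_num

lemma hasDerivAt_euler_zero {A : ℂ → ℂ} (hA : DifferentiableOn ℂ A (Metric.ball 0 1)) :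
    HasDerivAt (euler A) (deriv A 0) 0 := by
  have h1 := hasDerivAt_of_diff Metric.isOpen_ball (hA.deriv Metric.isOpen_ball)
    (Metric.mem_ball_self one_pos)
  refine ((hasDerivAt_id (0 : ℂ)).mul h1).congr_deriv ?_
  simp

lemma hasDerivAt_epsTwo_zero : HasDerivAt epsTwo (-24) 0 := by
  rw [← deriv_epsTwo_zero]
  exact hasDerivAt_of_diff Metric.isOpen_ball differentiableOn_epsTwo
    (Metric.mem_ball_self one_pos)

lemma hasDerivAt_epsFour_zero : HasDerivAt epsFour (-20) 0 := by
  refine ((hasDerivAt_euler_zero differentiableOn_epsTwo).sub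
    ((hasDerivAt_epsTwo_zero.pow 2).div_const 12)).congr_deriv ?_
  rw [deriv_epsTwo_zero, epsTwo_zero]
  norm_num

lemma hasDerivAt_epsSix_zero : HasDerivAt epsSix (-14) 0 := by
  refine ((hasDerivAt_euler_zero hasQExpansion_covariantFour.diff).sub
    ((hasDerivAt_epsTwo_zero.mul hasDerivAt_epsFour_zero).div_const 3)).congr_deriv ?_
  rw [hasDerivAt_epsFour_zero.deriv, epsTwo_zero, epsFour_zero]
  norm_num

/-- The relation in weight eight, as there are no cusp forms of that weight. -/
lemma covariantEight_eq (z : ℍ) : covariantEight z = -2 * covariantFour z ^ 2 := by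
  set h : ℍ → ℂ := covariantEight + (2 : ℂ) • (covariantFour * covariantFour) with hh
  have hslash : ∀ γ : SL(2, ℤ), h ∣[(8 : ℤ)] γ = h := by
    intro γ
    have h4 : (covariantFour * covariantFour) ∣[(8 : ℤ)] γ = covariantFour * covariantFour := by
      have := ModularForm.mul_slash_SL2 4 4 γ covariantFour covariantFour
      rw [covariantFour_slash] at this
      simpa using this
    rw [hh, SlashAction.add_slash, ModularForm.SL_smul_slash, h4, covariantEight_slash]
  have hzero : IsZeroAtImInfty h := by
    have hc : ContinuousAt (fun x => epsEight x + 2 * (epsFour x * epsFour x)) 0 := by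
      have hb := Metric.ball_mem_nhds (0 : ℂ) one_pos
      have c8 := (hasQExpansion_covariantEight.diff.differentiableAt hb).continuousAt
      have c4 := (hasQExpansion_covariantFour.diff.differentiableAt hb).continuousAt
      exact c8.add ((c4.mul c4).const_mul 2)
    have := hc.tendsto.comp (qParam_tendsto_atImInfty one_pos)
    rw [epsEight_zero, epsFour_zero] at this
    -- The constant term vanishes, so the form is a cusp form of weight 8 and level one, hence zero.
    have e : (-1 / 72 + 2 * (-1 / 12 * (-1 / 12)) : ℂ) = 0 := by norm_num
    rw [e] at this
    refine this.congr fun z => ?_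
    simp [hh, hasQExpansion_covariantEight.eq, hasQExpansion_covariantFour.eq]
  let f : CuspForm 𝒮ℒ 8 :=
    { toFun := h
      slash_action_eq' := by
        rintro A ⟨A, rfl⟩
        exact hslash A
      holo' := mdifferentiable_covariantEight.add
        ((mdifferentiable_covariantFour.mul mdifferentiable_covariantFour).const_smul 2)
      zero_at_cusps' := by
        intro c hc
        rw [Subgroup.IsArithmetic.isCusp_iff_isCusp_SL2Z] at hc
        rw [OnePoint.isZeroAt_iff_forall_SL2Z hc]
        intro γ _
        rw [hslash]
        exact hzero }
  have hf : f = 0 :=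
    rank_zero_iff_forall_zero.1 (CuspForm.rank_eq_zero_of_weight_lt_twelve (by norm_num)) f
  have : h z = 0 := DFunLike.congr_fun hf z
  simp only [hh, Pi.add_apply, Pi.smul_apply, Pi.mul_apply, smul_eq_mul] at this
  linear_combination this

lemma epsEight_qParam {w : ℂ} (hw : 0 < w.im) :
    epsEight (Function.Periodic.qParam 1 w) = -2 * epsFour (Function.Periodic.qParam 1 w) ^ 2 := by
  have := covariantEight_eq ⟨w, hw⟩
  rwa [hasQExpansion_covariantEight.eq, hasQExpansion_covariantFour.eq] at this

/-- The function `π i E₂`, a solution of the Chazy equation on the upper half-plane. -/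
def modE (w : ℂ) : ℂ := π * I * epsTwo (Function.Periodic.qParam 1 w)

/-- The covariant of weight four of `modE`. -/
def modF (w : ℂ) : ℂ := 2 * π ^ 2 / 3 * epsFour (Function.Periodic.qParam 1 w)

/-- The covariant of weight six of `modE`. -/
def modG (w : ℂ) : ℂ := 4 * π ^ 3 * I / 3 * epsSix (Function.Periodic.qParam 1 w)

/-- The factors π i, 2π²/3, 4π³ i/3 come from D = (2πi)⁻¹ d/dw and the normalization of the system.
With them the weight eight relation `covariantEight_eq` becomes f₈ = 12 f₄². -/
lemma covariantSystem_modE :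
    CovariantSystem modE modF modG (fun w => 12 * modF w ^ 2) upperHalfPlaneSet := by
  intro w hw
  refine ⟨?_, ?_, ?_⟩
  · refine ((hasDerivAt_comp_qParam differentiableOn_epsTwo hw).const_mul (π * I)).congr_deriv ?_
    simp only [modE, modF, epsFour]
    ring_nf
    simp only [I_sq]
    ring
  · refine ((hasDerivAt_comp_qParam hasQExpansion_covariantFour.diff hw).const_mul
      (2 * (π : ℂ) ^ 2 / 3)).congr_deriv ?_
    simp only [modE, modF, modG, epsSix]
    ring_nf
  · refine ((hasDerivAt_comp_qParam hasQExpansion_covariantSix.diff hw).const_mul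
      (4 * (π : ℂ) ^ 3 * I / 3)).congr_deriv ?_
    have := epsEight_qParam hw
    rw [epsEight] at this
    rw [eq_add_of_sub_eq this]
    simp only [modE, modF, modG]
    ring_nf
    simp only [I_sq]
    ring

lemma isChazySolutionOn_modE : IsChazySolutionOn modE upperHalfPlaneSet :=
  covariantSystem_modE.isChazySolutionOn isOpen_uhp fun _ _ => rfl

lemma modE_coe (z : ℍ) : modE z = π * I * E2 z := by
  rw [modE, epsTwo_qParam]

lemma modE_smul (γ : SL(2, ℤ)) (z : ℍ) :
    modE ((γ • z : ℍ) : ℂ) = denom γ z ^ 2 * modE z + 6 * γ 1 0 * denom γ z := by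
  have h := E2_slash γ z
  rw [ModularForm.SL_slash_apply] at h
  have hj := denom_ne_zero γ z
  have hp : (π : ℂ) ≠ 0 := by simp
  rw [modE_coe, modE_coe]
  rw [zpow_neg, ← div_eq_mul_inv, div_eq_iff (zpow_ne_zero _ hj)] at h
  rw [h]
  simp only [zpow_ofNat]
  field_simp
  ring_nf
  simp only [I_sq]
  ring

lemma tendsto_modE_mul_I : Tendsto (fun t : ℝ => modE (t * I)) atTop (𝓝 (π * I)) := by
  have h1 : Tendsto (fun t : ℝ => Function.Periodic.qParam 1 ((t : ℂ) * I)) atTop (𝓝 0) := by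
    refine ((Function.Periodic.qParam_tendsto one_pos).mono_right nhdsWithin_le_nhds).comp ?_
    rw [tendsto_comap_iff]
    refine tendsto_id.congr fun t => ?_
    simp
  have h2 := (hasDerivAt_epsTwo_zero.continuousAt.tendsto.comp h1).const_mul (π * I)
  simpa [epsTwo_zero, modE] using h2

/-- `modE` is unbounded near every rational point of the real axis. -/
lemma exists_tendsto_norm_modE (r : ℚ) : ∃ w : ℝ → ℂ, (∀ᶠ t in atTop, 0 < (w t).im) ∧
    Tendsto w atTop (𝓝 (r : ℂ)) ∧ Tendsto (fun t => ‖modE (w t)‖) atTop atTop := by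
  have hcop : IsCoprime r.num (r.den : ℤ) := by
    rw [Int.isCoprime_iff_gcd_eq_one]
    exact r.reduced
  obtain ⟨γ, h0, h1⟩ := hcop.exists_SL2_col 0
  have hden : (r.den : ℂ) ≠ 0 := by exact_mod_cast r.den_ne_zero
  set d : ℂ := ((γ 1 1 : ℤ) : ℂ) with hd
  set b : ℂ := ((γ 0 1 : ℤ) : ℂ) with hb
  have hdet : (r.num : ℂ) * d - b * r.den = 1 := by
    have := Matrix.det_fin_two γ.1
    rw [γ.2, h0, h1] at this
    have h' : ((1 : ℤ) : ℂ) = ((r.num * γ.1 1 1 - γ.1 0 1 * r.den : ℤ) : ℂ) :=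
      congrArg _ this
    push_cast at h'
    rw [hd, hb, ← h']
  have hr : (r : ℂ) = r.num / r.den := Rat.cast_def r
  have hj : Tendsto (fun t : ℝ => ‖(r.den : ℂ) * (t * I) + d‖) atTop atTop := by
    refine tendsto_atTop_mono (f := fun t : ℝ => ‖(r.den : ℂ)‖ * t - ‖d‖) (fun t => ?_) ?_
    · have h3 := norm_sub_le ((r.den : ℂ) * (t * I) + d) d
      rw [add_sub_cancel_right, norm_mul, norm_mul, norm_I, mul_one, norm_real] at h3
      have h4 : ‖(r.den : ℂ)‖ * t ≤ ‖(r.den : ℂ)‖ * ‖t‖ :=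
        mul_le_mul_of_nonneg_left (Real.le_norm_self t) (norm_nonneg _)
      linarith
    · exact tendsto_atTop_add_const_right _ _
        (tendsto_id.const_mul_atTop (norm_pos_iff.2 hden))
  -- This is γ(it) for γ with first column (num r, den r), by γz = a/c - 1/(c (cz + d)); it tends to
  -- γ(∞) = r.
  refine ⟨fun t => r - 1 / (r.den * (r.den * (t * I) + d)), ?_, ?_, ?_⟩
  · filter_upwards [eventually_gt_atTop 0] with t ht
    have h5 : (1 / ((r.den : ℂ) * (r.den * (t * I) + d))).im < 0 := by
      rw [one_div, inv_im]
      refine div_neg_of_neg_of_pos ?_ ?_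
      · have : (0 : ℝ) < r.den := by exact_mod_cast r.den_pos
        simp [hd]
        positivity
      · rw [Complex.normSq_pos]
        refine mul_ne_zero hden fun h => ?_
        have := congrArg Complex.im h
        simp [hd] at this
        exact ht.ne' this
    simpa using h5
  · have : Tendsto (fun t : ℝ => 1 / ((r.den : ℂ) * (r.den * (t * I) + d))) atTop (𝓝 0) := by
      rw [tendsto_zero_iff_norm_tendsto_zero]
      simp only [one_div, norm_inv, norm_mul (r.den : ℂ)]
      exact (hj.const_mul_atTop (norm_pos_iff.2 hden)).inv_tendsto_atTop
    simpa using tendsto_const_nhds.sub this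
  -- With j = cz + d the law `modE_smul` gives j (j `modE` + 6 c), where |j| → ∞ and `modE` (it) → π
  -- i ≠ 0.
  · have key : ∀ᶠ t : ℝ in atTop, ‖(r.den : ℂ) * (t * I) + d‖ *
        (‖(r.den : ℂ) * (t * I) + d‖ * ‖modE (t * I)‖ - 6 * r.den) ≤
        ‖modE (r - 1 / (r.den * (r.den * (t * I) + d)))‖ := by
      filter_upwards [eventually_gt_atTop 0, hj.eventually_gt_atTop 0] with t ht hjt
      have hjt' : (r.den : ℂ) * (t * I) + d ≠ 0 := norm_pos_iff.1 hjt
      have hpos : 0 < ((t : ℂ) * I).im := by simpa using ht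
      have hs := modE_smul γ ⟨_, hpos⟩
      have hden' : denom γ (⟨_, hpos⟩ : ℍ) = (r.den : ℂ) * (t * I) + d := by
        rw [ModularGroup.denom_apply, h1]; simp [hd]
      have hw : ((γ • (⟨_, hpos⟩ : ℍ) : ℍ) : ℂ) =
          r - 1 / (r.den * (r.den * (t * I) + d)) := by
        rw [UpperHalfPlane.specialLinearGroup_apply]
        simp only [h0, h1, eq_intCast]
        push_cast
        rw [← hd, ← hb, hr]
        generalize hJ : (r.den : ℂ) * (t * I) + d = J at hjt' ⊢
        field_simp
        rw [← hJ]
        linear_combination -hdet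
      rw [hw, hden', h1] at hs
      rw [hs]
      set j := (r.den : ℂ) * (t * I) + d
      have e : j ^ 2 * modE (t * I) + 6 * ((r.den : ℤ) : ℂ) * j =
          j * (j * modE (t * I) + 6 * r.den) := by push_cast; ring
      change _ ≤ ‖j ^ 2 * modE (t * I) + 6 * ((r.den : ℤ) : ℂ) * j‖
      rw [e, norm_mul]
      refine mul_le_mul_of_nonneg_left ?_ (norm_nonneg _)
      have h6 := norm_sub_le (j * modE (t * I) + 6 * r.den) (6 * r.den)
      rw [add_sub_cancel_right, norm_mul, norm_mul] at h6
      simp at h6 ⊢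
      linarith
    refine tendsto_atTop_mono' _ key ?_
    refine hj.atTop_mul_atTop₀ ?_
    refine tendsto_atTop_add_const_right _ _ ?_
    have hn : Tendsto (fun t : ℝ => ‖modE (t * I)‖) atTop (𝓝 ‖(π * I : ℂ)‖) :=
      tendsto_modE_mul_I.norm
    exact hj.atTop_mul_pos (by simp) hn

lemma euler_conj {A : ℂ → ℂ} (hA : DifferentiableOn ℂ A (Metric.ball 0 1))
    (h : ∀ x ∈ Metric.ball (0 : ℂ) 1, A (conj x) = conj (A x)) {x : ℂ}
    (hx : x ∈ Metric.ball (0 : ℂ) 1) : euler A (conj x) = conj (euler A x) := by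
  have h1 := (hasDerivAt_of_diff Metric.isOpen_ball hA hx).conj_conj
  have hx' : conj x ∈ Metric.ball (0 : ℂ) 1 := by simpa using hx
  have hev : A =ᶠ[𝓝 (conj x)] conj ∘ A ∘ conj := by
    filter_upwards [Metric.isOpen_ball.mem_nhds hx'] with y hy
    have := h (conj y) (by simpa using hy)
    simpa using this
  rw [euler, euler, (h1.congr_of_eventuallyEq hev).deriv, map_mul]

lemma epsFour_conj {x : ℂ} (hx : x ∈ Metric.ball (0 : ℂ) 1) :
    epsFour (conj x) = conj (epsFour x) := by
  rw [epsFour, epsFour, epsTwo_conj hx,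
    euler_conj differentiableOn_epsTwo (fun _ h => epsTwo_conj h) hx]
  simp [map_ofNat]

lemma epsSix_conj {x : ℂ} (hx : x ∈ Metric.ball (0 : ℂ) 1) :
    epsSix (conj x) = conj (epsSix x) := by
  rw [epsSix, epsSix, epsTwo_conj hx, epsFour_conj hx,
    euler_conj hasQExpansion_covariantFour.diff (fun _ h => epsFour_conj h) hx]
  simp [map_ofNat]

/-- The function `1728 / j` in terms of `q`. -/
def invJ (x : ℂ) : ℂ := (4 * epsFour x ^ 3 + 3 * epsSix x ^ 2) / (4 * epsFour x ^ 3)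

lemma invJ_conj {x : ℂ} (hx : x ∈ Metric.ball (0 : ℂ) 1) : invJ (conj x) = conj (invJ x) := by
  rw [invJ, invJ, epsFour_conj hx, epsSix_conj hx]
  simp [map_ofNat]

lemma invJ_zero : invJ 0 = 0 := by
  rw [invJ, epsFour_zero, epsSix_zero]; norm_num

/-- The zero at q = 0 is simple, so 1728/j can be inverted near the cusp. -/
lemma hasDerivAt_invJ_zero : HasDerivAt invJ 1728 0 := by
  have h4 := hasDerivAt_epsFour_zero
  have h6 := hasDerivAt_epsSix_zero
  refine ((((h4.pow 3).const_mul 4).add ((h6.pow 2).const_mul 3)).div ((h4.pow 3).const_mul 4)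
    ?_).congr_deriv ?_
  · simp [epsFour_zero]
  · simp [epsFour_zero, epsSix_zero]; norm_num

lemma analyticAt_epsFour_zero : AnalyticAt ℂ epsFour 0 :=
  hasQExpansion_covariantFour.diff.analyticAt (Metric.ball_mem_nhds 0 one_pos)

lemma analyticAt_epsSix_zero : AnalyticAt ℂ epsSix 0 :=
  hasQExpansion_covariantSix.diff.analyticAt (Metric.ball_mem_nhds 0 one_pos)

lemma analyticAt_invJ_zero : AnalyticAt ℂ invJ 0 := by
  have h4 := analyticAt_epsFour_zero
  have h6 := analyticAt_epsSix_zero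
  have hn : (4 : ℂ) * epsFour 0 ^ 3 ≠ 0 := by rw [epsFour_zero]; norm_num
  exact ((analyticAt_const.mul (h4.pow 3)).add (analyticAt_const.mul (h6.pow 2))).div
    (analyticAt_const.mul (h4.pow 3)) hn

end Modular


/-! ### Lifting to the modular picture near a cusp -/

lemma hasDerivAt_VSeq_zero' (α β γ : ℝ) (a₁ a₂ : ℂ) {s : ℂ} (h0 : s ≠ 0) (h1 : s ≠ 1) :
    HasDerivAt (VSeq α β γ (1 - a₁ / 6) (1 - a₂ / 6) 0)
      (VSeq α β γ (1 - a₁ / 6) (1 - a₂ / 6) 1 s - 2 * q (1 - a₁ / 6) (1 - a₂ / 6) s *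
          VSeq α β γ (1 - a₁ / 6) (1 - a₂ / 6) 0 s) s := by
  rw [VSeq_one_eq α β γ a₁ a₂ h0 h1]
  exact hasDerivAt_VSeq_zero α β γ a₁ a₂ h0 h1

lemma hasDerivAt_VSeq_one' (α β γ : ℝ) (a₁ a₂ : ℂ) {s : ℂ} (h0 : s ≠ 0) (h1 : s ≠ 1) :
    HasDerivAt (VSeq α β γ (1 - a₁ / 6) (1 - a₂ / 6) 1)
      (VSeq α β γ (1 - a₁ / 6) (1 - a₂ / 6) 2 s - 3 * q (1 - a₁ / 6) (1 - a₂ / 6) s *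
          VSeq α β γ (1 - a₁ / 6) (1 - a₂ / 6) 1 s) s := by
  rw [VSeq_two_eq α β γ a₁ a₂ h0 h1]
  exact hasDerivAt_VSeq_one α β γ a₁ a₂ h0 h1

/-- `T` transforms `modE` into `-3 (T''/T' + q) / T'`. -/
def IsLiftOn (b₁ b₂ : ℂ) (T : ℂ → ℂ) (U : Set ℂ) : Prop :=
  ∀ s ∈ U, modE (T s) * deriv T s = -3 * (nonlin T s + q b₁ b₂ s)

/-- Equality of the absolute invariants G²/F³ and V₃²/V₂³ suffices, since both sides obey the same
differential system. Differentiating it gives T', and so F T'² = V₂; differentiating that gives the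
lift equation, and differentiating once more the Schwarzian equation. -/
lemma lift_of_invariant_eq {α β γ : ℝ} {a₁ a₂ : ℂ} {T : ℂ → ℂ} {U : Set ℂ} (hU : IsOpen U)
    (hUH : U ⊆ upperHalfPlaneSet) (hT : DifferentiableOn ℂ T U)
    (hTH : MapsTo T U upperHalfPlaneSet)
    (hid : ∀ x : ℂ, x ≠ 0 → x ≠ 1 → VSeq α β γ (1 - a₁ / 6) (1 - a₂ / 6) 2 x =
      12 * VSeq α β γ (1 - a₁ / 6) (1 - a₂ / 6) 0 x ^ 2)
    (hrel : ∀ s ∈ U, modG (T s) ^ 2 * VSeq α β γ (1 - a₁ / 6) (1 - a₂ / 6) 0 s ^ 3 =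
      VSeq α β γ (1 - a₁ / 6) (1 - a₂ / 6) 1 s ^ 2 * modF (T s) ^ 3)
    (hF : ∀ s ∈ U, modF (T s) ≠ 0) (hG : ∀ s ∈ U, modG (T s) ≠ 0)
    (hV0 : ∀ s ∈ U, VSeq α β γ (1 - a₁ / 6) (1 - a₂ / 6) 0 s ≠ 0)
    (hV1 : ∀ s ∈ U, VSeq α β γ (1 - a₁ / 6) (1 - a₂ / 6) 1 s ≠ 0)
    (hdisc : ∀ s ∈ U, 8 * VSeq α β γ (1 - a₁ / 6) (1 - a₂ / 6) 0 s ^ 3 -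
      VSeq α β γ (1 - a₁ / 6) (1 - a₂ / 6) 1 s ^ 2 ≠ 0) :
    HasSchwarzian (V α β γ) T U ∧ IsLiftOn (1 - a₁ / 6) (1 - a₂ / 6) T U := by
  set v₀ := VSeq α β γ (1 - a₁ / 6) (1 - a₂ / 6) 0 with hv₀
  set v₁ := VSeq α β γ (1 - a₁ / 6) (1 - a₂ / 6) 1 with hv₁
  set Q := q (1 - a₁ / 6) (1 - a₂ / 6) with hQ
  have d0 : ∀ s ∈ U, HasDerivAt v₀ (v₁ s - 2 * Q s * v₀ s) s := fun s hs =>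
    hasDerivAt_VSeq_zero' α β γ a₁ a₂ (ne_zero_of_mem (hUH hs)) (ne_one_of_mem (hUH hs))
  have d1 : ∀ s ∈ U, HasDerivAt v₁ (12 * v₀ s ^ 2 - 3 * Q s * v₁ s) s := fun s hs => by
    rw [← hid s (ne_zero_of_mem (hUH hs)) (ne_one_of_mem (hUH hs))]
    exact hasDerivAt_VSeq_one' α β γ a₁ a₂ (ne_zero_of_mem (hUH hs)) (ne_one_of_mem (hUH hs))
  have dT : ∀ s ∈ U, HasDerivAt T (deriv T s) s := fun s hs => hasDerivAt_of_diff hU hT hs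
  have dT' : ∀ s ∈ U, HasDerivAt (deriv T) (deriv (deriv T) s) s :=
    fun s hs => hasDerivAt_of_diff hU (hT.deriv hU) hs
  have dE : ∀ s ∈ U, HasDerivAt (fun s => modE (T s))
      ((modE (T s) ^ 2 / 6 - 3 * modF (T s)) * deriv T s) s := fun s hs =>
    (covariantSystem_modE _ (hTH hs)).1.comp s (dT s hs)
  have dF : ∀ s ∈ U, HasDerivAt (fun s => modF (T s))
      ((modG (T s) + 2 / 3 * modE (T s) * modF (T s)) * deriv T s) s := fun s hs =>
    (covariantSystem_modE _ (hTH hs)).2.1.comp s (dT s hs)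
  have dG : ∀ s ∈ U, HasDerivAt (fun s => modG (T s))
      ((12 * modF (T s) ^ 2 + modE (T s) * modG (T s)) * deriv T s) s := fun s hs =>
    (covariantSystem_modE _ (hTH hs)).2.2.comp s (dT s hs)
  -- first integral: the derivative of `T`
  have hp : ∀ s ∈ U, deriv T s * (modG (T s) * v₀ s) = v₁ s * modF (T s) := by
    intro s hs
    have hev : (fun s => modG (T s) ^ 2 * v₀ s ^ 3) =ᶠ[𝓝 s] fun s => v₁ s ^ 2 * modF (T s) ^ 3 := by
      filter_upwards [hU.mem_nhds hs] with x hx using hrel x hx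
    have hl := ((dG s hs).pow 2).mul ((d0 s hs).pow 3)
    have hr := ((d1 s hs).pow 2).mul ((dF s hs).pow 3)
    have := (hr.congr_of_eventuallyEq hev).unique hl
    have h := hrel s hs
    have hFs := hF s hs
    have hGs := hG s hs
    have h0s := hV0 s hs
    have h1s := hV1 s hs
    have hds := hdisc s hs
    simp only [Pi.pow_apply, Nat.cast_ofNat, Nat.add_one_sub_one, pow_one] at this
    generalize modF (T s) = F at *
    generalize modG (T s) = G at *
    generalize modE (T s) = E at *
    generalize deriv T s = p at *
    generalize v₀ s = x at *
    generalize v₁ s = y at *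
    generalize Q s = Q at *
    -- The terms with E and q drop out by homogeneity. What remains carries the discriminant as a
    -- factor, which is why it must not vanish.
    have key : (p * (G * x) - y * F) * (F ^ 2 * (8 * x ^ 3 - y ^ 2)) = 0 := by
      linear_combination (-x / 3) * this + (x / 3 * (6 * Q - 2 * E * p) - y) * h
    have := (mul_eq_zero.1 key).resolve_right (mul_ne_zero (pow_ne_zero 2 hFs) hds)
    exact sub_eq_zero.1 this
  have hne : ∀ s ∈ U, deriv T s ≠ 0 := by
    intro s hs h
    have := hp s hs
    rw [h, zero_mul] at this
    exact mul_ne_zero (hV1 s hs) (hF s hs) this.symm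
  have hF2 : ∀ s ∈ U, modF (T s) * deriv T s ^ 2 = v₀ s := by
    intro s hs
    have h := hrel s hs
    have h' := hp s hs
    have hn : modG (T s) ^ 2 * v₀ s ^ 2 ≠ 0 :=
      mul_ne_zero (pow_ne_zero _ (hG s hs)) (pow_ne_zero _ (hV0 s hs))
    refine mul_right_cancel₀ hn ?_
    linear_combination modF (T s) * (deriv T s * (modG (T s) * v₀ s) + v₁ s * modF (T s)) * h' - h
  have hlift : IsLiftOn (1 - a₁ / 6) (1 - a₂ / 6) T U := by
    intro s hs
    have hev : (fun s => modF (T s) * deriv T s ^ 2) =ᶠ[𝓝 s] v₀ := by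
      filter_upwards [hU.mem_nhds hs] with x hx using hF2 x hx
    have hl := (dF s hs).mul ((dT' s hs).pow 2)
    have := ((d0 s hs).congr_of_eventuallyEq hev).unique hl
    have h2 := hF2 s hs
    have h3 := hp s hs
    have hn := hne s hs
    have hFs := hF s hs
    simp only [Pi.pow_apply, Nat.cast_ofNat, Nat.add_one_sub_one, pow_one] at this
    rw [nonlin, ← hQ]
    field_simp
    -- With the weight six analogue of `hF2`, the G- and V₃-terms of the differentiated equation
    -- cancel, leaving T'' and q.
    have h4 : modG (T s) * deriv T s ^ 3 = v₁ s := by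
      refine mul_right_cancel₀ hFs ?_
      linear_combination h3 + modG (T s) * deriv T s * h2
    refine mul_right_cancel₀ (mul_ne_zero hFs hn) ?_
    linear_combination -(3 / 2) * (h4 + this) + 3 * Q s * h2
  refine ⟨⟨hT, hne, fun s hs => ?_⟩, hlift⟩
  have hev : nonlin T =ᶠ[𝓝 s] fun s => -1 / 3 * (modE (T s) * deriv T s) - Q s := by
    filter_upwards [hU.mem_nhds hs] with x hx
    linear_combination (1 / 3) * hlift x hx
  have dq := hasDerivAt_q (1 - a₁ / 6) (1 - a₂ / 6) (ne_zero_of_mem (hUH hs))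
    (ne_one_of_mem (hUH hs))
  refine (((((dE s hs).mul (dT' s hs)).const_mul (-1 / 3)).sub dq).congr_of_eventuallyEq
    hev).congr_deriv ?_
  have h1 := hlift s hs
  have h2 := hF2 s hs
  have h3 : v₀ s = 1 / 2 * V α β γ s + (-(1 - a₁ / 6) / (s - 1) ^ 2 - (1 - a₂ / 6) / s ^ 2) +
      1 / 2 * Q s ^ 2 := by
    simp only [hv₀, VSeq, dq.deriv]
    rfl
  have h4 : deriv (deriv T) s = nonlin T s * deriv T s := by
    rw [nonlin, div_mul_cancel₀ _ (hne s hs)]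
  rw [h4]
  rw [h3] at h2
  change _ = -3 * (nonlin T s + Q s) at h1
  generalize (-(1 - a₁ / 6) / (s - 1) ^ 2 - (1 - a₂ / 6) / s ^ 2) = dQ at *
  linear_combination h2 + (-1 / 18 * (modE (T s) * deriv T s) + 1 / 6 * (nonlin T s + Q s)
    - 1 / 3 * nonlin T s) * h1

open Complex ComplexConjugate in
/-- A local inverse of `invJ`, with its zero divided out. -/
lemma exists_invJ_inverse : ∃ G : ℂ → ℂ, AnalyticAt ℂ G 0 ∧ G 0 = 1 / 1728 ∧
    ∀ᶠ x in 𝓝 0, invJ (x * G x) = x ∧ conj x * G (conj x) = conj (x * G x) := by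
  have ha := analyticAt_invJ_zero
  have hd : deriv invJ 0 ≠ 0 := by rw [hasDerivAt_invJ_zero.deriv]; norm_num
  have hst := ha.hasStrictDerivAt
  set H := hst.localInverse _ _ _ hd with hH
  have hHa : AnalyticAt ℂ H 0 := by
    have := ha.analyticAt_localInverse hd
    rwa [invJ_zero] at this
  have hH0 : H 0 = 0 := by
    have : H (invJ 0) = 0 := HasStrictFDerivAt.localInverse_apply_image _
    rwa [invJ_zero] at this
  have hHd : deriv H 0 = 1 / 1728 := by
    have := (hst.to_localInverse hd).hasDerivAt.deriv
    rw [invJ_zero] at this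
    rw [this, hasDerivAt_invJ_zero.deriv]; norm_num
  have hr : ∀ᶠ x in 𝓝 (0 : ℂ), invJ (H x) = x := by
    have := hst.eventually_right_inverse hd
    rwa [invJ_zero] at this
  have hl : ∀ᶠ x in 𝓝 (0 : ℂ), H (invJ x) = x := hst.eventually_left_inverse hd
  have hmul : ∀ x, x * dslope H 0 x = H x := by
    intro x
    have := sub_smul_dslope H 0 x
    simpa [hH0] using this
  refine ⟨dslope H 0, ?_, by rw [dslope_same, hHd], ?_⟩
  · obtain ⟨p, hp⟩ := hHa
    exact hp.has_fpower_series_dslope_fslope.analyticAt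
  · have hc0 : Tendsto (fun x => conj (H x)) (𝓝 0) (𝓝 0) := by
      have : ContinuousAt (fun x => conj (H x)) 0 := continuous_conj.continuousAt.comp
        hHa.continuousAt
      simpa [ContinuousAt, hH0] using this
    have hH0' : Tendsto H (𝓝 0) (𝓝 0) := by simpa [ContinuousAt, hH0] using hHa.continuousAt
    filter_upwards [hr, hc0.eventually hl, hH0'.eventually (Metric.ball_mem_nhds 0 one_pos)]
      with x h1 h2 h3
    rw [hmul, hmul]
    refine ⟨h1, ?_⟩
    rwa [invJ_conj h3, h1] at h2

open Complex ComplexConjugate in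
/-- Near a cusp there is a solution of the lifting problem, with logarithmic behaviour. -/
lemma CuspData.exists_local_lift {α β γ : ℝ} {a₁ a₂ a₃ : ℂ} {k n : ℕ} {K : ℝ}
    (h : CuspData α β γ a₁ a₂ a₃ k n K) : ∃ (δ : ℝ) (ℓ : ℂ → ℂ) (η : ℝ), 0 < δ ∧ δ < 1 ∧
      ContinuousOn ℓ (Metric.ball 0 δ) ∧ (∀ x : ℝ, (x : ℂ) ∈ Metric.ball 0 δ → (ℓ x).im = η) ∧
      MapsTo (fun s => (k * log s + ℓ s) / (2 * Real.pi * I))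
        (Metric.ball 0 δ ∩ upperHalfPlaneSet) upperHalfPlaneSet ∧
      HasSchwarzian (V α β γ) (fun s => (k * log s + ℓ s) / (2 * Real.pi * I))
        (Metric.ball 0 δ ∩ upperHalfPlaneSet) ∧
      IsLiftOn (1 - a₁ / 6) (1 - a₂ / 6) (fun s => (k * log s + ℓ s) / (2 * Real.pi * I))
        (Metric.ball 0 δ ∩ upperHalfPlaneSet) := by
  obtain ⟨G, hGa, hG0, hG⟩ := exists_invJ_inverse
  set P : ℂ → ℂ := numer₂ (coeffZero α a₂) (coeffOne α β γ a₁ a₂) (coeffTwo γ a₁ a₂) with hP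
  set N : ℂ → ℂ := numer₃ (a₂ / 6) (a₁ / 6) (coeffZero α a₂) (coeffOne α β γ a₁ a₂)
    (coeffTwo γ a₁ a₂) with hN
  have hk : (k : ℂ) ≠ 0 := by exact_mod_cast h.pos.ne'
  have hK : (K : ℂ) ≠ 0 := by exact_mod_cast h.ne_zero
  have hP0 : P 0 = (k : ℂ) ^ 2 / 72 := by
    simp only [hP, numer₂, coeffZero, h.alpha_eq, h.a₂_eq]
    push_cast; ring
  have hN0 : N 0 = (k : ℂ) ^ 3 / 216 := by
    have : N 0 = 2 * (a₂ / 6) * P 0 := by simp only [hN, hP, numer₃]; ring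
    rw [this, hP0, h.a₂_eq]; ring
  have hPa : Differentiable ℂ P := by
    unfold P numer₂; fun_prop
  have hNa : Differentiable ℂ N := by
    unfold N numer₃ numer₂; fun_prop
  have hPc : ∀ s, P (conj s) = conj (P s) := by
    intro s
    have h1 : conj a₁ = a₁ := conj_eq_iff_im.2 h.a₁_real
    simp [hP, numer₂, coeffZero, coeffOne, coeffTwo, h.a₂_eq, h1, map_ofNat]
  -- By `discr` this is 1 - V₃²/(8 V₂³), the value that 1728/j(T(s)) must take. The nome of T is
  -- therefore r G(r) = s^k U with U(0) ≠ 0.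
  set r : ℂ → ℂ := fun s => K * s ^ k * (s - 1) ^ n / (8 * P s ^ 3) with hr
  have hP0' : P 0 ≠ 0 := by rw [hP0]; exact div_ne_zero (pow_ne_zero _ hk) (by norm_num)
  have hN0' : N 0 ≠ 0 := by rw [hN0]; exact div_ne_zero (pow_ne_zero _ hk) (by norm_num)
  have hra : AnalyticAt ℂ r 0 := by
    have hPa' := hPa.analyticAt 0
    refine AnalyticAt.div ?_ (analyticAt_const.mul (hPa'.pow 3)) (by simp [hP0'])
    exact (analyticAt_const.mul (analyticAt_id.pow k)).mul
      ((analyticAt_id.sub analyticAt_const).pow n)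
  have hr0 : r 0 = 0 := by simp [hr, h.pos.ne']
  have hrc : ∀ s, r (conj s) = conj (r s) := by
    intro s; simp [hr, hPc, map_ofNat]
  set U : ℂ → ℂ := fun s => K * (s - 1) ^ n / (8 * P s ^ 3) * G (r s) with hU
  have hGr : AnalyticAt ℂ (fun s => G (r s)) 0 := by
    have : AnalyticAt ℂ G (r 0) := by rwa [hr0]
    exact this.comp hra
  have hUa : AnalyticAt ℂ U 0 := by
    have hPa' := hPa.analyticAt 0
    refine AnalyticAt.mul (AnalyticAt.div ?_ (analyticAt_const.mul (hPa'.pow 3)) (by simp [hP0']))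
      hGr
    exact analyticAt_const.mul ((analyticAt_id.sub analyticAt_const).pow n)
  have hU0 : U 0 = ((K * (-1) ^ n / (8 * ((k : ℝ) ^ 2 / 72) ^ 3) * (1 / 1728) : ℝ) : ℂ) := by
    simp only [hU, hr0, hG0, hP0]; push_cast; ring
  have hU0' : U 0 ≠ 0 := by
    rw [hU0, ofReal_ne_zero]
    have := h.ne_zero
    have : (k : ℝ) ≠ 0 := by exact_mod_cast h.pos.ne'
    positivity
  have hUr : ∀ s, s ^ k * U s = r s * G (r s) := by
    intro s; simp only [hU, hr]; ring
  -- A logarithm of U. Since U(0) may be negative, U/U(0) is used to stay away from the branch cut;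
  -- on the real axis this quotient is positive, so Im ℓ = Im log U(0).
  set ℓ : ℂ → ℂ := fun s => log (U s / U 0) + log (U 0) with hℓ
  have hone : U 0 / U 0 = 1 := div_self hU0'
  have hℓa : AnalyticAt ℂ ℓ 0 := by
    refine AnalyticAt.add ?_ analyticAt_const
    refine (hUa.div analyticAt_const hU0').clog ?_
    simp [hone]
  have hlim : Tendsto (fun s => r s * G (r s)) (𝓝 0) (𝓝 0) := by
    have : ContinuousAt (fun s => r s * G (r s)) 0 := hra.continuousAt.mul hGr.continuousAt
    simpa [ContinuousAt, hr0] using this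
  have hrlim : Tendsto r (𝓝 0) (𝓝 0) := by
    simpa [ContinuousAt, hr0] using hra.continuousAt
  have hUlim : Tendsto (fun s => U s / U 0) (𝓝 0) (𝓝 1) := by
    have := (hUa.continuousAt.div_const (U 0)).tendsto
    rwa [hone] at this
  have e4 : ∀ᶠ x in 𝓝 (0 : ℂ), epsFour x ≠ 0 :=
    hasDerivAt_epsFour_zero.continuousAt.eventually_ne (by rw [epsFour_zero]; norm_num)
  have e6 : ∀ᶠ x in 𝓝 (0 : ℂ), epsSix x ≠ 0 :=
    hasDerivAt_epsSix_zero.continuousAt.eventually_ne (by rw [epsSix_zero]; norm_num)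
  have hall : ∀ᶠ s in 𝓝 (0 : ℂ), (DifferentiableAt ℂ ℓ s ∧ 0 < (U s / U 0).re ∧
      P s ≠ 0 ∧ N s ≠ 0) ∧ (invJ (r s * G (r s)) = r s ∧
        conj (r s) * G (conj (r s)) = conj (r s * G (r s))) ∧
      epsFour (r s * G (r s)) ≠ 0 ∧ epsSix (r s * G (r s)) ≠ 0 ∧
      r s * G (r s) ∈ Metric.ball (0 : ℂ) 1 := by
    filter_upwards [hℓa.eventually_analyticAt,
      hUlim.eventually ((isOpen_lt continuous_const continuous_re).mem_nhds
        (show (0 : ℝ) < (1 : ℂ).re by simp)), hPa.continuous.continuousAt.eventually_ne hP0',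
      hNa.continuous.continuousAt.eventually_ne hN0', hrlim.eventually hG, hlim.eventually e4,
      hlim.eventually e6, hlim.eventually (Metric.ball_mem_nhds 0 one_pos)]
      with s h1 h2 h3 h4 h5 h6 h7 h8
    exact ⟨⟨h1.differentiableAt, h2, h3, h4⟩, h5, h6, h7, h8⟩
  obtain ⟨δ₀, hδ₀, hball⟩ := Metric.eventually_nhds_iff_ball.1 hall
  set δ := min δ₀ (1 / 2) with hδ
  have hδpos : 0 < δ := lt_min hδ₀ (by norm_num)
  have hb : ∀ s ∈ Metric.ball (0 : ℂ) δ, s ∈ Metric.ball (0 : ℂ) δ₀ := fun s hs =>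
    Metric.ball_subset_ball (min_le_left _ _) hs
  refine ⟨δ, ℓ, (log (U 0)).im, hδpos, (min_le_right _ _).trans_lt (by norm_num),
    fun s hs => (hball s (hb s hs)).1.1.continuousAt.continuousWithinAt, ?_, ?_⟩
  · intro x hx
    obtain ⟨⟨-, h2, -, -⟩, ⟨-, h4⟩, -⟩ := hball x (hb x hx)
    have hUx : conj (U x) = U x := by
      by_cases hx0 : x = 0
      · rw [hx0, ofReal_zero, hU0, conj_ofReal]
      · have h5 := hrc x
        rw [conj_ofReal] at h5
        rw [← h5, ← hUr, map_mul, map_pow, conj_ofReal] at h4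
        exact (mul_left_cancel₀ (pow_ne_zero k (ofReal_ne_zero.2 hx0)) h4).symm
    have hreal : conj (U x / U 0) = U x / U 0 := by
      rw [map_div₀, hUx, hU0, conj_ofReal]
    rw [hℓ]
    simp only [add_im, log_im, add_eq_right]
    rw [← conj_eq_iff_re.1 hreal, arg_ofReal_of_nonneg h2.le]
  set T : ℂ → ℂ := fun s => (k * log s + ℓ s) / (2 * Real.pi * I) with hT
  set C := Metric.ball (0 : ℂ) δ ∩ upperHalfPlaneSet with hC
  have hCo : IsOpen C := Metric.isOpen_ball.inter isOpen_uhp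
  have hpi : (Real.pi : ℂ) ≠ 0 := by simp
  have hq : ∀ s ∈ C, Function.Periodic.qParam 1 (T s) = r s * G (r s) := by
    intro s hs
    obtain ⟨⟨-, h2, -, -⟩, -⟩ := hball s (hb s hs.1)
    have hs0 := ne_zero_of_mem hs.2
    have hUs : U s / U 0 ≠ 0 := fun h => by simp [h] at h2
    have : 2 * (Real.pi : ℂ) * I * T s / ((1 : ℝ) : ℂ) = k * log s + ℓ s := by
      simp only [hT]; field_simp; simp
    rw [Function.Periodic.qParam, this, exp_add, exp_nat_mul, exp_log hs0, hℓ, exp_add,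
      exp_log hUs, exp_log hU0', div_mul_cancel₀ _ hU0', hUr]
  have hTH : MapsTo T C upperHalfPlaneSet := by
    intro s hs
    have h8 := (hball s (hb s hs.1)).2.2.2.2
    rw [← hq s hs, mem_ball_zero_iff] at h8
    have := (Function.Periodic.norm_qParam_lt_iff (h := 1) one_pos 0 (T s)).1 (by simpa using h8)
    exact this
  refine ⟨hTH, lift_of_invariant_eq hCo inter_subset_right ?_ hTH
    ((vertexSystem_iff h.sum_eq).1 h.system) ?_ ?_ ?_ ?_ ?_ ?_⟩
  · intro s hs
    have hsl : s ∈ slitPlane := mem_slitPlane_iff.2 (.inr (show (0 : ℝ) < s.im from hs.2).ne')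
    have h1 := (hball s (hb s hs.1)).1.1
    exact ((((differentiableAt_id.clog hsl).const_mul (k : ℂ)).add h1).div_const
      _).differentiableWithinAt
  · intro s hs
    obtain ⟨⟨-, -, h3, h4⟩, ⟨h5, -⟩, h6, h7, -⟩ := hball s (hb s hs.1)
    have hs0 := ne_zero_of_mem hs.2
    have hs1 := ne_one_of_mem hs.2
    have hs1' := sub_ne_zero.2 hs1
    rw [VSeq_zero_eq α β γ a₁ a₂ hs0 hs1, VSeq_one_eq α β γ a₁ a₂ hs0 hs1, modF, modG, hq s hs]
    change _ * (P s / _) ^ 3 = (N s / _) ^ 2 * _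
    rw [invJ] at h5
    have hdisc : 8 * P s ^ 3 - N s ^ 2 = K * s ^ k * (s - 1) ^ n := h.discr s
    have hrs : r s = (8 * P s ^ 3 - N s ^ 2) / (8 * P s ^ 3) := by rw [hdisc]
    generalize r s * G (r s) = Q at *
    rw [hrs] at h5
    have key : 6 * epsSix Q ^ 2 * P s ^ 3 = -(N s ^ 2 * epsFour Q ^ 3) := by
      rw [div_eq_div_iff (by simp [h6]) (by simp [h3])] at h5
      linear_combination (1 / 4) * h5
    field_simp
    ring_nf
    simp only [I_sq]
    linear_combination (-8 : ℂ) * key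
  · intro s hs
    have := (hball s (hb s hs.1)).2.2.1
    rw [modF, hq s hs]
    simp [this]
  · intro s hs
    have := (hball s (hb s hs.1)).2.2.2.1
    rw [modG, hq s hs]
    simp [this]
  · intro s hs
    have hs0 := ne_zero_of_mem hs.2
    have hs1 := ne_one_of_mem hs.2
    have hs1' := sub_ne_zero.2 hs1
    rw [VSeq_zero_eq α β γ a₁ a₂ hs0 hs1]
    have : P s ≠ 0 := (hball s (hb s hs.1)).1.2.2.1
    change P s / _ ≠ 0
    positivity
  · intro s hs
    have hs0 := ne_zero_of_mem hs.2
    have hs1 := ne_one_of_mem hs.2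
    have hs1' := sub_ne_zero.2 hs1
    rw [VSeq_one_eq α β γ a₁ a₂ hs0 hs1]
    have : N s ≠ 0 := (hball s (hb s hs.1)).1.2.2.2
    change N s / _ ≠ 0
    positivity
  · intro s hs
    have hs0 := ne_zero_of_mem hs.2
    have hs1 := ne_one_of_mem hs.2
    have hs1' := sub_ne_zero.2 hs1
    rw [VSeq_zero_eq α β γ a₁ a₂ hs0 hs1, VSeq_one_eq α β γ a₁ a₂ hs0 hs1]
    have : 8 * (P s / (s ^ 2 * (s - 1) ^ 2)) ^ 3 - (N s / (s ^ 3 * (s - 1) ^ 3)) ^ 2 =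
        K * s ^ k * (s - 1) ^ n / (s ^ 6 * (s - 1) ^ 6) := by
      have hdisc : 8 * P s ^ 3 - N s ^ 2 = K * s ^ k * (s - 1) ^ n := h.discr s
      rw [← hdisc]; field_simp
    change 8 * (P s / (s ^ 2 * (s - 1) ^ 2)) ^ 3 - (N s / (s ^ 3 * (s - 1) ^ 3)) ^ 2 ≠ 0
    rw [this]
    positivity

/-! ### Uniqueness of maps with a given Schwarzian derivative -/

lemma eq_const_of_hasDerivAt_zero {f : ℂ → ℂ} {U : Set ℂ} (hU : IsOpen U)
    (hUc : IsPreconnected U) (h : ∀ s ∈ U, HasDerivAt f 0 s) {s₀ : ℂ} (hs₀ : s₀ ∈ U) :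
    ∀ s ∈ U, f s = f s₀ := fun _ hs =>
  hU.is_const_of_deriv_eq_zero hUc
    (fun x hx => (h x hx).differentiableAt.differentiableWithinAt)
    (fun x hx => (h x hx).deriv) hs hs₀

/-- Two maps with the same Schwarzian derivative differ by a fractional linear transformation. -/
lemma HasSchwarzian.eq_moebius {W Z T : ℂ → ℂ} {U : Set ℂ} (hU : IsOpen U)
    (hUc : IsPreconnected U) (hne : U.Nonempty) (hZ : HasSchwarzian W Z U)
    (hT : HasSchwarzian W T U) :
    (∃ ρ σ : ℂ, ρ ≠ 0 ∧ ∀ s ∈ U, T s = ρ * Z s + σ) ∨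
      ∃ ξ ρ σ : ℂ, ρ ≠ 0 ∧ ∀ s ∈ U, Z s ≠ ξ ∧ T s = ρ * (-1 / (Z s - ξ)) + σ := by
  obtain ⟨s₀, hs₀⟩ := hne
  have dZ : ∀ s ∈ U, HasDerivAt Z (deriv Z s) s := fun s hs => hZ.hasDerivAt hU hs
  have dT : ∀ s ∈ U, HasDerivAt T (deriv T s) s := fun s hs => hT.hasDerivAt hU hs
  have dZ' : ∀ s ∈ U, HasDerivAt (deriv Z) (nonlin Z s * deriv Z s) s :=
    fun s hs => hZ.hasDerivAt_deriv hU hs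
  have dT' : ∀ s ∈ U, HasDerivAt (deriv T) (nonlin T s * deriv T s) s :=
    fun s hs => hT.hasDerivAt_deriv hU hs
  set d : ℂ → ℂ := fun s => nonlin T s - nonlin Z s with hd
  have dd : ∀ s ∈ U, HasDerivAt d (d s * (nonlin Z s + nonlin T s) / 2) s := fun s hs =>
    ((hT.eqn s hs).sub (hZ.eqn s hs)).congr_deriv (by simp only [hd]; ring)
  -- If T = M ∘ Z, then d = (M''/M')(Z) Z'. Constancy of this quotient shows that d vanishes
  -- identically or nowhere, the affine and the non-affine case.
  have hc1 : ∀ s ∈ U, d s ^ 2 / (deriv Z s * deriv T s) =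
      d s₀ ^ 2 / (deriv Z s₀ * deriv T s₀) := by
    refine eq_const_of_hasDerivAt_zero hU hUc (f := fun s => d s ^ 2 / (deriv Z s * deriv T s))
      (fun s hs => ?_) hs₀
    have h1 := hZ.deriv_ne s hs
    have h2 := hT.deriv_ne s hs
    refine (((dd s hs).pow 2).div ((dZ' s hs).mul (dT' s hs)) (mul_ne_zero h1 h2)).congr_deriv ?_
    simp only [Pi.mul_apply, Pi.pow_apply, Nat.cast_ofNat, Nat.add_one_sub_one, pow_one]
    field_simp
    ring
  by_cases h0 : d s₀ = 0
  · left
    have hd0 : ∀ s ∈ U, d s = 0 := by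
      intro s hs
      have h := hc1 s hs
      rw [h0] at h
      simpa [hZ.deriv_ne s hs, hT.deriv_ne s hs] using h
    have hc2 : ∀ s ∈ U, deriv T s / deriv Z s = deriv T s₀ / deriv Z s₀ := by
      refine eq_const_of_hasDerivAt_zero hU hUc (f := fun s => deriv T s / deriv Z s)
        (fun s hs => ?_) hs₀
      have h1 := hZ.deriv_ne s hs
      refine ((dT' s hs).div (dZ' s hs) h1).congr_deriv ?_
      have : nonlin T s = nonlin Z s := sub_eq_zero.1 (hd0 s hs)
      rw [this]
      field_simp
      simp
    set ρ := deriv T s₀ / deriv Z s₀ with hρ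
    have hc3 : ∀ s ∈ U, T s - ρ * Z s = T s₀ - ρ * Z s₀ := by
      refine eq_const_of_hasDerivAt_zero hU hUc (f := fun s => T s - ρ * Z s)
        (fun s hs => ?_) hs₀
      refine ((dT s hs).sub ((dZ s hs).const_mul ρ)).congr_deriv ?_
      rw [← hc2 s hs, div_mul_cancel₀ _ (hZ.deriv_ne s hs), sub_self]
    refine ⟨ρ, T s₀ - ρ * Z s₀, div_ne_zero (hT.deriv_ne _ hs₀) (hZ.deriv_ne _ hs₀),
      fun s hs => ?_⟩
    linear_combination hc3 s hs
  · right
    have hd0 : ∀ s ∈ U, d s ≠ 0 := by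
      intro s hs h
      have h' := hc1 s hs
      rw [h] at h'
      rw [zero_pow two_ne_zero, zero_div, eq_comm, div_eq_zero_iff] at h'
      rcases h' with h' | h'
      · exact h0 (pow_eq_zero_iff two_ne_zero |>.1 h')
      · exact mul_ne_zero (hZ.deriv_ne _ hs₀) (hT.deriv_ne _ hs₀) h'
    -- For M with pole ξ, M''/M' = -2/(z - ξ), so 2 Z'/d + Z is the pole.
    have hc2 : ∀ s ∈ U, 2 * deriv Z s / d s + Z s = 2 * deriv Z s₀ / d s₀ + Z s₀ := by
      refine eq_const_of_hasDerivAt_zero hU hUc (f := fun s => 2 * deriv Z s / d s + Z s)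
        (fun s hs => ?_) hs₀
      have h1 := hd0 s hs
      refine ((((dZ' s hs).const_mul 2).div (dd s hs) h1).add (dZ s hs)).congr_deriv ?_
      have e : nonlin T s = d s + nonlin Z s := by simp [hd]
      rw [e]
      field_simp
      ring
    set ξ := 2 * deriv Z s₀ / d s₀ + Z s₀ with hξ
    have hsub : ∀ s ∈ U, Z s - ξ = -(2 * deriv Z s / d s) := fun s hs => by
      linear_combination hc2 s hs
    have hne : ∀ s ∈ U, Z s - ξ ≠ 0 := by
      intro s hs
      rw [hsub s hs, neg_ne_zero]
      exact div_ne_zero (mul_ne_zero two_ne_zero (hZ.deriv_ne s hs)) (hd0 s hs)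
    have hc3 : ∀ s ∈ U, deriv T s / deriv Z s * (Z s - ξ) ^ 2 =
        deriv T s₀ / deriv Z s₀ * (Z s₀ - ξ) ^ 2 := by
      refine eq_const_of_hasDerivAt_zero hU hUc
        (f := fun s => deriv T s / deriv Z s * (Z s - ξ) ^ 2) (fun s hs => ?_) hs₀
      have h1 := hZ.deriv_ne s hs
      refine (((dT' s hs).div (dZ' s hs) h1).mul (((dZ s hs).sub_const ξ).pow 2)).congr_deriv ?_
      have e : nonlin T s = d s + nonlin Z s := by simp [hd]
      simp only [Pi.pow_apply, Pi.div_apply]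
      rw [hsub s hs, e]
      have h2 := hd0 s hs
      generalize d s = x at *
      simp only [Nat.cast_ofNat, Nat.add_one_sub_one, pow_one]
      field_simp
      ring
    set ρ := deriv T s₀ / deriv Z s₀ * (Z s₀ - ξ) ^ 2 with hρ
    have hc4 : ∀ s ∈ U, T s - ρ * (-1 / (Z s - ξ)) = T s₀ - ρ * (-1 / (Z s₀ - ξ)) := by
      refine eq_const_of_hasDerivAt_zero hU hUc (f := fun s => T s - ρ * (-1 / (Z s - ξ)))
        (fun s hs => ?_) hs₀
      have h1 := hne s hs
      have h2 := hZ.deriv_ne s hs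
      refine ((dT s hs).sub (((hasDerivAt_const s (-1 : ℂ)).div ((dZ s hs).sub_const ξ)
        h1).const_mul ρ)).congr_deriv ?_
      rw [← hc3 s hs]
      field_simp
      ring
    refine ⟨ξ, ρ, T s₀ - ρ * (-1 / (Z s₀ - ξ)), mul_ne_zero (div_ne_zero (hT.deriv_ne _ hs₀)
      (hZ.deriv_ne _ hs₀)) (pow_ne_zero 2 (hne _ hs₀)), fun s hs => ⟨sub_ne_zero.1 (hne s hs), ?_⟩⟩
    linear_combination hc4 s hs


/-! ### Triangle maps and the geometry at a cusp -/

/-- The boundary values of `Z` on `I` exist and lie on the hyperbolic line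
`A |p| ^ 2 + B Re p + C = 0`. -/
def HasSide (Z : ℂ → ℂ) (I : Set ℝ) (A B C : ℝ) : Prop :=
  ∀ x ∈ I, ∃ p : ℂ, 0 < p.im ∧ A * Complex.normSq p + B * p.re + C = 0 ∧
    Tendsto Z (𝓝[upperHalfPlaneSet] (x : ℂ)) (𝓝 p)

/-- A locally injective map of the upper half-plane into itself with given Schwarzian derivative,
carrying the intervals between `0, 1, ∞` to hyperbolic lines. -/
structure IsTriangleMap (W Z : ℂ → ℂ) : Prop where
  schwarzian : HasSchwarzian W Z upperHalfPlaneSet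
  mapsTo : MapsTo Z upperHalfPlaneSet upperHalfPlaneSet
  sides : ∀ I ∈ ({Iio 0, Ioo 0 1, Ioi 1} : Set (Set ℝ)), ∃ A B C : ℝ,
    0 < B ^ 2 - 4 * A * C ∧ HasSide Z I A B C

lemma IsSchwarzMap.isTriangleMap {α β γ : ℝ} {Z : ℂ → ℂ} (h : IsSchwarzMap α β γ Z) :
    IsTriangleMap (V α β γ) Z := by
  refine ⟨h.hasSchwarzian, h.mapsTo, fun I hI => ?_⟩
  obtain ⟨L, ⟨A, B, C, hd, rfl⟩, hL⟩ := h.sides I hI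
  refine ⟨A, B, C, hd, fun x hx => ?_⟩
  obtain ⟨p, ⟨hp, hp'⟩, ht⟩ := hL x hx
  exact ⟨p, hp, hp', ht⟩

lemma HasSchwarzian.moebius_comp {W Z : ℂ → ℂ} {U : Set ℂ} (hU : IsOpen U)
    (h : HasSchwarzian W Z U) (M : GL (Fin 2) ℂ)
    (hM : ∀ s ∈ U, M 1 0 * Z s + M 1 1 ≠ 0) :
    HasSchwarzian W (fun s => moebius M (Z s)) U := by
  have h1 : ∀ s ∈ U, HasDerivAt (fun s => moebius M (Z s)) (moebiusDeriv M (Z s) * deriv Z s) s :=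
    fun s hs => (hasDerivAt_moebius M (hM s hs)).comp s (h.hasDerivAt hU hs)
  have h2 : ∀ s ∈ U, HasDerivAt (deriv fun s => moebius M (Z s))
      ((nonlin Z s + moebiusNonlin M (Z s) * deriv Z s) * (moebiusDeriv M (Z s) * deriv Z s))
      s := by
    intro s hs
    have hev : (deriv fun s => moebius M (Z s)) =ᶠ[𝓝 s]
        fun s => moebiusDeriv M (Z s) * deriv Z s := by
      filter_upwards [hU.mem_nhds hs] with x hx using (h1 x hx).deriv
    have hc : HasDerivAt (fun s => moebiusDeriv M (Z s)) _ s :=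
      (hasDerivAt_moebiusDeriv M (hM s hs)).comp s (h.hasDerivAt hU hs)
    refine ((hc.mul (h.hasDerivAt_deriv hU hs)).congr_of_eventuallyEq hev).congr_deriv ?_
    ring
  have hne : ∀ s ∈ U, moebiusDeriv M (Z s) * deriv Z s ≠ 0 := fun s hs =>
    mul_ne_zero (moebiusDeriv_ne_zero M (hM s hs)) (h.deriv_ne s hs)
  have h3 : ∀ s ∈ U, nonlin (fun s => moebius M (Z s)) s =
      nonlin Z s + moebiusNonlin M (Z s) * deriv Z s := by
    intro s hs
    rw [nonlin, (h2 s hs).deriv, (h1 s hs).deriv, mul_div_cancel_right₀ _ (hne s hs)]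
  refine ⟨fun s hs => (h1 s hs).differentiableAt.differentiableWithinAt, fun s hs => ?_,
    fun s hs => ?_⟩
  · rw [(h1 s hs).deriv]; exact hne s hs
  · have hev : nonlin (fun s => moebius M (Z s)) =ᶠ[𝓝 s]
        fun s => nonlin Z s + moebiusNonlin M (Z s) * deriv Z s := by
      filter_upwards [hU.mem_nhds hs] with x hx using h3 x hx
    have hc : HasDerivAt (fun s => moebiusNonlin M (Z s)) _ s :=
      (hasDerivAt_moebiusNonlin M (hM s hs)).comp s (h.hasDerivAt hU hs)
    refine (((h.eqn s hs).add (hc.mul (h.hasDerivAt_deriv hU hs))).congr_of_eventuallyEq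
      hev).congr_deriv ?_
    rw [h3 s hs]
    ring

lemma HasSchwarzian.congr {W Z Z' : ℂ → ℂ} {U : Set ℂ} (hU : IsOpen U)
    (h : HasSchwarzian W Z U) (he : EqOn Z' Z U) : HasSchwarzian W Z' U := by
  have e1 : ∀ s ∈ U, Z' =ᶠ[𝓝 s] Z := fun s hs => by
    filter_upwards [hU.mem_nhds hs] with x hx using he hx
  have e2 : ∀ s ∈ U, nonlin Z' s = nonlin Z s := fun s hs => by
    rw [nonlin, nonlin, (e1 s hs).deriv_eq, (e1 s hs).deriv.deriv_eq]
  refine ⟨h.diff.congr he, fun s hs => ?_, fun s hs => ?_⟩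
  · rw [(e1 s hs).deriv_eq]; exact h.deriv_ne s hs
  · rw [e2 s hs]
    refine (h.eqn s hs).congr_of_eventuallyEq ?_
    filter_upwards [hU.mem_nhds hs] with x hx using e2 x hx

/-- The matrix of `z ↦ ρ z + σ`. -/
def affineMatrix (ρ σ : ℂ) (hρ : ρ ≠ 0) : GL (Fin 2) ℂ :=
  Matrix.GeneralLinearGroup.mkOfDetNeZero !![ρ, σ; 0, 1] (by simpa using hρ)

lemma moebius_affineMatrix {ρ σ : ℂ} (hρ : ρ ≠ 0) (z : ℂ) :
    moebius (affineMatrix ρ σ hρ) z = ρ * z + σ := by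
  simp [moebius, affineMatrix, Matrix.GeneralLinearGroup.mkOfDetNeZero]

lemma affineMatrix_denom {ρ σ : ℂ} (hρ : ρ ≠ 0) (z : ℂ) :
    affineMatrix ρ σ hρ 1 0 * z + affineMatrix ρ σ hρ 1 1 ≠ 0 := by
  simp [affineMatrix, Matrix.GeneralLinearGroup.mkOfDetNeZero]

/-- The matrix of `z ↦ ρ (-1 / (z - ξ)) + σ`. -/
def inversionMatrix (ξ ρ σ : ℂ) (hρ : ρ ≠ 0) : GL (Fin 2) ℂ :=
  Matrix.GeneralLinearGroup.mkOfDetNeZero !![σ, -σ * ξ - ρ; 1, -ξ] (by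
    rw [Matrix.det_fin_two]; simpa using hρ)

lemma inversionMatrix_denom {ξ ρ σ : ℂ} (hρ : ρ ≠ 0) (z : ℂ) :
    inversionMatrix ξ ρ σ hρ 1 0 * z + inversionMatrix ξ ρ σ hρ 1 1 = z - ξ := by
  simp [inversionMatrix, Matrix.GeneralLinearGroup.mkOfDetNeZero]
  ring

lemma moebius_inversionMatrix {ξ ρ σ : ℂ} (hρ : ρ ≠ 0) {z : ℂ} (hz : z ≠ ξ) :
    moebius (inversionMatrix ξ ρ σ hρ) z = ρ * (-1 / (z - ξ)) + σ := by
  have hz' := sub_ne_zero.2 hz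
  rw [moebius, inversionMatrix_denom]
  simp [inversionMatrix, Matrix.GeneralLinearGroup.mkOfDetNeZero]
  field_simp
  ring

lemma ne_ofReal_of_im_pos {z : ℂ} (hz : 0 < z.im) (ξ : ℝ) : z ≠ ξ := by
  rintro rfl; simp at hz

lemma im_neg_one_div {z : ℂ} (hz : 0 < z.im) (ξ : ℝ) : 0 < (-1 / (z - ξ)).im := by
  have h : z - ξ ≠ 0 := sub_ne_zero.2 (ne_ofReal_of_im_pos hz ξ)
  have : (-1 / (z - ξ)).im = z.im / Complex.normSq (z - ξ) := by
    rw [neg_div, one_div, Complex.neg_im, Complex.inv_im]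
    simp
    ring
  rw [this]
  exact div_pos hz (Complex.normSq_pos.2 h)

lemma IsTriangleMap.inversion {W Z : ℂ → ℂ} (h : IsTriangleMap W Z) (ξ : ℝ) :
    IsTriangleMap W (fun s => -1 / (Z s - ξ)) := by
  refine ⟨?_, fun s hs => im_neg_one_div (h.mapsTo hs) ξ, fun I hI => ?_⟩
  · have hd : ∀ s ∈ upperHalfPlaneSet, inversionMatrix ξ 1 0 one_ne_zero 1 0 * Z s +
        inversionMatrix ξ 1 0 one_ne_zero 1 1 ≠ 0 := fun s hs => by
      rw [inversionMatrix_denom]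
      exact sub_ne_zero.2 (ne_ofReal_of_im_pos (h.mapsTo hs) ξ)
    refine (h.schwarzian.moebius_comp isOpen_uhp (inversionMatrix ξ 1 0 one_ne_zero) hd).congr
      isOpen_uhp fun s hs => ?_
    rw [moebius_inversionMatrix one_ne_zero (ne_ofReal_of_im_pos (h.mapsTo hs) ξ)]
    ring
  · obtain ⟨A, B, C, hd, hs⟩ := h.sides I hI
    -- The equation of the side after substituting p = ξ - 1/p'; its discriminant is unchanged.
    refine ⟨A * ξ ^ 2 + B * ξ + C, -(2 * A * ξ + B), A, by linarith, fun x hx => ?_⟩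
    obtain ⟨p, hp, hpL, ht⟩ := hs x hx
    have hne : p - ξ ≠ 0 := sub_ne_zero.2 (ne_ofReal_of_im_pos hp ξ)
    refine ⟨-1 / (p - ξ), im_neg_one_div hp ξ, ?_, tendsto_const_nhds.div (ht.sub_const _) hne⟩
    have hn : Complex.normSq (p - ξ) ≠ 0 := (Complex.normSq_pos.2 hne).ne'
    have e1 : Complex.normSq (-1 / (p - ξ)) = 1 / Complex.normSq (p - ξ) := by simp
    have e2 : (-1 / (p - ξ)).re = -(p.re - ξ) / Complex.normSq (p - ξ) := by
      rw [neg_div, one_div, Complex.neg_re, Complex.inv_re]; simp; ring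
    rw [e1, e2]
    field_simp
    rw [Complex.normSq_apply] at hpL ⊢
    simp only [Complex.sub_re, Complex.ofReal_re, Complex.sub_im, Complex.ofReal_im, sub_zero]
    linear_combination hpL

/-- `T` has boundary values on `I` with real part `c` and arbitrarily large imaginary part. -/
def HasCuspLimits (T : ℂ → ℂ) (c : ℝ) (I : Set ℝ) : Prop :=
  ∀ M : ℝ, ∃ x ∈ I, ∃ y : ℝ, M < y ∧
    Tendsto T (𝓝[upperHalfPlaneSet] (x : ℂ)) (𝓝 (c + y * Complex.I))

instance neBot_nhdsWithin_uhp (x : ℝ) : (𝓝[upperHalfPlaneSet] (x : ℂ)).NeBot := by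
  rw [← mem_closure_iff_nhdsWithin_neBot]
  have : upperHalfPlaneSet = {z : ℂ | (0 : ℝ) < z.im} := rfl
  rw [this, Complex.closure_setOfPred_lt_im]
  simp

lemma quadratic_eq_zero_of_unbounded {a b c : ℝ}
    (h : ∀ M : ℝ, ∃ y, M < y ∧ a * y ^ 2 + b * y + c = 0) : a = 0 ∧ b = 0 ∧ c = 0 := by
  obtain ⟨y₁, -, h1⟩ := h 0
  obtain ⟨y₂, h12, h2⟩ := h y₁
  obtain ⟨y₃, h23, h3⟩ := h y₂
  have e1 : a * (y₁ + y₂) + b = 0 := by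
    refine (mul_eq_zero.1 (?_ : (y₂ - y₁) * _ = 0)).resolve_left (sub_ne_zero.2 h12.ne')
    linear_combination h2 - h1
  have e2 : a * (y₂ + y₃) + b = 0 := by
    refine (mul_eq_zero.1 (?_ : (y₃ - y₂) * _ = 0)).resolve_left (sub_ne_zero.2 h23.ne')
    linear_combination h3 - h2
  have ha : a = 0 := by
    refine (mul_eq_zero.1 (?_ : (y₃ - y₁) * _ = 0)).resolve_left
      (sub_ne_zero.2 (h12.trans h23).ne')
    linear_combination e2 - e1
  have hb : b = 0 := by linear_combination e1 - (y₁ + y₂) * ha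
  exact ⟨ha, hb, by linear_combination h1 - y₁ ^ 2 * ha - y₁ * hb⟩

/-- The point p = ρ⁻¹ (g + iY) satisfies the equation of the side for arbitrarily large Y, so the
quadratic in Y vanishes identically. Its leading coefficient gives A = 0, the linear one that ρ is
real, and Im p > 0 the sign. -/
lemma HasSide.vertical_of_cusp {Z : ℂ → ℂ} {I : Set ℝ} {A B C : ℝ} (hd : 0 < B ^ 2 - 4 * A * C)
    (hs : HasSide Z I A B C) {ρ σ : ℂ} (hρ : ρ ≠ 0) {c : ℝ}
    (hc : HasCuspLimits (fun s => ρ * Z s + σ) c I) :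
    A = 0 ∧ ρ.im = 0 ∧ 0 < ρ.re := by
  set e := (ρ⁻¹).re with he
  set f := (ρ⁻¹).im with hf
  set g := c - σ.re with hg
  have key : ∀ M : ℝ, ∃ Y, M < Y ∧ 0 < f * g + e * Y ∧
      A * ((e ^ 2 + f ^ 2) * (g ^ 2 + Y ^ 2)) + B * (e * g - f * Y) + C = 0 := by
    intro M
    obtain ⟨x, hx, y, hy, ht⟩ := hc (M + σ.im)
    obtain ⟨p, hp, hpL, htp⟩ := hs x hx
    have hlim := tendsto_nhds_unique ht ((htp.const_mul ρ).add_const σ)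
    have hpe : p = ρ⁻¹ * (g + (y - σ.im : ℝ) * Complex.I) := by
      have : (g : ℂ) + (y - σ.im : ℝ) * Complex.I = ρ * p := by
        have h1 : ρ * p = c + y * Complex.I - σ := by rw [hlim]; ring
        rw [h1]
        apply Complex.ext <;> simp [hg]
      rw [this, inv_mul_cancel_left₀ hρ]
    have hre : p.re = e * g - f * (y - σ.im) := by
      rw [hpe, Complex.mul_re]; simp [he, hf]
    have him : p.im = f * g + e * (y - σ.im) := by
      rw [hpe, Complex.mul_im]; simp [he, hf]; ring
    refine ⟨y - σ.im, by linarith, him ▸ hp, ?_⟩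
    rw [Complex.normSq_apply, hre, him] at hpL
    linear_combination hpL
  have hq := quadratic_eq_zero_of_unbounded (a := A * (e ^ 2 + f ^ 2)) (b := -(B * f))
    (c := A * ((e ^ 2 + f ^ 2) * g ^ 2) + B * e * g + C) (fun M => by
      obtain ⟨Y, hY, -, h⟩ := key M
      exact ⟨Y, hY, by linear_combination h⟩)
  have hef : e ^ 2 + f ^ 2 ≠ 0 := by
    have : Complex.normSq ρ⁻¹ ≠ 0 := by simpa using hρ
    rw [Complex.normSq_apply] at this
    intro h; exact this (by rw [← h]; ring)
  have hA : A = 0 := (mul_eq_zero.1 hq.1).resolve_right hef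
  have hB : B ≠ 0 := by rintro rfl; simp [hA] at hd
  have hf0 : f = 0 := by simpa [hB] using hq.2.1
  have he0 : 0 < e := by
    obtain ⟨Y, hY, hpos, -⟩ := key 0
    rw [hf0, zero_mul, zero_add] at hpos
    exact pos_of_mul_pos_left hpos hY.le
  have hρe : ρ = ((e⁻¹ : ℝ) : ℂ) := by
    have : ρ⁻¹ = (e : ℂ) := Complex.ext (by simp [he]) (by simp [← hf, hf0])
    rw [← inv_inv ρ, this]; simp
  refine ⟨hA, by rw [hρe, Complex.ofReal_im], by rw [hρe, Complex.ofReal_re]; positivity⟩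

/-- Here p = ξ - ρ/(g + iY). The two relations are the linear and constant coefficients of the
resulting quadratic in Y, the leading one saying that the side passes through ξ. -/
lemma HasSide.inversion_relation {Z T : ℂ → ℂ} {I : Set ℝ} {A B C : ℝ}
    (hs : HasSide Z I A B C) {ξ ρ σ : ℂ} {c : ℝ} (hc : HasCuspLimits T c I)
    (hT : ∀ x ∈ I, ∀ p w : ℂ, Tendsto Z (𝓝[upperHalfPlaneSet] (x : ℂ)) (𝓝 p) →
      Tendsto T (𝓝[upperHalfPlaneSet] (x : ℂ)) (𝓝 w) → (w - σ) * (p - ξ) = -ρ) :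
    (2 * A * ξ.re + B) * ρ.im - 2 * A * ξ.im * ρ.re = 0 ∧
      ((2 * A * ξ.re + B) * ρ.re + 2 * A * ξ.im * ρ.im) * (c - σ.re) =
        A * Complex.normSq ρ := by
  set g := c - σ.re with hg
  set g₀ := A * Complex.normSq ξ + B * ξ.re + C with hg₀
  have hq := quadratic_eq_zero_of_unbounded (a := g₀)
    (b := -((2 * A * ξ.re + B) * ρ.im - 2 * A * ξ.im * ρ.re))
    (c := g₀ * g ^ 2 - ((2 * A * ξ.re + B) * ρ.re + 2 * A * ξ.im * ρ.im) * g +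
      A * Complex.normSq ρ) (fun M => by
    obtain ⟨x, hx, y, hy, ht⟩ := hc (max M 0 + σ.im)
    obtain ⟨p, hp, hpL, htp⟩ := hs x hx
    have hrel := hT x hx p _ htp ht
    set Y := y - σ.im with hY
    have hMY : max M 0 < Y := by rw [hY]; linarith
    have hY0 : 0 < Y := (le_max_right _ _).trans_lt hMY
    refine ⟨Y, (le_max_left _ _).trans_lt hMY, ?_⟩
    have hw : (c : ℂ) + y * Complex.I - σ = g + Y * Complex.I := by
      apply Complex.ext <;> simp [hg, hY]
    rw [hw] at hrel
    have hre := congrArg Complex.re hrel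
    have him := congrArg Complex.im hrel
    simp only [Complex.mul_re, Complex.mul_im, Complex.add_re, Complex.add_im, Complex.sub_re,
      Complex.sub_im, Complex.ofReal_re, Complex.ofReal_im, Complex.I_re, Complex.I_im,
      Complex.neg_re, Complex.neg_im, mul_zero, mul_one, sub_zero, add_zero, zero_add] at hre him
    have hn : g ^ 2 + Y ^ 2 ≠ 0 := by positivity
    have hpr : p.re = ξ.re - (ρ.re * g + ρ.im * Y) / (g ^ 2 + Y ^ 2) := by
      field_simp
      linear_combination g * hre + Y * him
    have hpi : p.im = ξ.im - (ρ.im * g - ρ.re * Y) / (g ^ 2 + Y ^ 2) := by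
      field_simp
      linear_combination g * him - Y * hre
    rw [Complex.normSq_apply, hpr, hpi] at hpL
    rw [hg₀, Complex.normSq_apply, Complex.normSq_apply]
    field_simp at hpL
    have hcan := mul_right_cancel₀ (b := g ^ 2 + Y ^ 2) hn
      (a := g₀ * Y ^ 2 + -((2 * A * ξ.re + B) * ρ.im - 2 * A * ξ.im * ρ.re) * Y +
        (g₀ * g ^ 2 - ((2 * A * ξ.re + B) * ρ.re + 2 * A * ξ.im * ρ.im) * g +
          A * Complex.normSq ρ)) (c := 0)
    rw [hg₀, Complex.normSq_apply, Complex.normSq_apply] at hcan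
    apply hcan
    linear_combination hpL)
  refine ⟨by linear_combination -hq.2.1, by linear_combination -hq.2.2 + g ^ 2 * hq.1⟩

/-- Circles orthogonal to the real axis that pass through ξ also pass through its conjugate. If ξ
were not real, the two distinct parallel lines Re = c would both contain the image of that conjugate
point. -/
lemma im_eq_zero_of_inversion_relation {A B C A' B' C' g g' : ℝ} {ξ ρ : ℂ} (hρ : ρ ≠ 0)
    (hd : 0 < B ^ 2 - 4 * A * C) (hd' : 0 < B' ^ 2 - 4 * A' * C')
    (h1 : (2 * A * ξ.re + B) * ρ.im - 2 * A * ξ.im * ρ.re = 0)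
    (h2 : ((2 * A * ξ.re + B) * ρ.re + 2 * A * ξ.im * ρ.im) * g = A * Complex.normSq ρ)
    (h1' : (2 * A' * ξ.re + B') * ρ.im - 2 * A' * ξ.im * ρ.re = 0)
    (h2' : ((2 * A' * ξ.re + B') * ρ.re + 2 * A' * ξ.im * ρ.im) * g' = A' * Complex.normSq ρ)
    (hg : g ≠ g') : ξ.im = 0 := by
  by_contra hξ
  have hn : Complex.normSq ρ ≠ 0 := by simpa using hρ
  have aux : ∀ {A B C g : ℝ}, 0 < B ^ 2 - 4 * A * C →
      (2 * A * ξ.re + B) * ρ.im - 2 * A * ξ.im * ρ.re = 0 →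
      ((2 * A * ξ.re + B) * ρ.re + 2 * A * ξ.im * ρ.im) * g = A * Complex.normSq ρ →
      2 * ξ.im * g = ρ.im := by
    intro A B C g hd h1 h2
    set S := (2 * A * ξ.re + B) * ρ.re + 2 * A * ξ.im * ρ.im with hS
    -- The vector (2A Re ξ + B, 2A Im ξ) is parallel to ρ. The resulting g = Im ρ/(2 Im ξ) does not
    -- depend on the side.
    have e1 : Complex.normSq ρ * (2 * A * ξ.re + B) = ρ.re * S := by
      rw [Complex.normSq_apply]; linear_combination ρ.im * h1
    have e2 : Complex.normSq ρ * (2 * A * ξ.im) = ρ.im * S := by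
      rw [Complex.normSq_apply]; linear_combination -ρ.re * h1
    have hS0 : S ≠ 0 := by
      intro h0
      rw [h0, mul_zero] at e1 e2
      have hA : A = 0 := by simpa [hn, hξ] using e2
      have hB : B = 0 := by simpa [hn, hA] using e1
      simp [hA, hB] at hd
    refine mul_right_cancel₀ hS0 ?_
    linear_combination 2 * ξ.im * h2 + e2
  have h3 := aux hd h1 h2
  have h3' := aux hd' h1' h2'
  exact hg (mul_left_cancel₀ (mul_ne_zero two_ne_zero hξ) (h3.trans h3'.symm))

lemma HasCuspLimits.congr {T T' : ℂ → ℂ} {c : ℝ} {I : Set ℝ} {δ : ℝ}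
    (h : HasCuspLimits T c I) (hI : ∀ x ∈ I, |x| < δ)
    (he : ∀ s ∈ Metric.ball (0 : ℂ) δ ∩ upperHalfPlaneSet, T' s = T s) : HasCuspLimits T' c I := by
  intro M
  obtain ⟨x, hx, y, hy, ht⟩ := h M
  refine ⟨x, hx, y, hy, ht.congr' ?_⟩
  have hb : Metric.ball (0 : ℂ) δ ∈ 𝓝 (x : ℂ) :=
    Metric.isOpen_ball.mem_nhds (by simpa using hI x hx)
  filter_upwards [mem_nhdsWithin_of_mem_nhds hb, self_mem_nhdsWithin] with s h1 h2
  exact (he s ⟨h1, h2⟩).symm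

lemma HasCuspLimits.mono {T : ℂ → ℂ} {c : ℝ} {I J : Set ℝ} (h : HasCuspLimits T c I)
    (hIJ : I ⊆ J) : HasCuspLimits T c J := fun M => by
  obtain ⟨x, hx, h⟩ := h M
  exact ⟨x, hIJ hx, h⟩

/-! ### Boundary values of the logarithmic lift on the two sides of the cusp -/

section LogLimits

open Complex

variable {k : ℕ} {δ η : ℝ} {ℓ : ℂ → ℂ}

lemma exists_log_bound (hk : 0 < k) (hδ : 0 < δ) (hℓ : ContinuousOn ℓ (Metric.ball 0 δ)) (M : ℝ) :
    ∃ ε, 0 < ε ∧ ε < δ ∧ ∀ x : ℝ, |x| = ε →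
      M < -(k * Real.log |x| + (ℓ x).re) / (2 * Real.pi) := by
  have hc : ContinuousAt ℓ 0 := hℓ.continuousAt (Metric.ball_mem_nhds 0 hδ)
  have hb : ∀ᶠ s in 𝓝 (0 : ℂ), (ℓ s).re < (ℓ 0).re + 1 :=
    (continuous_re.continuousAt.comp hc).eventually_lt_const
      (by simp : ((re ∘ ℓ) 0) < (ℓ 0).re + 1)
  obtain ⟨r, hr, hrb⟩ := Metric.eventually_nhds_iff_ball.1 hb
  have hlog : ∀ᶠ x in 𝓝[>] (0 : ℝ), Real.log x < -(2 * Real.pi * M + (ℓ 0).re + 1) / k :=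
    Real.tendsto_log_nhdsGT_zero.eventually_lt_atBot _
  have hsmall : ∀ᶠ x in 𝓝[>] (0 : ℝ), x < min r δ :=
    mem_nhdsWithin_of_mem_nhds (Iio_mem_nhds (lt_min hr hδ))
  obtain ⟨ε, ⟨h1, h2⟩, h3⟩ := ((hlog.and hsmall).and self_mem_nhdsWithin).exists
  refine ⟨ε, h3, h2.trans_le (min_le_right _ _), fun x hx => ?_⟩
  have h4 := hrb x (by simpa [hx] using h2.trans_le (min_le_left _ _))
  have hk' : (0 : ℝ) < k := by exact_mod_cast hk
  rw [lt_div_iff₀ hk'] at h1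
  rw [hx, lt_div_iff₀ (by positivity)]
  linarith

lemma hasCuspLimits_pos (hk : 0 < k) (hδ : 0 < δ) (hℓ : ContinuousOn ℓ (Metric.ball 0 δ))
    (hη : ∀ x : ℝ, (x : ℂ) ∈ Metric.ball 0 δ → (ℓ x).im = η) :
    HasCuspLimits (fun s => (k * log s + ℓ s) / (2 * Real.pi * I)) (η / (2 * Real.pi))
      (Ioo 0 δ) := by
  intro M
  obtain ⟨ε, h0, hεδ, hε⟩ := exists_log_bound hk hδ hℓ M
  have hmem : (ε : ℂ) ∈ Metric.ball (0 : ℂ) δ := by simpa [abs_of_pos h0] using hεδ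
  refine ⟨ε, ⟨h0, hεδ⟩, _, hε ε (abs_of_pos h0), ?_⟩
  have hc : ContinuousAt (fun s => (k * log s + ℓ s) / (2 * Real.pi * I)) (ε : ℂ) := by
    have h1 : ContinuousAt log (ε : ℂ) := continuousAt_clog (by simp [h0])
    have h2 := hℓ.continuousAt (Metric.isOpen_ball.mem_nhds hmem)
    exact ((h1.const_mul _).add h2).div_const _
  have := hc.tendsto.mono_left (nhdsWithin_le_nhds (s := upperHalfPlaneSet))
  convert this using 2
  rw [← ofReal_log h0.le]
  have hℓe : ℓ ε = (ℓ ε).re + η * I := by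
    apply Complex.ext <;> simp [hη ε hmem]
  have hpi : (Real.pi : ℂ) ≠ 0 := by simp
  rw [hℓe]
  simp only [add_re, ofReal_re, mul_re, I_re, mul_zero, ofReal_im, I_im, sub_self, add_zero,
    mul_one, abs_of_pos h0]
  push_cast
  field_simp
  ring_nf
  simp only [I_sq]
  ring

/-- To the left of 0 the argument of s is π instead of 0, which shifts the real part by k/2; hence
the two vertical lines are distinct. -/
lemma hasCuspLimits_neg (hk : 0 < k) (hδ : 0 < δ) (hℓ : ContinuousOn ℓ (Metric.ball 0 δ))
    (hη : ∀ x : ℝ, (x : ℂ) ∈ Metric.ball 0 δ → (ℓ x).im = η) :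
    HasCuspLimits (fun s => (k * log s + ℓ s) / (2 * Real.pi * I)) (η / (2 * Real.pi) + k / 2)
      (Ioo (-δ) 0) := by
  intro M
  obtain ⟨ε, h0, hεδ, hε⟩ := exists_log_bound hk hδ hℓ M
  have hmem : ((-ε : ℝ) : ℂ) ∈ Metric.ball (0 : ℂ) δ := by simpa [abs_of_pos h0] using hεδ
  refine ⟨-ε, ⟨by linarith, by linarith⟩, _, hε (-ε) (by simp [abs_of_pos h0]), ?_⟩
  have h1 : Tendsto log (𝓝[upperHalfPlaneSet] ((-ε : ℝ) : ℂ)) (𝓝 (Real.log ε + Real.pi * I)) := by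
    have := tendsto_log_nhdsWithin_im_nonneg_of_re_neg_of_im_zero
      (z := ((-ε : ℝ) : ℂ)) (by simpa using h0) (by simp)
    simp only [ofReal_neg, norm_neg, norm_real, Real.norm_of_nonneg h0.le] at this
    rw [ofReal_neg]
    exact this.mono_left (nhdsWithin_mono _ fun z (hz : 0 < z.im) => hz.le)
  have h2 := (hℓ.continuousAt (Metric.isOpen_ball.mem_nhds hmem)).tendsto.mono_left
    (nhdsWithin_le_nhds (s := upperHalfPlaneSet))
  have := ((h1.const_mul (k : ℂ)).add h2).div_const (2 * Real.pi * I)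
  convert this using 2
  have hℓe : ℓ (-ε : ℝ) = (ℓ (-ε : ℝ)).re + η * I := by
    refine Complex.ext (by simp) ?_
    rw [hη (-ε) hmem]; simp
  have hpi : (Real.pi : ℂ) ≠ 0 := by simp
  rw [hℓe]
  simp only [add_re, ofReal_re, mul_re, I_re, mul_zero, ofReal_im, I_im, sub_self, add_zero,
    mul_one, abs_neg, abs_of_pos h0]
  push_cast
  field_simp
  ring_nf
  simp only [I_sq]
  ring

end LogLimits

/-- `T` has boundary values on `I` satisfying `P`. -/
def HasBoundary (T : ℂ → ℂ) (I : Set ℝ) (P : ℂ → Prop) : Prop :=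
  ∀ x ∈ I, ∃ p, P p ∧ Tendsto T (𝓝[upperHalfPlaneSet] (x : ℂ)) (𝓝 p)

/-- The sides of an affine image of a triangle map with a cusp at infinity. -/
structure HasCuspSides (T : ℂ → ℂ) (t c₁ c₂ : ℝ) : Prop where
  mem : ∀ s ∈ upperHalfPlaneSet, t < (T s).im
  first : HasBoundary T (Ioo 0 1) fun p => t < p.im ∧ p.re = c₁
  second : HasBoundary T (Iio 0) fun p => t < p.im ∧ p.re = c₂
  third : (∃ c₃, HasBoundary T (Ioi 1) fun p => t < p.im ∧ p.re = c₃) ∨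
    ∃ (m : ℂ) (r : ℝ), m.im = t ∧ 0 < r ∧ HasBoundary T (Ioi 1) fun p => t < p.im ∧ ‖p - m‖ = r

/-- The first two sides become vertical by `vertical_of_cusp`. The third may be a line or a circle,
and its centre lies on Im = Im σ, the image of the real axis. -/
lemma IsTriangleMap.hasCuspSides {W Z T : ℂ → ℂ} (hZ : IsTriangleMap W Z) {δ : ℝ} (hδ1 : δ < 1)
    {c₁ c₂ : ℝ} (h1 : HasCuspLimits T c₁ (Ioo 0 δ)) (h2 : HasCuspLimits T c₂ (Ioo (-δ) 0))
    {ρ σ : ℂ} (hρ : ρ ≠ 0)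
    (he : ∀ s ∈ Metric.ball (0 : ℂ) δ ∩ upperHalfPlaneSet, T s = ρ * Z s + σ) :
    ρ.im = 0 ∧ 0 < ρ.re ∧ HasCuspSides (fun s => ρ * Z s + σ) σ.im c₁ c₂ := by
  have h1' : HasCuspLimits (fun s => ρ * Z s + σ) c₁ (Ioo 0 1) :=
    (h1.congr (fun x hx => by rw [abs_of_pos hx.1]; exact hx.2)
      (fun s hs => (he s hs).symm)).mono (Ioo_subset_Ioo_right hδ1.le)
  have h2' : HasCuspLimits (fun s => ρ * Z s + σ) c₂ (Iio 0) :=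
    (h2.congr (fun x hx => by rw [abs_of_neg hx.2]; linarith [hx.1])
      (fun s hs => (he s hs).symm)).mono fun x hx => hx.2
  obtain ⟨A, B, C, hd, hs⟩ := hZ.sides (Ioo 0 1) (by simp)
  obtain ⟨A', B', C', hd', hs'⟩ := hZ.sides (Iio 0) (by simp)
  obtain ⟨A'', B'', C'', hd'', hs''⟩ := hZ.sides (Ioi 1) (by simp)
  obtain ⟨hA, hρi, hρr⟩ := hs.vertical_of_cusp hd hρ h1'
  obtain ⟨hA', -, -⟩ := hs'.vertical_of_cusp hd' hρ h2'
  have him : ∀ z : ℂ, (ρ * z + σ).im = ρ.re * z.im + σ.im := fun z => by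
    simp [Complex.mul_im, hρi]
  have hre : ∀ z : ℂ, (ρ * z + σ).re = ρ.re * z.re + σ.re := fun z => by
    simp [Complex.mul_re, hρi]
  have himlt : ∀ z : ℂ, 0 < z.im → σ.im < (ρ * z + σ).im := fun z hz => by
    rw [him]; nlinarith [mul_pos hρr hz]
  have vert : ∀ {I : Set ℝ} {A B C : ℝ}, 0 < B ^ 2 - 4 * A * C → A = 0 → HasSide Z I A B C →
      HasBoundary (fun s => ρ * Z s + σ) I
        fun p => σ.im < p.im ∧ p.re = ρ.re * (-C / B) + σ.re := by
    intro I A B C hd hA hs x hx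
    obtain ⟨p, hp, hpL, ht⟩ := hs x hx
    refine ⟨ρ * p + σ, ⟨himlt p hp, ?_⟩, (ht.const_mul ρ).add_const σ⟩
    have hB : B ≠ 0 := by rintro rfl; simp [hA] at hd
    rw [hre]
    have : p.re = -C / B := by
      rw [hA] at hpL
      field_simp
      linarith
    rw [this]
  have vert' : ∀ {I : Set ℝ} {A B C c : ℝ}, 0 < B ^ 2 - 4 * A * C → A = 0 → HasSide Z I A B C →
      HasCuspLimits (fun s => ρ * Z s + σ) c I →
      HasBoundary (fun s => ρ * Z s + σ) I fun p => σ.im < p.im ∧ p.re = c := by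
    intro I A B C c hd hA hs hc
    have hv := vert hd hA hs
    obtain ⟨x, hx, y, -, ht⟩ := hc 0
    obtain ⟨p, ⟨-, hp⟩, ht'⟩ := hv x hx
    have := congrArg Complex.re (tendsto_nhds_unique ht ht')
    simp only [Complex.add_re, Complex.ofReal_re, Complex.mul_re, Complex.I_re, mul_zero,
      Complex.ofReal_im, Complex.I_im, mul_one, sub_self, add_zero] at this
    rwa [← hp, ← this] at hv
  refine ⟨hρi, hρr, fun s hs => himlt _ (hZ.mapsTo hs), vert' hd hA hs h1', vert' hd' hA' hs' h2',
    ?_⟩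
  by_cases hA0 : A'' = 0
  · exact .inl ⟨_, vert hd'' hA0 hs''⟩
  · right
    refine ⟨ρ * ((-B'' / (2 * A'') : ℝ) : ℂ) + σ,
      ρ.re * (Real.sqrt (B'' ^ 2 - 4 * A'' * C'') / |2 * A''|), ?_, by positivity,
      fun x hx => ?_⟩
    · rw [him, Complex.ofReal_im]; simp
    obtain ⟨p, hp, hpL, ht⟩ := hs'' x hx
    refine ⟨ρ * p + σ, ⟨himlt p hp, ?_⟩, (ht.const_mul ρ).add_const σ⟩
    rw [add_sub_add_right_eq_sub, ← mul_sub, norm_mul]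
    have e1 : ‖ρ‖ = ρ.re := by
      rw [← Complex.re_add_im ρ, hρi]
      simp [abs_of_pos hρr]
    have e2 : ‖p - ((-B'' / (2 * A'') : ℝ) : ℂ)‖ =
        Real.sqrt (B'' ^ 2 - 4 * A'' * C'') / |2 * A''| := by
      rw [Complex.norm_def, ← Real.sqrt_sq_eq_abs, ← Real.sqrt_div hd''.le]
      congr 1
      rw [Complex.normSq_apply] at hpL ⊢
      simp only [Complex.sub_re, Complex.sub_im, Complex.ofReal_re, Complex.ofReal_im, sub_zero]
      field_simp
      linear_combination 4 * A'' * hpL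
    rw [e1, e2]

/-- After a real normalization, a triangle map with a cusp at `0` agrees with the local lift up
to an affine map. -/
lemma IsTriangleMap.exists_normalization {W Z T : ℂ → ℂ} (hZ : IsTriangleMap W Z) {δ : ℝ}
    (hδ : 0 < δ) (hδ1 : δ < 1)
    (hT : HasSchwarzian W T (Metric.ball 0 δ ∩ upperHalfPlaneSet))
    {c₁ c₂ : ℝ} (hc : c₁ ≠ c₂) (h1 : HasCuspLimits T c₁ (Ioo 0 δ))
    (h2 : HasCuspLimits T c₂ (Ioo (-δ) 0)) :
    ∃ (Z₁ : ℂ → ℂ) (ρ σ : ℂ), IsTriangleMap W Z₁ ∧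
      (Z₁ = Z ∨ ∃ ξ : ℝ, Z₁ = fun s => -1 / (Z s - ξ)) ∧
      (∀ s ∈ Metric.ball (0 : ℂ) δ ∩ upperHalfPlaneSet, T s = ρ * Z₁ s + σ) ∧
      ρ.im = 0 ∧ 0 < ρ.re ∧ HasCuspSides (fun s => ρ * Z₁ s + σ) σ.im c₁ c₂ := by
  set D := Metric.ball (0 : ℂ) δ ∩ upperHalfPlaneSet with hD
  have hDo : IsOpen D := Metric.isOpen_ball.inter isOpen_uhp
  have hDc : IsPreconnected D :=
    ((convex_ball 0 δ).inter (convex_halfSpace_im_gt 0)).isPreconnected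
  have hDne : D.Nonempty := by
    refine ⟨(δ / 2 : ℝ) * Complex.I, ?_, ?_⟩
    · simp [abs_of_pos hδ]; linarith
    · change 0 < Complex.im _
      simp [hδ]
  have hZD : HasSchwarzian W Z D :=
    ⟨hZ.schwarzian.diff.mono inter_subset_right, fun s hs => hZ.schwarzian.deriv_ne s hs.2,
      fun s hs => hZ.schwarzian.eqn s hs.2⟩
  rcases hZD.eq_moebius hDo hDc hDne hT with ⟨ρ, σ, hρ, he⟩ | ⟨ξ, ρ, σ, hρ, he⟩
  · exact ⟨Z, ρ, σ, hZ, .inl rfl, he, hZ.hasCuspSides hδ1 h1 h2 hρ he⟩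
  · have hlim : ∀ x : ℝ, |x| < δ → ∀ p w : ℂ,
        Tendsto Z (𝓝[upperHalfPlaneSet] (x : ℂ)) (𝓝 p) →
        Tendsto T (𝓝[upperHalfPlaneSet] (x : ℂ)) (𝓝 w) → (w - σ) * (p - ξ) = -ρ := by
      intro x hx p w hp hw
      refine tendsto_nhds_unique ((hw.sub_const σ).mul (hp.sub_const ξ)) ?_
      refine tendsto_const_nhds.congr' ?_
      have hb : Metric.ball (0 : ℂ) δ ∈ 𝓝 (x : ℂ) :=
        Metric.isOpen_ball.mem_nhds (by simpa using hx)
      filter_upwards [mem_nhdsWithin_of_mem_nhds hb, self_mem_nhdsWithin] with s hs1 hs2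
      obtain ⟨hne, hTs⟩ := he s ⟨hs1, hs2⟩
      have := sub_ne_zero.2 hne
      rw [hTs]
      field_simp
      ring
    obtain ⟨A, B, C, hd, hs⟩ := hZ.sides (Ioo 0 1) (by simp)
    obtain ⟨A', B', C', hd', hs'⟩ := hZ.sides (Iio 0) (by simp)
    have hsm : HasSide Z (Ioo 0 δ) A B C := fun x hx => hs x ⟨hx.1, hx.2.trans hδ1⟩
    have hsm' : HasSide Z (Ioo (-δ) 0) A' B' C' := fun x hx => hs' x hx.2
    obtain ⟨r1, r2⟩ := hsm.inversion_relation (ξ := ξ) (ρ := ρ) (σ := σ) h1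
      fun x hx => hlim x (by rw [abs_of_pos hx.1]; exact hx.2)
    obtain ⟨r1', r2'⟩ := hsm'.inversion_relation (ξ := ξ) (ρ := ρ) (σ := σ) h2
      fun x hx => hlim x (by rw [abs_of_neg hx.2]; linarith [hx.1])
    -- A real pole means that the inversion preserves the upper half-plane, so it can be absorbed in
    -- the triangle map.
    have hξ := im_eq_zero_of_inversion_relation hρ hd hd' r1 r2 r1' r2'
      (fun h => hc (sub_left_injective h))
    obtain ⟨x, rfl⟩ : ∃ x : ℝ, ξ = (x : ℂ) := ⟨ξ.re, Complex.ext (by simp) (by simp [hξ])⟩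
    exact ⟨_, ρ, σ, hZ.inversion x, .inr ⟨x, rfl⟩, fun s hs => (he s hs).2,
      (hZ.inversion x).hasCuspSides hδ1 h1 h2 hρ fun s hs => (he s hs).2⟩


/-! ### The reflection principle -/

-- Morera's theorem: a rectangle that crosses the real axis is cut along it, and on each half
-- Cauchy's theorem needs only continuity on the boundary.
open Complex in
lemma differentiableOn_of_continuousOn_of_im_ne_zero {f : ℂ → ℂ} {U : Set ℂ} (hU : IsOpen U)
    (hc : ContinuousOn f U) (hd : ∀ z ∈ U, z.im ≠ 0 → DifferentiableAt ℂ f z) :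
    DifferentiableOn ℂ f U := by
  refine (isConservativeOn_and_continuousOn_iff_isDifferentiableOn hU).1 ⟨fun z w hzw => ?_, hc⟩
  rw [← add_eq_zero_iff_eq_neg, wedgeIntegral_add_wedgeIntegral_eq]
  have direct : ∀ z w : ℂ, Rectangle z w ⊆ U → (0 : ℝ) ∉ Ioo (min z.im w.im) (max z.im w.im) →
      (∫ x : ℝ in z.re..w.re, f (x + z.im * I)) - (∫ x : ℝ in z.re..w.re, f (x + w.im * I)) +
      I • (∫ y : ℝ in z.im..w.im, f (w.re + y * I)) -
      I • (∫ y : ℝ in z.im..w.im, f (z.re + y * I)) = 0 := by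
    intro z w hzw h0
    refine integral_boundary_rect_eq_zero_of_continuousOn_of_differentiableOn f z w
      (hc.mono hzw) fun s hs => ?_
    refine (hd s (hzw ⟨?_, ?_⟩) ?_).differentiableWithinAt
    · exact Ioo_subset_Icc_self hs.1
    · exact Ioo_subset_Icc_self hs.2
    · intro h; exact h0 (h ▸ hs.2)
  by_cases h0 : (0 : ℝ) ∈ Ioo (min z.im w.im) (max z.im w.im)
  swap
  · exact direct z w hzw h0
  have h0' : (0 : ℝ) ∈ uIcc z.im w.im := Ioo_subset_Icc_self h0
  have e1 := direct z (w.re : ℂ) (fun s hs => hzw ⟨by simpa using hs.1,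
    uIcc_subset_uIcc_left h0' (by simpa using hs.2)⟩) (by
      simp only [ofReal_im, mem_Ioo, lt_max_iff, min_lt_iff, lt_irrefl]; rintro ⟨h, h'⟩
      simp at h h'; linarith)
  have e2 := direct (z.re : ℂ) w (fun s hs => hzw ⟨by simpa using hs.1,
    uIcc_subset_uIcc_right h0' (by simpa using hs.2)⟩) (by
      simp only [ofReal_im, mem_Ioo, lt_max_iff, min_lt_iff, lt_irrefl]; rintro ⟨h, h'⟩
      simp at h h'; linarith)
  have hint : ∀ a ∈ uIcc z.re w.re, ContinuousOn (fun y : ℝ => f (a + y * I))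
      (uIcc z.im w.im) := by
    intro a ha
    refine hc.comp (by fun_prop) fun y hy => hzw ⟨?_, ?_⟩
    · simpa using ha
    · simpa using hy
  have hadd : ∀ a ∈ uIcc z.re w.re, (∫ y : ℝ in z.im..0, f (a + y * I)) +
      (∫ y : ℝ in (0 : ℝ)..w.im, f (a + y * I)) = ∫ y : ℝ in z.im..w.im, f (a + y * I) := by
    intro a ha
    exact intervalIntegral.integral_add_adjacent_intervals
      ((hint a ha).mono (uIcc_subset_uIcc_left h0')).intervalIntegrable
      ((hint a ha).mono (uIcc_subset_uIcc_right h0')).intervalIntegrable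
  simp only [ofReal_re, ofReal_im] at e1 e2
  rw [← hadd _ left_mem_uIcc, ← hadd _ right_mem_uIcc]
  simp only [smul_eq_mul] at e1 e2 ⊢
  linear_combination e1 + e2

lemma closure_uhp : closure upperHalfPlaneSet = {z : ℂ | 0 ≤ z.im} :=
  Complex.closure_setOfPred_lt_im 0

open ComplexConjugate in
/-- The Schwarz reflection principle across the real axis. -/
lemma exists_reflection {g : ℂ → ℂ} {B : Set ℂ} (hB : IsOpen B)
    (hBc : ∀ s ∈ B, conj s ∈ B) (hg : DifferentiableOn ℂ g (B ∩ upperHalfPlaneSet))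
    (hr : ∀ x : ℝ, (x : ℂ) ∈ B →
      ∃ v : ℝ, Tendsto g (𝓝[upperHalfPlaneSet] (x : ℂ)) (𝓝 (v : ℂ))) :
    ∃ G : ℂ → ℂ, DifferentiableOn ℂ G B ∧ EqOn G g (B ∩ upperHalfPlaneSet) ∧
      (∀ s, G (conj s) = conj (G s)) ∧
      ∀ (x : ℝ) (v : ℂ), (x : ℂ) ∈ B → Tendsto g (𝓝[upperHalfPlaneSet] (x : ℂ)) (𝓝 v) →
        G x = v := by
  set e := extendFrom upperHalfPlaneSet g with he
  have hgd : ∀ s ∈ B, 0 < s.im → DifferentiableAt ℂ g s := fun s hs h =>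
    hg.differentiableAt ((hB.inter isOpen_uhp).mem_nhds ⟨hs, h⟩)
  have heq : ∀ s ∈ B, 0 < s.im → e s = g s := fun s hs h =>
    extendFrom_eq (subset_closure h) ((hgd s hs h).continuousAt.mono_left nhdsWithin_le_nhds)
  have hex : ∀ (x : ℝ) (v : ℂ), (x : ℂ) ∈ B →
      Tendsto g (𝓝[upperHalfPlaneSet] (x : ℂ)) (𝓝 v) → e x = v := fun x v _ hv =>
    extendFrom_eq (by rw [closure_uhp]; simp) hv
  have hxr : ∀ s ∈ B, s.im = 0 → conj (e s) = e s := by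
    intro s hs h
    obtain ⟨x, rfl⟩ : ∃ x : ℝ, s = (x : ℂ) := ⟨s.re, Complex.ext (by simp) (by simp [h])⟩
    obtain ⟨v, hv⟩ := hr x hs
    rw [hex x v hs hv, Complex.conj_ofReal]
  have hcont : ContinuousOn e (B ∩ {s | 0 ≤ s.im}) := by
    refine continuousOn_extendFrom (by rw [closure_uhp]; exact inter_subset_right) ?_
    rintro s ⟨hs, hs'⟩
    rcases (show 0 ≤ s.im from hs').eq_or_lt with h | h
    · obtain ⟨x, rfl⟩ : ∃ x : ℝ, s = (x : ℂ) := ⟨s.re, Complex.ext (by simp) (by simp [← h])⟩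
      obtain ⟨v, hv⟩ := hr x hs
      exact ⟨v, hv⟩
    · exact ⟨_, (hgd s hs h).continuousAt.mono_left nhdsWithin_le_nhds⟩
  -- Taking the real part on the axis makes the symmetry hold at every s, even outside B; on B it
  -- changes nothing, as the values there are real.
  set G : ℂ → ℂ := fun s => if 0 < s.im then e s else
    if s.im < 0 then conj (e (conj s)) else ((e s).re : ℂ) with hG
  have hGpos : ∀ s, 0 < s.im → G s = e s := fun s h => by simp [hG, h]
  have hGneg : ∀ s, s.im < 0 → G s = conj (e (conj s)) := fun s h => by
    simp [hG, h, h.not_gt]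
  have hGzero : ∀ s ∈ B, s.im = 0 → G s = e s := fun s hs h => by
    have h1 : G s = ((e s).re : ℂ) := by simp [hG, h]
    rw [h1]
    exact Complex.conj_eq_iff_re.1 (hxr s hs h)
  have hGu : EqOn G e (B ∩ {s | 0 ≤ s.im}) := by
    rintro s ⟨hs, hs'⟩
    rcases (show 0 ≤ s.im from hs').eq_or_lt with h | h
    · exact hGzero s hs h.symm
    · exact hGpos s h
  have hGl : EqOn G (fun s => conj (e (conj s))) (B ∩ {s | s.im ≤ 0}) := by
    rintro s ⟨hs, hs'⟩
    rcases (show s.im ≤ 0 from hs').eq_or_lt with h | h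
    · change G s = conj (e (conj s))
      rw [Complex.conj_eq_iff_im.2 h, hxr s hs h, hGzero s hs h]
    · exact hGneg s h
  have hdpos : ∀ s ∈ B, 0 < s.im → DifferentiableAt ℂ G s := by
    intro s hs h
    refine (hgd s hs h).congr_of_eventuallyEq ?_
    filter_upwards [(hB.inter isOpen_uhp).mem_nhds ⟨hs, h⟩] with x hx
    rw [hGpos x hx.2, heq x hx.1 hx.2]
  have hsymm : ∀ s, G (conj s) = conj (G s) := by
    intro s
    rcases lt_trichotomy s.im 0 with h | h | h
    · rw [hGneg s h, hGpos _ (by simpa using h)]; simp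
    · rw [Complex.conj_eq_iff_im.2 h]
      simp [hG, h]
    · rw [hGpos s h, hGneg _ (by simpa using h)]; simp
  have hdneg : ∀ s ∈ B, s.im < 0 → DifferentiableAt ℂ G s := by
    intro s hs h
    have h1 := (hdpos (conj s) (hBc s hs) (by simpa using h)).conj_conj
    have h2 : conj ∘ G ∘ conj = G := by
      funext z; simp [hsymm]
    rwa [h2, Complex.conj_conj] at h1
  refine ⟨G, ?_, ?_, hsymm, ?_⟩
  · refine differentiableOn_of_continuousOn_of_im_ne_zero hB ?_ ?_
    · have h1 : ContinuousOn G (B ∩ {s | 0 ≤ s.im}) := hcont.congr hGu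
      have h2 : ContinuousOn G (B ∩ {s | s.im ≤ 0}) := by
        refine ContinuousOn.congr ?_ hGl
        refine Complex.continuous_conj.comp_continuousOn (hcont.comp
          Complex.continuous_conj.continuousOn ?_)
        rintro s ⟨hs, hs'⟩
        exact ⟨hBc s hs, by simpa using hs'⟩
      intro s hs
      have hBu : B = (B ∩ {s | 0 ≤ s.im}) ∪ (B ∩ {s | s.im ≤ 0}) := by
        ext z; constructor
        · intro hz
          rcases le_total 0 z.im with h | h
          · exact .inl ⟨hz, h⟩
          · exact .inr ⟨hz, h⟩
        · rintro (h | h) <;> exact h.1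
      rcases lt_trichotomy s.im 0 with h | h | h
      · exact (hdneg s hs h).continuousAt.continuousWithinAt
      · rw [hBu]
        exact (h1 s ⟨hs, h.ge⟩).union (h2 s ⟨hs, h.le⟩)
      · exact (hdpos s hs h).continuousAt.continuousWithinAt
    · intro s hs hne
      rcases hne.lt_or_gt with h | h
      · exact hdneg s hs h
      · exact hdpos s hs h
  · rintro s ⟨hs, h⟩
    rw [hGpos s h, heq s hs h]
  · intro x v hx hv
    rw [hGzero x hx (by simp), hex x v hx hv]


/-! ### Continuation of the lift -/

lemma exists_lt_norm_modE (x : ℝ) {ε : ℝ} (hε : 0 < ε) (K : ℝ) :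
    ∃ w ∈ Metric.ball (x : ℂ) ε ∩ upperHalfPlaneSet, K < ‖modE w‖ := by
  obtain ⟨r, hr, hr'⟩ := exists_rat_btwn (show x < x + ε by linarith)
  obtain ⟨w, h1, h2, h3⟩ := exists_tendsto_norm_modE r
  have hb : ∀ᶠ t in atTop, w t ∈ Metric.ball (x : ℂ) ε := by
    refine h2.eventually (Metric.isOpen_ball.mem_nhds ?_)
    rw [Metric.mem_ball, show (r : ℂ) = ((r : ℝ) : ℂ) by simp, Complex.dist_eq,
      ← Complex.ofReal_sub, Complex.norm_real, Real.norm_eq_abs, abs_of_pos (by linarith)]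
    linarith
  obtain ⟨t, ht1, ht2, ht3⟩ := (h1.and (hb.and (h3.eventually_gt_atTop K))).exists
  exact ⟨w t, ⟨ht2, ht1⟩, ht3⟩

lemma differentiableOn_modE : DifferentiableOn ℂ modE upperHalfPlaneSet :=
  isChazySolutionOn_modE.1

lemma analyticOnNhd_lift {W T : ℂ → ℂ} (hT : HasSchwarzian W T upperHalfPlaneSet) (b₁ b₂ : ℂ) :
    AnalyticOnNhd ℂ (fun s => modE (T s) * deriv T s + 3 * (nonlin T s + q b₁ b₂ s))
      (upperHalfPlaneSet ∩ T ⁻¹' upperHalfPlaneSet) := by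
  refine DifferentiableOn.analyticOnNhd (fun s hs => ?_)
    (hT.diff.continuousOn.isOpen_inter_preimage isOpen_uhp isOpen_uhp)
  have h1 := hT.hasDerivAt isOpen_uhp hs.1
  have h2 : HasDerivAt (fun s => modE (T s)) _ s :=
    (hasDerivAt_of_diff isOpen_uhp differentiableOn_modE hs.2).comp s h1
  exact ((h2.mul (hT.hasDerivAt_deriv isOpen_uhp hs.1)).add
    (((hT.eqn s hs.1).add (hasDerivAt_q b₁ b₂ (ne_zero_of_mem hs.1)
      (ne_one_of_mem hs.1))).const_mul 3)).differentiableAt.differentiableWithinAt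

/-- The lift equation propagates over the upper half-plane, because `modE` has the real axis as
natural boundary. -/
lemma HasSchwarzian.lift_continuation {W T : ℂ → ℂ} (hT : HasSchwarzian W T upperHalfPlaneSet)
    {b₁ b₂ : ℂ} {C : Set ℂ} (hCo : IsOpen C) (hCne : C.Nonempty) (hCH : C ⊆ upperHalfPlaneSet)
    (hmaps : MapsTo T C upperHalfPlaneSet) (hl : IsLiftOn b₁ b₂ T C) :
    MapsTo T upperHalfPlaneSet upperHalfPlaneSet ∧ IsLiftOn b₁ b₂ T upperHalfPlaneSet := by
  set R : ℂ → ℂ := fun s => modE (T s) * deriv T s + 3 * (nonlin T s + q b₁ b₂ s) with hR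
  -- An open-closed argument: S is open by definition, and it has to be shown closed in the upper
  -- half-plane.
  set S : Set ℂ := {s | ∀ᶠ x in 𝓝 s, T x ∈ upperHalfPlaneSet ∧ R x = 0} with hS
  have hSo : IsOpen S := isOpen_iff_mem_nhds.2 fun s hs => eventually_eventually_nhds.2 hs
  have hCS : C ⊆ S := fun s hs => by
    filter_upwards [hCo.mem_nhds hs] with x hx
    exact ⟨hmaps hx, by rw [hR]; linear_combination hl x hx⟩
  suffices upperHalfPlaneSet ⊆ S by
    have h := fun s hs => (this hs : ∀ᶠ x in 𝓝 s, _).self_of_nhds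
    exact ⟨fun s hs => (h s hs).1, fun s hs => by linear_combination (h s hs).2⟩
  obtain ⟨c, hc⟩ := hCne
  refine (convex_halfSpace_im_gt 0).isPreconnected.subset_of_closure_inter_subset hSo
    ⟨c, hCH hc, hCS hc⟩ ?_
  rintro s₁ ⟨hs₁, hsH⟩
  have hstrict : HasStrictDerivAt T (deriv T s₁) s₁ :=
    (hT.diff.analyticAt (isOpen_uhp.mem_nhds hsH)).hasStrictDerivAt
  set e := (hstrict.hasStrictFDerivAt_equiv (hT.deriv_ne s₁ hsH)).toOpenPartialHomeomorph T with he
  have heT : ∀ s, e s = T s := fun s => rfl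
  have hes : s₁ ∈ e.source := HasStrictFDerivAt.mem_toOpenPartialHomeomorph_source _
  have het : T s₁ ∈ e.target := e.map_source hes
  have hsymm : e.symm (T s₁) = s₁ := e.left_inv hes
  -- The local inverse of T carries the convex set ball ∩ upper half-plane to a connected set that
  -- meets S, so the identity theorem propagates R = 0 to all of it.
  have key : ∀ Q ∈ 𝓝 s₁, Q ⊆ upperHalfPlaneSet → ∃ ε > 0, ∀ ε' > 0, ε' ≤ ε →
      ((Metric.ball (T s₁) ε' ∩ upperHalfPlaneSet).Nonempty ∧
      (∀ᶠ s in 𝓝 s₁, T s ∈ Metric.ball (T s₁) ε' ∧ e.symm (T s) = s) ∧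
      ∀ w ∈ Metric.ball (T s₁) ε' ∩ upperHalfPlaneSet, e.symm w ∈ Q ∧ T (e.symm w) = w ∧
        R (e.symm w) = 0) := by
    intro Q hQ hQH
    have hc : ContinuousAt e.symm (T s₁) := e.continuousAt_symm het
    have hn : e.target ∩ e.symm ⁻¹' Q ∈ 𝓝 (T s₁) :=
      inter_mem (e.open_target.mem_nhds het) (hc (by rwa [hsymm]))
    obtain ⟨ε, hε, hsub⟩ := Metric.mem_nhds_iff.1 hn
    refine ⟨ε, hε, fun ε' hε' hle => ?_⟩
    have hsub' : Metric.ball (T s₁) ε' ⊆ _ := (Metric.ball_subset_ball hle).trans hsub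
    have hev : ∀ᶠ s in 𝓝 s₁, T s ∈ Metric.ball (T s₁) ε' ∧ e.symm (T s) = s := by
      filter_upwards [(hT.hasDerivAt isOpen_uhp hsH).continuousAt
        (Metric.ball_mem_nhds _ hε'), e.open_source.mem_nhds hes] with s h1 h2
      exact ⟨h1, e.left_inv h2⟩
    obtain ⟨s₂, ⟨hb, hl2⟩, hs₂⟩ := (mem_closure_iff_nhds.1 hs₁) _ hev
    have hs₂H : T s₂ ∈ upperHalfPlaneSet := (hs₂ : ∀ᶠ x in 𝓝 s₂, _).self_of_nhds.1
    refine ⟨⟨T s₂, hb, hs₂H⟩, hev, ?_⟩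
    set N := e.symm '' (Metric.ball (T s₁) ε' ∩ upperHalfPlaneSet) with hN
    have hTN : ∀ w ∈ Metric.ball (T s₁) ε', T (e.symm w) = w := fun w hw =>
      e.right_inv (hsub' hw).1
    have hNpc : IsPreconnected N := by
      refine (((convex_ball _ _).inter (convex_halfSpace_im_gt 0)).isPreconnected).image _ ?_
      exact e.continuousOn_symm.mono fun w hw => (hsub' hw.1).1
    have hNsub : N ⊆ upperHalfPlaneSet ∩ T ⁻¹' upperHalfPlaneSet := by
      rintro _ ⟨w, hw, rfl⟩
      exact ⟨hQH (hsub' hw.1).2, by rw [mem_preimage, hTN w hw.1]; exact hw.2⟩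
    have hz := ((analyticOnNhd_lift hT b₁ b₂).mono
      hNsub).eqOn_zero_of_preconnected_of_eventuallyEq_zero hNpc
      (z₀ := s₂) ⟨T s₂, ⟨hb, hs₂H⟩, hl2⟩ ((hs₂ : ∀ᶠ x in 𝓝 s₂, _).mono fun x hx => hx.2)
    intro w hw
    exact ⟨(hsub' hw.1).2, hTN w hw.1, hz ⟨w, hw, rfl⟩⟩
  rcases lt_trichotomy (T s₁).im 0 with h | h | h
  · obtain ⟨ε, hε, hk⟩ := key _ (isOpen_uhp.mem_nhds hsH) subset_rfl
    obtain ⟨ε₁, hε₁, hsub⟩ := Metric.mem_nhds_iff.1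
      ((isOpen_lt Complex.continuous_im continuous_const).mem_nhds h)
    obtain ⟨⟨w, hw, hw'⟩, -⟩ := hk (min ε ε₁) (lt_min hε hε₁) (min_le_left _ _)
    have h1 : w.im < 0 := hsub (Metric.ball_subset_ball (min_le_right _ _) hw)
    exact absurd h1 (not_lt.2 (le_of_lt hw'))
  · exfalso
    -- If T(s₁) were real, the lift equation would write `modE` near it as a bounded function F of
    -- the local inverse, against its unboundedness near every real point.
    set F : ℂ → ℂ := fun s => -3 * (nonlin T s + q b₁ b₂ s) / deriv T s with hF
    have hFc : ContinuousAt F s₁ :=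
      (continuousAt_const.mul ((hT.eqn s₁ hsH).continuousAt.add
        (hasDerivAt_q b₁ b₂ (ne_zero_of_mem hsH) (ne_one_of_mem hsH)).continuousAt)).div
        (hT.hasDerivAt_deriv isOpen_uhp hsH).continuousAt (hT.deriv_ne s₁ hsH)
    have hFb : {s | ‖F s‖ < ‖F s₁‖ + 1} ∈ 𝓝 s₁ :=
      hFc.norm (Iio_mem_nhds (by linarith))
    obtain ⟨ε, hε, hk⟩ := key _ (inter_mem hFb (isOpen_uhp.mem_nhds hsH)) inter_subset_right
    obtain ⟨-, -, hk⟩ := hk ε hε le_rfl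
    obtain ⟨x, hx⟩ : ∃ x : ℝ, T s₁ = (x : ℂ) := ⟨(T s₁).re, Complex.ext (by simp) (by simp [h])⟩
    rw [hx] at hk
    obtain ⟨w, hw, hlt⟩ := exists_lt_norm_modE x hε (‖F s₁‖ + 1)
    obtain ⟨⟨h1, h2⟩, h3, h4⟩ := hk w hw
    have hd := hT.deriv_ne _ h2
    have : modE w = F (e.symm w) := by
      have h5 : modE (T (e.symm w)) * deriv T (e.symm w) +
        3 * (nonlin T (e.symm w) + q b₁ b₂ (e.symm w)) = 0 := h4
      rw [h3] at h5
      rw [hF, eq_div_iff hd]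
      linear_combination h5
    rw [this] at hlt
    exact absurd hlt (not_lt.2 (le_of_lt h1))
  · obtain ⟨ε, hε, hk⟩ := key _ (isOpen_uhp.mem_nhds hsH) subset_rfl
    obtain ⟨-, hev, hk⟩ := hk ε hε le_rfl
    filter_upwards [hev, (hT.hasDerivAt isOpen_uhp hsH).continuousAt
      (isOpen_uhp.mem_nhds h)] with s hs1 hs2
    refine ⟨hs2, ?_⟩
    have := (hk (T s) ⟨hs1.1, hs2⟩).2.2
    rwa [hs1.2] at this


/-! ### Excluding a vertical third side -/

/-- Liouville's argument: Cauchy's estimate on a circle of radius R bounds the derivative by a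
multiple of R^(-1/2). -/
lemma eq_of_norm_le_sqrt {F : ℂ → ℂ} (hF : Differentiable ℂ F) {K : ℝ}
    (hK : ∀ s, 2 ≤ ‖s‖ → ‖F s‖ ≤ K * √‖s‖) (x y : ℂ) : F x = F y := by
  refine is_const_of_deriv_eq_zero hF (fun c => ?_) x y
  have hK0 : 0 ≤ K := by
    have := (norm_nonneg _).trans (hK 4 (by norm_num))
    have h4 : (0 : ℝ) < √‖(4 : ℂ)‖ := Real.sqrt_pos.2 (by norm_num)
    nlinarith
  have hb : ∀ᶠ R : ℝ in atTop, ‖deriv F c‖ ≤ K * √2 * (1 / √R) := by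
    filter_upwards [eventually_ge_atTop (‖c‖ + 2)] with R hR
    have hR0 : 0 < R := by linarith [norm_nonneg c]
    refine (Complex.norm_deriv_le_of_forall_mem_sphere_norm_le hR0 hF.diffContOnCl
      (C := K * √(2 * R)) fun z hz => ?_).trans_eq ?_
    · have h1 : ‖z - c‖ = R := by simpa [dist_eq_norm] using hz
      have h2 : 2 ≤ ‖z‖ := by linarith [norm_sub_le z c]
      have h3 : ‖z‖ ≤ 2 * R := by
        have := norm_add_le (z - c) c
        rw [sub_add_cancel] at this
        linarith
      exact (hK z h2).trans (mul_le_mul_of_nonneg_left (Real.sqrt_le_sqrt h3) hK0)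
    · rw [Real.sqrt_mul (by norm_num)]
      have := Real.sqrt_pos.2 hR0
      field_simp
      rw [Real.sq_sqrt hR0.le]
  have ht : Tendsto (fun R : ℝ => K * √2 * (1 / √R)) atTop (𝓝 (K * √2 * 0)) :=
    (tendsto_const_nhds.div_atTop Real.tendsto_sqrt_atTop).const_mul _
  rw [mul_zero] at ht
  exact norm_le_zero_iff.1 (ge_of_tendsto ht hb)

-- Multiplying by s (s - 1) removes the singularities at 0 and 1, so the product reflects to an
-- entire function vanishing there. Dividing back leaves an entire function of growth at most
-- |s|^(1/2).
open ComplexConjugate in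
lemma exists_eq_const_of_real_boundary {f : ℂ → ℂ} {a b K : ℝ} (ha : |a| ≤ 1 / 4)
    (hb : |b| ≤ 1 / 4) (hf : DifferentiableOn ℂ f upperHalfPlaneSet)
    (hK : ∀ s ∈ upperHalfPlaneSet, ‖f s‖ ≤ K * (‖s - 1‖ ^ (-a) * ‖s‖ ^ (-b)))
    (hr : ∀ x : ℝ, x ≠ 0 → x ≠ 1 →
      ∃ v : ℝ, Tendsto f (𝓝[upperHalfPlaneSet] (x : ℂ)) (𝓝 (v : ℂ))) :
    ∃ c, ∀ s ∈ upperHalfPlaneSet, f s = c := by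
  rw [abs_le] at ha hb
  set M : ℂ → ℝ := fun s => K * (‖s - 1‖ ^ (1 - a) * ‖s‖ ^ (1 - b)) with hM
  have hMc : Continuous M := by
    refine continuous_const.mul (Continuous.mul ?_ ?_)
    · exact (by fun_prop : Continuous fun s : ℂ => ‖s - 1‖).rpow_const
        fun _ => .inr (by linarith)
    · exact continuous_norm.rpow_const fun _ => .inr (by linarith)
  have hgM : ∀ s ∈ upperHalfPlaneSet, ‖f s * (s * (s - 1))‖ ≤ M s := by
    intro s hs
    have h0 : 0 < ‖s‖ := norm_pos_iff.2 (ne_zero_of_mem hs)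
    have h1 : 0 < ‖s - 1‖ := norm_pos_iff.2 (sub_ne_zero.2 (ne_one_of_mem hs))
    rw [hM, norm_mul, norm_mul]
    simp only
    rw [sub_eq_neg_add 1 a, sub_eq_neg_add 1 b, Real.rpow_add h0, Real.rpow_add h1, Real.rpow_one,
      Real.rpow_one]
    calc ‖f s‖ * (‖s‖ * ‖s - 1‖) ≤ K * (‖s - 1‖ ^ (-a) * ‖s‖ ^ (-b)) * (‖s‖ * ‖s - 1‖) :=
          mul_le_mul_of_nonneg_right (hK s hs) (by positivity)
      _ = _ := by ring
  have hzero : ∀ x : ℝ, M x = 0 → Tendsto (fun s => f s * (s * (s - 1)))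
      (𝓝[upperHalfPlaneSet] (x : ℂ)) (𝓝 0) := by
    intro x hx
    refine squeeze_zero_norm' (eventually_mem_nhdsWithin.mono hgM) ?_
    rw [← hx]
    exact hMc.continuousAt.mono_left nhdsWithin_le_nhds
  have hM0 : M ((0 : ℝ) : ℂ) = 0 := by
    simp [hM, Real.zero_rpow (show 1 - b ≠ 0 by linarith)]
  have hM1 : M ((1 : ℝ) : ℂ) = 0 := by
    simp [hM, Real.zero_rpow (show 1 - a ≠ 0 by linarith)]
  obtain ⟨G, hGd, hGf, hGc, hGb⟩ := exists_reflection (g := fun s => f s * (s * (s - 1)))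
    isOpen_univ (fun _ _ => mem_univ _)
    (by
      rw [univ_inter]
      exact hf.mul (by fun_prop))
    (fun x _ => by
      by_cases h0 : x = 0
      · exact ⟨0, by simpa using hzero x (h0 ▸ hM0)⟩
      by_cases h1 : x = 1
      · exact ⟨0, by simpa using hzero x (h1 ▸ hM1)⟩
      obtain ⟨v, hv⟩ := hr x h0 h1
      refine ⟨v * (x * (x - 1)), ?_⟩
      push_cast
      refine hv.mul (Tendsto.mono_left ?_ nhdsWithin_le_nhds)
      exact (by fun_prop : Continuous fun s : ℂ => s * (s - 1)).tendsto _)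
  have hGd : Differentiable ℂ G := differentiableOn_univ.1 hGd
  have hG0 : G 0 = 0 := by simpa using hGb 0 0 (mem_univ _) (hzero 0 hM0)
  have hG1 : G 1 = 0 := by simpa using hGb 1 0 (mem_univ _) (hzero 1 hM1)
  have hGM : ∀ s, ‖G s‖ ≤ M s := by
    have hcl : ∀ s : ℂ, 0 ≤ s.im → ‖G s‖ ≤ M s := by
      have hc : IsClosed {s | ‖G s‖ ≤ M s} := isClosed_le hGd.continuous.norm hMc
      intro s hs
      refine closure_minimal (fun z hz => ?_) hc (show s ∈ closure upperHalfPlaneSet by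
        rw [closure_uhp]; exact hs)
      change ‖G z‖ ≤ M z
      rw [hGf ⟨mem_univ _, hz⟩]
      exact hgM z hz
    intro s
    rcases le_total 0 s.im with h | h
    · exact hcl s h
    · have h1 := hcl (conj s) (by simpa using h)
      rw [hGc, RCLike.norm_conj] at h1
      have h2 : M (conj s) = M s := by
        simp only [hM, RCLike.norm_conj]
        rw [← RCLike.norm_conj (s - 1)]
        simp
      rwa [h2] at h1
  set F := dslope (dslope G 0) 1 with hF
  have hFd : Differentiable ℂ F := by
    rw [← differentiableOn_univ, hF, Complex.differentiableOn_dslope univ_mem,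
      Complex.differentiableOn_dslope univ_mem, differentiableOn_univ]
    exact hGd
  have hFG : ∀ s : ℂ, s ≠ 0 → s ≠ 1 → F s = G s / (s * (s - 1)) := by
    intro s h0 h1
    have h1' := sub_ne_zero.2 h1
    rw [hF, dslope_of_ne _ h1, slope_def_field, dslope_of_ne _ h0, slope_def_field,
      dslope_of_ne _ one_ne_zero, slope_def_field, hG0, hG1]
    field_simp
    ring
  have hK0 : 0 ≤ K := by
    have h := (norm_nonneg _).trans (hgM Complex.I (by simp))
    have h1 : (0 : ℝ) < ‖Complex.I - 1‖ := norm_pos_iff.2 fun h => by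
      have := congrArg Complex.im h; simp at this
    simp only [hM] at h
    have h2 := Real.rpow_pos_of_pos h1 (1 - a)
    simp only [Complex.norm_I, Real.one_rpow, mul_one] at h
    exact nonneg_of_mul_nonneg_left h h2
  refine ⟨F 0, fun s hs => ?_⟩
  have hs' : f s = F s := by
    have h0 := ne_zero_of_mem hs
    have h1 := sub_ne_zero.2 (ne_one_of_mem hs)
    rw [hFG s h0 (ne_one_of_mem hs), hGf ⟨mem_univ _, hs⟩]
    field_simp
  rw [hs']
  refine eq_of_norm_le_sqrt hFd (K := K * √2) (fun z hz => ?_) s 0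
  have hz0 : z ≠ 0 := norm_pos_iff.1 (by linarith)
  have hz1 : 1 ≤ ‖z - 1‖ := by
    have := norm_sub_norm_le z 1
    rw [norm_one] at this
    linarith
  have hz1' : ‖z - 1‖ ≤ 2 * ‖z‖ := by
    have := norm_sub_le z 1
    rw [norm_one] at this
    linarith
  rw [hFG z hz0 fun h => by rw [h] at hz1; norm_num at hz1, norm_div, norm_mul]
  have hzp : 0 < ‖z‖ := by linarith
  have hz1p : 0 < ‖z - 1‖ := by linarith
  have aux : ∀ {x e : ℝ}, 1 ≤ x → x ≤ 2 * ‖z‖ → -(1 / 4) ≤ e →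
      x ^ (-e) ≤ (2 * ‖z‖) ^ (1 / 4 : ℝ) := fun h h' he =>
    (Real.rpow_le_rpow_of_exponent_le h (by linarith)).trans
      (Real.rpow_le_rpow (by linarith) h' (by norm_num))
  calc ‖G z‖ / (‖z‖ * ‖z - 1‖) ≤ M z / (‖z‖ * ‖z - 1‖) :=
        div_le_div_of_nonneg_right (hGM z) (by positivity)
    _ = K * (‖z - 1‖ ^ (-a) * ‖z‖ ^ (-b)) := by
        simp only [hM]
        rw [sub_eq_neg_add 1 a, sub_eq_neg_add 1 b, Real.rpow_add hzp,
          Real.rpow_add hz1p, Real.rpow_one, Real.rpow_one]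
        field_simp
    _ ≤ K * ((2 * ‖z‖) ^ (1 / 4 : ℝ) * (2 * ‖z‖) ^ (1 / 4 : ℝ)) := by
        refine mul_le_mul_of_nonneg_left (mul_le_mul (aux hz1 hz1' (by linarith))
          (aux (by linarith) (by linarith) (by linarith)) (by positivity) (by positivity)) hK0
    _ = K * √2 * √‖z‖ := by
        rw [← Real.rpow_add (by positivity), show (1 / 4 + 1 / 4 : ℝ) = 1 / 2 by norm_num,
          ← Real.sqrt_eq_rpow, Real.sqrt_mul (by norm_num)]
        ring

lemma tendsto_log_uhp {x : ℝ} (hx : x ≠ 0) :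
    Tendsto Complex.log (𝓝[upperHalfPlaneSet] (x : ℂ)) (𝓝 (Complex.log x)) := by
  rcases hx.lt_or_gt with h | h
  · exact (Complex.continuousWithinAt_log_of_re_neg_of_im_zero (by simpa using h)
      (by simp)).mono_left (nhdsWithin_mono _ fun z hz => (le_of_lt hz : 0 ≤ z.im))
  · exact (continuousAt_clog (.inl (by simpa using h))).mono_left nhdsWithin_le_nhds

lemma tendsto_log_sub_one_uhp {x : ℝ} (hx : x ≠ 1) :
    Tendsto (fun s => Complex.log (s - 1)) (𝓝[upperHalfPlaneSet] (x : ℂ))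
      (𝓝 (Complex.log (x - 1))) := by
  have h := tendsto_log_uhp (sub_ne_zero.2 hx)
  push_cast at h
  refine h.comp (tendsto_nhdsWithin_iff.2 ⟨?_, ?_⟩)
  · exact ((continuous_id.sub continuous_const).tendsto (x : ℂ)).mono_left nhdsWithin_le_nhds
  · filter_upwards [self_mem_nhdsWithin] with s hs
    simpa using hs

/-- A map with three vertical sides does not take values in a half-plane. -/
lemma not_three_vertical_sides {T : ℂ → ℂ} {t c₁ c₂ c₃ : ℝ}
    (hT : DifferentiableOn ℂ T upperHalfPlaneSet) (hm : ∀ s ∈ upperHalfPlaneSet, t < (T s).im)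
    (h1 : HasBoundary T (Ioo 0 1) fun p => t < p.im ∧ p.re = c₁)
    (h2 : HasBoundary T (Iio 0) fun p => t < p.im ∧ p.re = c₂)
    (h3 : HasBoundary T (Ioi 1) fun p => t < p.im ∧ p.re = c₃) (hc : c₁ < c₂) : False := by
  -- A and B are chosen so that i (T - c₃) - A log (s - 1) - B log s has real boundary values on all
  -- three intervals: the arguments jump by π at 1 and at 0.
  set A := (c₁ - c₃) / Real.pi with hA
  set B := (c₂ - c₁) / Real.pi with hB
  have hπ := Real.pi_pos
  have hAπ : A * Real.pi = c₁ - c₃ := by rw [hA]; field_simp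
  have hBπ : B * Real.pi = c₂ - c₁ := by rw [hB]; field_simp
  have hB0 : 0 < B := div_pos (by linarith) hπ
  -- Scaling brings the exponents l A, l B into [-1/4, 1/4], the range of
  -- `exists_eq_const_of_real_boundary`. The exponential makes the lower bound on Im T an upper
  -- bound on the modulus.
  set l := 1 / (4 * (|A| + |B|)) with hl
  have hAB : 0 < |A| + |B| := by positivity
  have hl0 : 0 < l := by positivity
  have hlA : |l * A| ≤ 1 / 4 := by
    rw [abs_mul, abs_of_pos hl0, hl]
    rw [div_mul_eq_mul_div, div_le_div_iff₀ (by positivity) (by norm_num)]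
    nlinarith [abs_nonneg B]
  have hlB : |l * B| ≤ 1 / 4 := by
    rw [abs_mul, abs_of_pos hl0, hl]
    rw [div_mul_eq_mul_div, div_le_div_iff₀ (by positivity) (by norm_num)]
    nlinarith [abs_nonneg A]
  set E : ℂ → ℂ → ℂ := fun p s => l * (Complex.I * (p - c₃) - A * Complex.log (s - 1) -
    B * Complex.log s) with hE
  have hEre : ∀ p s, (E p s).re = l * (-p.im - A * Real.log ‖s - 1‖ - B * Real.log ‖s‖) := by
    intro p s
    simp [hE, Complex.mul_re, Complex.log_re]
  have hEim : ∀ p s, (E p s).im = l * (p.re - c₃ - A * Complex.arg (s - 1) -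
      B * Complex.arg s) := by
    intro p s
    simp [hE, Complex.mul_im, Complex.log_im]
  have hnorm : ∀ s ∈ upperHalfPlaneSet, ‖Complex.exp (E (T s) s)‖ =
      Real.exp (-(l * (T s).im)) * (‖s - 1‖ ^ (-(l * A)) * ‖s‖ ^ (-(l * B))) := by
    intro s hs
    rw [Complex.norm_exp, hEre, Real.rpow_def_of_pos (norm_pos_iff.2 (ne_zero_of_mem hs)),
      Real.rpow_def_of_pos (norm_pos_iff.2 (sub_ne_zero.2 (ne_one_of_mem hs))), ← Real.exp_add,
      ← Real.exp_add]
    congr 1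
    ring
  obtain ⟨c, hcst⟩ := exists_eq_const_of_real_boundary (f := fun s => Complex.exp (E (T s) s))
    (K := Real.exp (-(l * t))) hlA hlB (by
      refine DifferentiableOn.cexp ((differentiableOn_const _).mul
        ((((hT.sub_const _).const_mul _).sub (DifferentiableOn.const_mul ?_ _)).sub
          (DifferentiableOn.const_mul ?_ _)))
      · exact (differentiableOn_id.sub_const _).clog fun s hs => .inr (by
          have : 0 < s.im := hs
          simpa using this.ne')
      · exact differentiableOn_id.clog fun s hs => .inr (by
          have : 0 < s.im := hs
          simpa using this.ne'))
    (fun s hs => by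
      rw [hnorm s hs]
      refine mul_le_mul_of_nonneg_right (Real.exp_le_exp.2 ?_) (by positivity)
      nlinarith [hm s hs])
    (fun x h0 hx1 => by
      have main : ∀ p : ℂ, Tendsto T (𝓝[upperHalfPlaneSet] (x : ℂ)) (𝓝 p) →
          (E p x).im = 0 →
          ∃ v : ℝ, Tendsto (fun s => Complex.exp (E (T s) s)) (𝓝[upperHalfPlaneSet] (x : ℂ))
            (𝓝 (v : ℂ)) := by
        intro p hp him
        refine ⟨Real.exp (E p x).re, ?_⟩
        have : ((Real.exp (E p x).re : ℝ) : ℂ) = Complex.exp (E p x) := by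
          rw [Complex.ofReal_exp]
          congr 1
          exact Complex.ext (by simp) (by simp [him])
        rw [this]
        refine (Complex.continuous_exp.tendsto _).comp ?_
        exact tendsto_const_nhds.mul (((tendsto_const_nhds.mul (hp.sub_const _)).sub
          (tendsto_const_nhds.mul (tendsto_log_sub_one_uhp hx1))).sub
          (tendsto_const_nhds.mul (tendsto_log_uhp h0)))
      have hx' : (x : ℂ) - 1 = ((x - 1 : ℝ) : ℂ) := by push_cast; rfl
      rcases lt_trichotomy x 0 with h | h | h
      · obtain ⟨p, ⟨-, hp⟩, ht⟩ := h2 x h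
        refine main p ht ?_
        rw [hEim, hx', Complex.arg_ofReal_of_neg h, Complex.arg_ofReal_of_neg (by linarith), hp]
        rw [hAπ, hBπ]; ring
      · exact absurd h h0
      rcases lt_trichotomy x 1 with h' | h' | h'
      · obtain ⟨p, ⟨-, hp⟩, ht⟩ := h1 x ⟨h, h'⟩
        refine main p ht ?_
        rw [hEim, hx', Complex.arg_ofReal_of_nonneg h.le, Complex.arg_ofReal_of_neg (by linarith),
          hp, hAπ]
        ring
      · exact absurd h' hx1
      · obtain ⟨p, ⟨-, hp⟩, ht⟩ := h3 x h'
        refine main p ht ?_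
        rw [hEim, hx', Complex.arg_ofReal_of_nonneg h.le,
          Complex.arg_ofReal_of_nonneg (by linarith), hp]
        ring)
  -- As the exponential is constant, Im T + A log |s - 1| + B log |s| is constant, and Im T > t.
  -- Near s = 1 this forces A ≥ 0, and then B > 0 contradicts it at ∞.
  have hbound : ∃ m : ℝ, ∀ s ∈ upperHalfPlaneSet,
      A * Real.log ‖s - 1‖ + B * Real.log ‖s‖ ≤ m := by
    refine ⟨-(Real.log ‖c‖) / l - t, fun s hs => ?_⟩
    have h : Real.log ‖Complex.exp (E (T s) s)‖ = Real.log ‖c‖ := by rw [hcst s hs]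
    rw [Complex.norm_exp, Real.log_exp, hEre] at h
    have h' := hm s hs
    rw [← h]
    field_simp
    linarith
  obtain ⟨m, hm'⟩ := hbound
  have hA0 : 0 ≤ A := by
    by_contra! hneg
    have ht : Tendsto (fun ε : ℝ => A * Real.log ε) (𝓝[>] 0) atTop :=
      Real.tendsto_log_nhdsGT_zero.const_mul_atBot_of_neg hneg
    obtain ⟨ε, h1, h2⟩ := ((ht.eventually_gt_atTop m).and self_mem_nhdsWithin).exists
    have hε : 0 < ε := h2
    have h3 := hm' (1 + ε * Complex.I) (by change 0 < Complex.im _; simpa using hε)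
    have h4 : (1 : ℝ) ≤ ‖1 + ε * Complex.I‖ := by
      have := Complex.abs_re_le_norm (1 + ε * Complex.I)
      simpa using this
    have h5 : 0 ≤ B * Real.log ‖1 + ε * Complex.I‖ := mul_nonneg hB0.le (Real.log_nonneg h4)
    rw [add_sub_cancel_left, norm_mul, Complex.norm_I, mul_one, Complex.norm_real,
      Real.norm_of_nonneg hε.le] at h3
    linarith
  have ht : Tendsto (fun y : ℝ => B * Real.log y) atTop atTop :=
    Real.tendsto_log_atTop.const_mul_atTop hB0
  obtain ⟨y, hy1, hy2⟩ := ((ht.eventually_gt_atTop m).and (eventually_ge_atTop 1)).exists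
  have hy0 : 0 < y := by linarith
  have h3 := hm' (y * Complex.I) (by change 0 < Complex.im _; simpa using hy0)
  have h4 : (1 : ℝ) ≤ ‖y * Complex.I - 1‖ := by
    have := Complex.abs_im_le_norm (y * Complex.I - 1)
    simp only [Complex.sub_im, Complex.mul_im, Complex.ofReal_re, Complex.I_im, mul_one,
      Complex.ofReal_im, Complex.I_re, mul_zero, add_zero, Complex.one_im, sub_zero,
      abs_of_pos hy0] at this
    linarith
  have h5 : 0 ≤ A * Real.log ‖y * Complex.I - 1‖ := mul_nonneg hA0 (Real.log_nonneg h4)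
  rw [norm_mul, Complex.norm_I, mul_one, Complex.norm_real, Real.norm_of_nonneg hy0.le] at h3
  linarith


/-! ### Excluding a circular third side centred below the real axis -/

open ComplexConjugate in
/-- The symmetry of `modE` with respect to a circle whose centre is in the lower half-plane
contradicts its natural boundary. -/
lemma not_frequently_circle_relation {m w₀ : ℂ} {r : ℝ} (hm : m.im < 0) (hw₀ : 0 < w₀.im)
    (hr₀ : ‖w₀ - m‖ = r)
    (hfr : ∃ᶠ w in 𝓝[≠] w₀, 0 < w.im ∧ ‖w - m‖ = r ∧ ((w - m) * modE w).re = -3) : False := by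
  have hmr : -m.im < r := by
    rw [← hr₀]
    have h1 := (le_abs_self _).trans (Complex.abs_im_le_norm (w₀ - m))
    rw [Complex.sub_im] at h1
    linarith
  have hr : 0 < r := by linarith
  -- The reflection of w in the circle is k (conj w). On K, a convex set, both w and its reflection
  -- lie in the upper half-plane, so the symmetrized relation h = 0 spreads from the arc to all of
  -- K.
  set k : ℂ → ℂ := fun v => m + r ^ 2 / (v - conj m) with hk
  set K : Set ℂ := upperHalfPlaneSet ∩ {w | -m.im * ‖w - m‖ ^ 2 < r ^ 2 * (w.im - m.im)} with hK
  have hne : ∀ w : ℂ, 0 ≤ w.im → w - m ≠ 0 := fun w hw h => by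
    rw [sub_eq_zero.1 h] at hw; linarith
  have hcne : ∀ w : ℂ, 0 ≤ w.im → conj w - conj m ≠ 0 := fun w hw h => by
    rw [← map_sub, map_eq_zero] at h
    exact hne w hw h
  have hkim : ∀ w : ℂ, 0 ≤ w.im →
      (k (conj w)).im = m.im + r ^ 2 * (w.im - m.im) / ‖w - m‖ ^ 2 := by
    intro w hw
    have h1 : (r : ℂ) ^ 2 / (conj w - conj m) = ((r ^ 2 / ‖w - m‖ ^ 2 : ℝ) : ℂ) * (w - m) := by
      have h2 : (w - m) * (conj w - conj m) = ((‖w - m‖ ^ 2 : ℝ) : ℂ) := by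
        rw [← map_sub, Complex.mul_conj, Complex.normSq_eq_norm_sq]
      have h3 := hcne w hw
      have h4 := hne w hw
      push_cast at h2 ⊢
      rw [← h2]
      field_simp
    rw [hk]
    simp only [h1, Complex.add_im, Complex.im_ofReal_mul, Complex.sub_im]
    ring
  have hkpos : ∀ w : ℂ, 0 ≤ w.im → -m.im * ‖w - m‖ ^ 2 < r ^ 2 * (w.im - m.im) →
      0 < (k (conj w)).im := by
    intro w hw h
    have h1 : 0 < ‖w - m‖ := norm_pos_iff.2 (hne w hw)
    rw [hkim w hw, ← neg_lt_iff_pos_add', lt_div_iff₀ (by positivity)]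
    exact h
  set Q : ℂ → ℂ := fun v => (k v - m) * modE (k v) with hQ
  set h : ℂ → ℂ := fun w => (w - m) * modE w + 6 + conj (Q (conj w)) with hh
  have hQd : ∀ w : ℂ, 0 ≤ w.im → -m.im * ‖w - m‖ ^ 2 < r ^ 2 * (w.im - m.im) →
      DifferentiableAt ℂ Q (conj w) := by
    intro w hw hlt
    have hkd : DifferentiableAt ℂ k (conj w) :=
      (differentiableAt_const _).add ((differentiableAt_const _).div
        (differentiableAt_id.sub_const _) (hcne w hw))
    exact (hkd.sub_const m).mul ((differentiableOn_modE.differentiableAt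
      (isOpen_uhp.mem_nhds (hkpos w hw hlt))).comp _ hkd)
  have hopen : IsOpen {w : ℂ | -m.im * ‖w - m‖ ^ 2 < r ^ 2 * (w.im - m.im)} :=
    isOpen_lt (by fun_prop) (by fun_prop)
  have hKo : IsOpen K := isOpen_uhp.inter hopen
  have hKc : Convex ℝ K := by
    refine (convex_halfSpace_im_gt 0).inter ?_
    have hconv : ConvexOn ℝ univ fun w : ℂ => -m.im * ‖w - m‖ ^ 2 - r ^ 2 * (w.im - m.im) := by
      have h1 : ConvexOn ℝ univ fun w : ℂ => ‖w - m‖ ^ 2 := by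
        refine ConvexOn.pow ?_ (fun _ _ => norm_nonneg _) 2
        simpa only [dist_eq_norm] using convexOn_univ_dist (E := ℂ) m
      have h2 : ConcaveOn ℝ univ fun w : ℂ => r ^ 2 * (w.im - m.im) := by
        refine ⟨convex_univ, fun x _ y _ a b ha hb hab => le_of_eq ?_⟩
        simp only [smul_eq_mul, Complex.add_im, Complex.real_smul, Complex.im_ofReal_mul]
        linear_combination -r ^ 2 * m.im * hab
      exact (h1.smul (by linarith : 0 ≤ -m.im)).sub h2
    simpa only [mem_univ, true_and, sub_neg] using hconv.convex_lt 0
  have hha : AnalyticOnNhd ℂ h K := by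
    refine DifferentiableOn.analyticOnNhd (fun w hw => ?_) hKo
    have hw0 : 0 ≤ w.im := le_of_lt hw.1
    have h1 := (hQd w hw0 hw.2).conj_conj
    rw [Complex.conj_conj] at h1
    exact ((((differentiableAt_id.sub_const m).mul (differentiableOn_modE.differentiableAt
      (isOpen_uhp.mem_nhds hw.1))).add_const 6).add h1).differentiableWithinAt
  have hzero : EqOn h 0 K := by
    refine hha.eqOn_zero_of_preconnected_of_frequently_eq_zero hKc.isPreconnected
      (z₀ := w₀) ⟨hw₀, ?_⟩ (hfr.mono ?_)
    · rw [mem_ofPred_eq, hr₀]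
      nlinarith [mul_pos (pow_pos hr 2) hw₀]
    · rintro w ⟨hw, hwr, hre⟩
      have h1 : k (conj w) = w := by
        have h2 : (w - m) * (conj w - conj m) = (r : ℂ) ^ 2 := by
          rw [← map_sub, Complex.mul_conj, Complex.normSq_eq_norm_sq, hwr]; push_cast; rfl
        rw [hk]
        simp only
        rw [← h2, mul_div_cancel_right₀ _ (hcne w hw.le)]
        ring
      change (w - m) * modE w + 6 + conj ((k (conj w) - m) * modE (k (conj w))) = 0
      rw [h1, add_right_comm, Complex.add_conj, hre]
      push_cast
      ring
  -- The real point above the centre lies inside the circle because -Im m < r, so its reflection is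
  -- in the upper half-plane. There h = 0 expresses `modE` by the continuous function P.
  set x := m.re with hx
  have hxm : -m.im * ‖(x : ℂ) - m‖ ^ 2 < r ^ 2 * ((x : ℂ).im - m.im) := by
    have h1 : (x : ℂ) - m = ((-m.im : ℝ) : ℂ) * Complex.I :=
      Complex.ext (by simp [hx]) (by simp)
    rw [h1, norm_mul, Complex.norm_I, Complex.norm_real, mul_one, Real.norm_eq_abs, sq_abs,
      Complex.ofReal_im, zero_sub, mul_comm]
    have : 0 < -m.im := by linarith
    exact mul_lt_mul_of_pos_right (by nlinarith) this
  set P : ℂ → ℂ := fun w => -(6 + conj (Q (conj w))) / (w - m) with hP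
  have hPc : ContinuousAt P x := by
    have hx0 : 0 ≤ (x : ℂ).im := by simp
    have hQc : ContinuousAt (fun w => Q (conj w)) (x : ℂ) :=
      ContinuousAt.comp' (hQd x hx0 hxm).continuousAt Complex.continuous_conj.continuousAt
    exact (continuousAt_const.add (Complex.continuous_conj.continuousAt.comp' hQc)).neg.div
      (by fun_prop) (hne x hx0)
  have hn : {w | ‖P w‖ < ‖P x‖ + 1} ∩ {w | -m.im * ‖w - m‖ ^ 2 < r ^ 2 * (w.im - m.im)} ∈
      𝓝 (x : ℂ) :=
    inter_mem (hPc.norm (Iio_mem_nhds (by linarith))) (hopen.mem_nhds hxm)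
  obtain ⟨ε, hε, hsub⟩ := Metric.mem_nhds_iff.1 hn
  obtain ⟨w, hw, hlt⟩ := exists_lt_norm_modE x hε (‖P x‖ + 1)
  have h1 : h w = 0 := hzero ⟨hw.2, (hsub hw.1).2⟩
  have h2 : modE w = P w := by
    rw [hP]
    simp only
    rw [eq_div_iff (hne w (le_of_lt hw.2))]
    simp only [hh] at h1
    linear_combination h1
  rw [h2] at hlt
  exact absurd hlt (not_lt.2 (le_of_lt (hsub hw.1).1))

open ComplexConjugate in
lemma deriv_conj_of_symm {f : ℂ → ℂ} (h : ∀ s, f (conj s) = conj (f s)) (s : ℂ) :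
    deriv f (conj s) = conj (deriv f s) := by
  have h1 : conj ∘ f ∘ conj = f := by funext z; simp [h]
  have h2 := congrFun (deriv_conj_conj (f := f)) s
  rw [h1] at h2
  simp only [Function.comp_apply] at h2
  rw [h2, Complex.conj_conj]

lemma tendsto_ofReal_nhdsNE (x : ℝ) :
    Tendsto (fun y : ℝ => (y : ℂ)) (𝓝[≠] x) (𝓝[≠] (x : ℂ)) :=
  tendsto_nhdsWithin_iff.2 ⟨Complex.continuous_ofReal.continuousAt.mono_left nhdsWithin_le_nhds,
    eventually_mem_nhdsWithin.mono fun y hy => by simpa using hy⟩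

/-- If sin G were constant, then cos G and hence also sin G would vanish, since G' ≠ 0. -/
lemma not_sin_const {G : ℂ → ℂ} {U : Set ℂ} (hU : IsOpen U) (hne : U.Nonempty)
    (hG : DifferentiableOn ℂ G U) (hG' : ∀ s ∈ U, deriv G s ≠ 0) {c : ℂ}
    (h : ∀ s ∈ U, Complex.sin (G s) = c) : False := by
  have h1 : ∀ s ∈ U, Complex.cos (G s) = 0 := fun s hs => by
    have hd := (hasDerivAt_of_diff hU hG hs).csin
    have hc : (fun s => Complex.sin (G s)) =ᶠ[𝓝 s] fun _ => c := by
      filter_upwards [hU.mem_nhds hs] with x hx using h x hx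
    exact (mul_eq_zero.1 (hd.unique ((hasDerivAt_const s c).congr_of_eventuallyEq
      hc))).resolve_right (hG' s hs)
  have h2 : ∀ s ∈ U, Complex.sin (G s) = 0 := fun s hs => by
    have hd := (hasDerivAt_of_diff hU hG hs).ccos
    have hc : (fun s => Complex.cos (G s)) =ᶠ[𝓝 s] fun _ => 0 := by
      filter_upwards [hU.mem_nhds hs] with x hx using h1 x hx
    exact neg_eq_zero.1 ((mul_eq_zero.1 (hd.unique ((hasDerivAt_const s 0).congr_of_eventuallyEq
      hc))).resolve_right (hG' s hs))
  obtain ⟨s, hs⟩ := hne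
  have := Complex.sin_sq_add_cos_sq (G s)
  rw [h1 s hs, h2 s hs] at this
  norm_num at this

open ComplexConjugate in
/-- Reflection of the lift equation across a circular side. -/
lemma exists_circle_relation {W T : ℂ → ℂ} (hT : HasSchwarzian W T upperHalfPlaneSet)
    (hmaps : MapsTo T upperHalfPlaneSet upperHalfPlaneSet) {b₁ b₂ : ℝ}
    (hl : IsLiftOn b₁ b₂ T upperHalfPlaneSet) {m : ℂ} {r : ℝ} (hm : m.im < 0) (hr : 0 < r)
    (hb : HasBoundary T (Ioi 1) fun p => m.im < p.im ∧ ‖p - m‖ = r) :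
    ∃ w₀ : ℂ, 0 < w₀.im ∧ ‖w₀ - m‖ = r ∧
      ∃ᶠ w in 𝓝[≠] w₀, 0 < w.im ∧ ‖w - m‖ = r ∧ ((w - m) * modE w).re = -3 := by
  set B := Metric.ball (2 : ℂ) 1 with hB
  have hBo : IsOpen B := Metric.isOpen_ball
  have hBre : ∀ s ∈ B, 1 < s.re := fun s hs => by
    have h1 : ‖s - 2‖ < 1 := by simpa [hB, dist_eq_norm] using hs
    have h2 := (neg_abs_le _).trans' (neg_le_neg (Complex.abs_re_le_norm (s - 2)))
    simp only [Complex.sub_re, Complex.re_ofNat] at h2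
    linarith
  have hBc : ∀ s ∈ B, conj s ∈ B := fun s hs => by
    have h1 : ‖s - 2‖ < 1 := by simpa [hB, dist_eq_norm] using hs
    have h2 : conj s - 2 = conj (s - 2) := by simp [map_ofNat]
    rw [hB, Metric.mem_ball, dist_eq_norm, h2, RCLike.norm_conj]
    exact h1
  have hrc : (r : ℂ) ≠ 0 := Complex.ofReal_ne_zero.2 hr.ne'
  have hslit : ∀ w : ℂ, m.im < w.im → (w - m) / r ∈ Complex.slitPlane := fun w hw => by
    refine .inr ?_
    rw [Complex.div_ofReal_im, Complex.sub_im]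
    exact (div_pos (by linarith) hr).ne'
  -- Angular coordinate on the circle: T = m + r e^{iG}, where G is real on the boundary and so
  -- extends across it.
  obtain ⟨G, hGd, hGT, hGc, hGb⟩ := exists_reflection
    (g := fun s => -Complex.I * Complex.log ((T s - m) / r)) hBo hBc
    ((((hT.diff.mono inter_subset_right).sub_const m).div_const _ |>.clog fun s hs =>
      hslit _ (hm.trans (hmaps hs.2))).const_mul _)
    (fun x hx => by
      obtain ⟨p, ⟨hp, hpr⟩, ht⟩ := hb x (by simpa using hBre x hx)
      refine ⟨Complex.arg ((p - m) / r), ?_⟩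
      have h1 : ((Complex.arg ((p - m) / r) : ℝ) : ℂ) =
          -Complex.I * Complex.log ((p - m) / r) := by
        rw [Complex.log, norm_div, hpr, Complex.norm_real, Real.norm_of_nonneg hr.le,
          div_self hr.ne']
        simp only [Real.log_one, Complex.ofReal_zero, zero_add]
        linear_combination (Complex.arg ((p - m) / r) : ℂ) * Complex.I_sq
      rw [h1]
      exact tendsto_const_nhds.mul (((ht.sub_const m).div_const _).clog (hslit p hp)))
  set u : ℂ → ℂ := fun s => r * Complex.exp (Complex.I * G s) with hu
  have hune : ∀ s, u s ≠ 0 := fun s => mul_ne_zero hrc (Complex.exp_ne_zero _)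
  have hTu : ∀ s ∈ B ∩ upperHalfPlaneSet, T s = m + u s := by
    intro s hs
    have h1 : (T s - m) / r ≠ 0 :=
      Complex.slitPlane_ne_zero (hslit _ (hm.trans (hmaps hs.2)))
    have h2 : Complex.I * (-Complex.I * Complex.log ((T s - m) / r)) =
        Complex.log ((T s - m) / r) := by
      linear_combination -Complex.log ((T s - m) / r) * Complex.I_sq
    simp only [hu, hGT hs]
    rw [h2, Complex.exp_log h1]
    field_simp
    ring
  have hGd1 : ∀ s ∈ B, HasDerivAt G (deriv G s) s := fun s hs => hasDerivAt_of_diff hBo hGd hs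
  have hGd2 : ∀ s ∈ B, HasDerivAt (deriv G) (deriv (deriv G) s) s := fun s hs =>
    hasDerivAt_of_diff hBo (hGd.deriv hBo) hs
  have hGd3 : ∀ s ∈ B, HasDerivAt (deriv (deriv G)) (deriv (deriv (deriv G)) s) s := fun s hs =>
    hasDerivAt_of_diff hBo ((hGd.deriv hBo).deriv hBo) hs
  have hud : ∀ s ∈ B, HasDerivAt u (Complex.I * deriv G s * u s) s := fun s hs => by
    refine ((((hGd1 s hs).const_mul Complex.I).cexp).const_mul (r : ℂ)).congr_deriv ?_
    simp only [hu]; ring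
  have hBHo : IsOpen (B ∩ upperHalfPlaneSet) := hBo.inter isOpen_uhp
  have hT1 : ∀ s ∈ B ∩ upperHalfPlaneSet, deriv T s = Complex.I * deriv G s * u s := by
    intro s hs
    have he : T =ᶠ[𝓝 s] fun s => m + u s := by
      filter_upwards [hBHo.mem_nhds hs] with x hx using hTu x hx
    rw [he.deriv_eq, ((hud s hs.1).const_add m).deriv]
  have hT2 : ∀ s ∈ B ∩ upperHalfPlaneSet, deriv (deriv T) s =
      (Complex.I * deriv (deriv G) s + (Complex.I * deriv G s) ^ 2) * u s := by
    intro s hs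
    have he : deriv T =ᶠ[𝓝 s] fun s => Complex.I * deriv G s * u s := by
      filter_upwards [hBHo.mem_nhds hs] with x hx using hT1 x hx
    rw [he.deriv_eq]
    refine (((hGd2 s hs.1).const_mul Complex.I).mul (hud s hs.1)).deriv.trans ?_
    ring
  have hG'ne : ∀ s ∈ B ∩ upperHalfPlaneSet, deriv G s ≠ 0 := by
    intro s hs h0
    refine hT.deriv_ne s hs.2 ?_
    rw [hT1 s hs, h0]; ring
  set E : ℂ → ℂ := fun s => Complex.I * (u s * modE (m + u s)) * deriv G s ^ 2 +
    3 * (deriv (deriv G) s + Complex.I * deriv G s ^ 2 + q b₁ b₂ s * deriv G s) with hE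
  have hE0 : ∀ s ∈ B ∩ upperHalfPlaneSet, E s = 0 := by
    intro s hs
    have h1 := hl s hs.2
    have h2 := hG'ne s hs
    have h3 := hune s
    have hI := Complex.I_ne_zero
    rw [nonlin, hT1 s hs, hT2 s hs, hTu s hs] at h1
    simp only [hE]
    have h4 : (Complex.I * deriv (deriv G) s + (Complex.I * deriv G s) ^ 2) * u s /
        (Complex.I * deriv G s * u s) = deriv (deriv G) s / deriv G s +
          Complex.I * deriv G s := by
      field_simp
    rw [h4] at h1
    have h5 : deriv (deriv G) s = deriv (deriv G) s / deriv G s * deriv G s := by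
      field_simp
    rw [h5]
    linear_combination deriv G s * h1
  have hreal : ∀ f : ℂ → ℂ, (∀ s, f (conj s) = conj (f s)) → ∀ x : ℝ, ∃ v : ℝ, f x = v := by
    intro f hf x
    have := hf x
    rw [Complex.conj_ofReal] at this
    exact ⟨(f x).re, (Complex.conj_eq_iff_re.1 this.symm).symm⟩
  have hc1 := deriv_conj_of_symm hGc
  have hc2 := deriv_conj_of_symm hc1
  have hnorm : ∀ x : ℝ, ‖u x‖ = r := fun x => by
    obtain ⟨v, hv⟩ := hreal G hGc x
    simp only [hu, hv]
    rw [mul_comm Complex.I, norm_mul, Complex.norm_exp_ofReal_mul_I, mul_one, Complex.norm_real,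
      Real.norm_of_nonneg hr.le]
  have hlim : ∀ x : ℝ, (x : ℂ) ∈ B → ∀ᶠ s in 𝓝[upperHalfPlaneSet] (x : ℂ),
      s ∈ B ∩ upperHalfPlaneSet := fun x hx =>
    inter_mem (mem_nhdsWithin_of_mem_nhds (hBo.mem_nhds hx)) self_mem_nhdsWithin
  -- On the real axis P = Im (m + u) · G'. Where P ≠ 0 the boundary point lies strictly above the
  -- real axis and the derivative can be cancelled.
  set P : ℂ → ℂ := fun s => (r * Complex.sin (G s) + m.im) * deriv G s with hP
  have hPa : AnalyticOnNhd ℂ P B := by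
    refine DifferentiableOn.analyticOnNhd (fun s hs => ?_) hBo
    exact ((((hGd1 s hs).csin.const_mul (r : ℂ)).add_const (m.im : ℂ)).mul
      (hGd2 s hs)).differentiableAt.differentiableWithinAt
  have hpt : ∀ x : ℝ, (x : ℂ) ∈ B → P x ≠ 0 →
      0 < (m + u x).im ∧ ‖m + u x - m‖ = r ∧ ((m + u x - m) * modE (m + u x)).re = -3 := by
    intro x hx hPx
    have him : 0 < (m + u x).im := by
      refine lt_of_le_of_ne ?_ ?_
      · have ht : Tendsto (fun s => (m + u s).im) (𝓝[upperHalfPlaneSet] (x : ℂ))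
            (𝓝 (m + u x).im) :=
          (Complex.continuous_im.continuousAt.comp'
            ((hud x hx).const_add m).continuousAt).mono_left nhdsWithin_le_nhds
        refine ge_of_tendsto ht ((hlim x hx).mono fun s hs => ?_)
        rw [← hTu s hs]
        exact le_of_lt (hmaps hs.2)
      · intro h0
        refine hPx ?_
        obtain ⟨v, hv⟩ := hreal G hGc x
        have h1 : (m + u x).im = m.im + r * Real.sin v := by
          simp only [hu, hv, Complex.add_im, Complex.im_ofReal_mul, mul_comm Complex.I,
            Complex.exp_ofReal_mul_I_im]
        rw [h1] at h0
        simp only [hP, hv]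
        rw [← Complex.ofReal_sin, ← Complex.ofReal_mul, ← Complex.ofReal_add, add_comm, ← h0]
        simp
    refine ⟨him, by rw [add_sub_cancel_left]; exact hnorm x, ?_⟩
    have hEx : E x = 0 := by
      have hx0 : (x : ℂ) ≠ 0 := fun h => by
        have := hBre _ hx; rw [h] at this; norm_num at this
      have hx1 : (x : ℂ) ≠ 1 := fun h => by
        have := hBre _ hx; rw [h] at this; norm_num at this
      have hc : ContinuousAt E x := by
        have hmod : ContinuousAt (fun s => modE (m + u s)) x :=
          ContinuousAt.comp' (differentiableOn_modE.differentiableAt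
            (isOpen_uhp.mem_nhds him)).continuousAt ((hud x hx).const_add m).continuousAt
        exact ((continuousAt_const.mul ((hud x hx).continuousAt.mul hmod)).mul
          ((hGd2 x hx).continuousAt.pow 2)).add (continuousAt_const.mul
          (((hGd3 x hx).continuousAt.add (continuousAt_const.mul
            ((hGd2 x hx).continuousAt.pow 2))).add
            ((hasDerivAt_q b₁ b₂ hx0 hx1).continuousAt.mul (hGd2 x hx).continuousAt)))
      refine tendsto_nhds_unique (hc.mono_left nhdsWithin_le_nhds)
        (tendsto_const_nhds.congr' ((hlim x hx).mono fun s hs => (hE0 s hs).symm))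
    obtain ⟨d, hd⟩ := hreal _ hc1 x
    obtain ⟨d₂, hd₂⟩ := hreal _ hc2 x
    have hd0 : d ≠ 0 := by
      rintro rfl
      exact hPx (by simp [hP, hd])
    have hq : q b₁ b₂ x = ((b₁ / (x - 1) + b₂ / x : ℝ) : ℂ) := by
      rw [q]; push_cast; rfl
    simp only [hE, hd, hd₂, hq] at hEx
    set X := u x * modE (m + u x) with hX
    have h1 := congrArg Complex.im hEx
    have h2 : (Complex.I * X * (d : ℂ) ^ 2).im = X.re * d ^ 2 := by
      rw [← Complex.ofReal_pow, Complex.im_mul_ofReal]; simp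
    have h3 : (3 * ((d₂ : ℂ) + Complex.I * (d : ℂ) ^ 2 +
        ((b₁ / (x - 1) + b₂ / x : ℝ) : ℂ) * d)).im = 3 * d ^ 2 := by
      generalize b₁ / (x - 1) + b₂ / x = b
      rw [← Complex.ofReal_pow, ← Complex.ofReal_mul]
      generalize d ^ 2 = e
      simp
    rw [Complex.add_im, h2, h3, Complex.zero_im] at h1
    rw [add_sub_cancel_left, ← hX]
    have h4 : (X.re + 3) * d ^ 2 = 0 := by linarith
    have := (mul_eq_zero.1 h4).resolve_right (pow_ne_zero 2 hd0)
    linarith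
  have h2B : ((2 : ℝ) : ℂ) ∈ B := by simp [hB]
  have hreB : ∀ x : ℝ, (x : ℂ) ∈ B → ∀ᶠ y : ℝ in 𝓝[≠] x, (y : ℂ) ∈ B := fun x hx =>
    (tendsto_ofReal_nhdsNE x).eventually (mem_nhdsWithin_of_mem_nhds (hBo.mem_nhds hx))
  obtain ⟨x₀, hx₀, hPx₀⟩ : ∃ x : ℝ, (x : ℂ) ∈ B ∧ P x ≠ 0 := by
    by_contra! hall
    have hz : EqOn P 0 B := hPa.eqOn_zero_of_preconnected_of_frequently_eq_zero
      (convex_ball _ _).isPreconnected h2B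
      ((tendsto_ofReal_nhdsNE 2).frequently ((hreB 2 h2B).mono fun y hy => hall y hy).frequently)
    refine not_sin_const hBHo ⟨2 + (1 / 2 : ℝ) * Complex.I, ?_, ?_⟩
      (hGd.mono inter_subset_left) hG'ne (c := -m.im / r) fun s hs => ?_
    · rw [hB, Metric.mem_ball, dist_eq_norm, add_sub_cancel_left, norm_mul, Complex.norm_I,
        Complex.norm_real]
      norm_num
    · change 0 < Complex.im _
      simp
    · have h1 : (r * Complex.sin (G s) + m.im) * deriv G s = 0 := hz hs.1
      have h2 := (mul_eq_zero.1 h1).resolve_right (hG'ne s hs)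
      rw [eq_div_iff hrc]
      linear_combination h2
  obtain ⟨h1, h2, -⟩ := hpt x₀ hx₀ hPx₀
  refine ⟨m + u x₀, h1, h2, ?_⟩
  have hd : HasDerivAt (fun s => m + u s) (Complex.I * deriv G x₀ * u x₀) x₀ :=
    (hud x₀ hx₀).const_add m
  have hdne : Complex.I * deriv G x₀ * u x₀ ≠ 0 := by
    refine mul_ne_zero (mul_ne_zero Complex.I_ne_zero fun h => hPx₀ ?_) (hune _)
    simp [hP, h]
  -- The boundary parametrization has non-zero derivative at x₀, so real points near x₀ give points
  -- of the arc other than w₀ that accumulate at w₀.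
  refine ((hd.tendsto_nhdsNE hdne).comp (tendsto_ofReal_nhdsNE x₀)).frequently
    (Eventually.frequently ?_)
  filter_upwards [hreB x₀ hx₀, (tendsto_ofReal_nhdsNE x₀).eventually
    (nhdsWithin_le_nhds ((hPa x₀ hx₀).continuousAt.eventually_ne hPx₀))] with y hy1 hy2
  exact hpt y hy1 hy2


/-! ### The global lift -/

lemma IsLiftOn.congr {b₁ b₂ : ℂ} {T T' : ℂ → ℂ} {U : Set ℂ} (hU : IsOpen U)
    (h : IsLiftOn b₁ b₂ T U) (he : EqOn T' T U) : IsLiftOn b₁ b₂ T' U := by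
  intro s hs
  have e1 : T' =ᶠ[𝓝 s] T := by filter_upwards [hU.mem_nhds hs] with x hx using he hx
  rw [nonlin, e1.deriv_eq, e1.deriv.deriv_eq, he hs]
  exact h s hs

/-- `M` maps the upper half-plane into itself and lifts the Schwarz map `Z`. -/
def IsLiftMatrix (b₁ b₂ : ℂ) (M : GL (Fin 2) ℂ) (Z : ℂ → ℂ) : Prop :=
  (∀ z ∈ upperHalfPlaneSet, M 1 0 * z + M 1 1 ≠ 0 ∧ moebius M z ∈ upperHalfPlaneSet) ∧
    IsLiftOn b₁ b₂ (fun s => moebius M (Z s)) upperHalfPlaneSet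

lemma CuspData.exists_isLiftMatrix {α β γ : ℝ} {a₁ a₂ a₃ : ℂ} {k n : ℕ} {K : ℝ}
    (h : CuspData α β γ a₁ a₂ a₃ k n K) {Z : ℂ → ℂ} (hZ : IsTriangleMap (V α β γ) Z) :
    ∃ M : GL (Fin 2) ℂ, IsLiftMatrix (1 - a₁ / 6) (1 - a₂ / 6) M Z := by
  obtain ⟨δ, ℓ, η, hδ, hδ1, hℓ, hη, hmaps, hsch, hlift⟩ := h.exists_local_lift
  have hk : (0 : ℝ) < k := by exact_mod_cast h.pos
  have hc : η / (2 * Real.pi) < η / (2 * Real.pi) + k / 2 := by linarith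
  obtain ⟨Z₁, ρ, σ, hZ₁, hZZ, hTe, hρi, hρr, hsides⟩ := hZ.exists_normalization hδ hδ1 hsch hc.ne
    (hasCuspLimits_pos h.pos hδ hℓ hη) (hasCuspLimits_neg h.pos hδ hℓ hη)
  have hρ : ρ ≠ 0 := by rintro rfl; simp at hρr
  set C := Metric.ball (0 : ℂ) δ ∩ upperHalfPlaneSet with hC
  have hCo : IsOpen C := Metric.isOpen_ball.inter isOpen_uhp
  have hCne : C.Nonempty := by
    refine ⟨(δ / 2 : ℝ) * Complex.I, ?_, ?_⟩
    · simp [abs_of_pos hδ]; linarith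
    · change 0 < Complex.im _
      simp [hδ]
  set T : ℂ → ℂ := fun s => ρ * Z₁ s + σ with hT
  have hTC : EqOn T (fun s => (k * Complex.log s + ℓ s) / (2 * Real.pi * Complex.I)) C :=
    fun s hs => (hTe s hs).symm
  have hTs : HasSchwarzian (V α β γ) T upperHalfPlaneSet :=
    (hZ₁.schwarzian.moebius_comp isOpen_uhp (affineMatrix ρ σ hρ)
      fun s _ => affineMatrix_denom hρ _).congr isOpen_uhp fun s _ =>
        (moebius_affineMatrix hρ _).symm
  obtain ⟨hTm, hTl⟩ := hTs.lift_continuation hCo hCne inter_subset_right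
    (fun s hs => by rw [hTC hs]; exact hmaps hs) (hlift.congr hCo hTC)
  -- T maps into the upper half-plane, but the affine map must do so on all of it, not only on the
  -- triangle.
  have hσ : 0 ≤ σ.im := by
    by_contra! hneg
    rcases hsides.third with ⟨c₃, h3⟩ | ⟨m, r, hm, hr, h3⟩
    · exact not_three_vertical_sides hTs.diff hsides.mem hsides.first hsides.second h3 hc
    · have e1 : 1 - a₁ / 6 = ((1 - a₁.re / 6 : ℝ) : ℂ) :=
        Complex.ext (by simp) (by simp [h.a₁_real])
      have e2 : 1 - a₂ / 6 = ((1 - k / 6 : ℝ) : ℂ) := by rw [h.a₂_eq]; push_cast; rfl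
      rw [e1, e2] at hTl
      rw [← hm] at hneg h3
      obtain ⟨w₀, hw₀, hr₀, hfr⟩ := exists_circle_relation hTs hTm hTl hneg hr h3
      exact not_frequently_circle_relation hneg hw₀ hr₀ hfr
  have him : ∀ z ∈ upperHalfPlaneSet, ρ * z + σ ∈ upperHalfPlaneSet := by
    intro z hz
    have hz' : 0 < z.im := hz
    change 0 < (ρ * z + σ).im
    have : (ρ * z + σ).im = ρ.re * z.im + σ.im := by simp [Complex.mul_im, hρi]
    rw [this]
    positivity
  rcases hZZ with rfl | ⟨ξ, rfl⟩
  · refine ⟨affineMatrix ρ σ hρ, fun z hz => ⟨affineMatrix_denom hρ z, ?_⟩, ?_⟩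
    · rw [moebius_affineMatrix]; exact him z hz
    · exact hTl.congr isOpen_uhp fun s _ => moebius_affineMatrix hρ _
  · refine ⟨inversionMatrix ξ ρ σ hρ, fun z hz => ⟨?_, ?_⟩, ?_⟩
    · rw [inversionMatrix_denom]
      exact sub_ne_zero.2 (ne_ofReal_of_im_pos hz ξ)
    · rw [moebius_inversionMatrix hρ (ne_ofReal_of_im_pos hz ξ)]
      exact him _ (im_neg_one_div hz ξ)
    · exact hTl.congr isOpen_uhp fun s hs =>
        moebius_inversionMatrix hρ (ne_ofReal_of_im_pos (hZ.mapsTo hs) ξ)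

/-! ### Cyclic permutation of the vertices -/

/-- The cyclic permutation `0 ↦ 1 ↦ ∞ ↦ 0` of the singular points. -/
def cycle (t : ℂ) : ℂ := 1 / (1 - t)

lemma cycle_mem {t : ℂ} (ht : t ∈ upperHalfPlaneSet) : cycle t ∈ upperHalfPlaneSet := by
  have h := im_neg_one_div ht 1
  rw [show cycle t = -1 / (t - (1 : ℝ)) by
    rw [cycle, neg_div, ← div_neg]; simp]
  exact h

lemma hasDerivAt_cycle {t : ℂ} (ht : t ≠ 1) : HasDerivAt cycle (cycle t ^ 2) t := by
  have h1 : 1 - t ≠ 0 := sub_ne_zero.2 ht.symm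
  refine ((hasDerivAt_const t (1 : ℂ)).div ((hasDerivAt_id t).const_sub 1) h1).congr_deriv ?_
  simp [cycle]

lemma cycle_ne_zero {t : ℂ} (ht : t ≠ 1) : cycle t ≠ 0 :=
  div_ne_zero one_ne_zero (sub_ne_zero.2 ht.symm)

lemma HasSchwarzian.hasDerivAt_cycle {W Z : ℂ → ℂ} (h : HasSchwarzian W Z upperHalfPlaneSet)
    {t : ℂ} (ht : t ∈ upperHalfPlaneSet) :
    HasDerivAt (fun t => Z (cycle t)) (deriv Z (cycle t) * cycle t ^ 2) t :=
  (h.hasDerivAt isOpen_uhp (cycle_mem ht)).comp t (Chazy.hasDerivAt_cycle (ne_one_of_mem ht))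

lemma HasSchwarzian.nonlin_cycle {W Z : ℂ → ℂ} (h : HasSchwarzian W Z upperHalfPlaneSet)
    {t : ℂ} (ht : t ∈ upperHalfPlaneSet) :
    nonlin (fun t => Z (cycle t)) t = nonlin Z (cycle t) * cycle t ^ 2 + 2 * cycle t := by
  have he : deriv (fun t => Z (cycle t)) =ᶠ[𝓝 t] fun t => deriv Z (cycle t) * cycle t ^ 2 := by
    filter_upwards [isOpen_uhp.mem_nhds ht] with x hx using (h.hasDerivAt_cycle hx).deriv
  have hc := Chazy.hasDerivAt_cycle (ne_one_of_mem ht)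
  have h1 : HasDerivAt (fun t => deriv Z (cycle t))
      (nonlin Z (cycle t) * deriv Z (cycle t) * cycle t ^ 2) t :=
    (h.hasDerivAt_deriv isOpen_uhp (cycle_mem ht)).comp t hc
  have h2 := (h1.mul (hc.pow 2)).congr_of_eventuallyEq he
  have hne := h.deriv_ne _ (cycle_mem ht)
  have hc0 := cycle_ne_zero (ne_one_of_mem ht)
  rw [nonlin, h2.deriv, (h.hasDerivAt_cycle ht).deriv]
  simp only [Pi.pow_apply, Nat.cast_ofNat, Nat.add_one_sub_one, pow_one]
  field_simp

/-- V transforms as a quadratic differential, a fractional linear substitution having no Schwarzian;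
the factor is (`cycle`')² = `cycle`⁴. -/
lemma V_cycle (α β γ : ℝ) {t : ℂ} (h0 : t ≠ 0) (h1 : t ≠ 1) :
    V α β γ (cycle t) * cycle t ^ 4 = V β γ α t := by
  have h1' : 1 - t ≠ 0 := sub_ne_zero.2 h1.symm
  have h1'' : t - 1 ≠ 0 := sub_ne_zero.2 h1
  have hc : cycle t - 1 = t / (1 - t) := by rw [cycle]; field_simp; ring
  rw [V, V, hc, cycle, show t - 1 = -(1 - t) by ring]
  field_simp
  ring

lemma HasSchwarzian.cycle {α β γ : ℝ} {Z : ℂ → ℂ}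
    (h : HasSchwarzian (V α β γ) Z upperHalfPlaneSet) :
    HasSchwarzian (V β γ α) (fun t => Z (cycle t)) upperHalfPlaneSet := by
  refine ⟨fun t ht => (h.hasDerivAt_cycle ht).differentiableAt.differentiableWithinAt,
    fun t ht => ?_, fun t ht => ?_⟩
  · rw [(h.hasDerivAt_cycle ht).deriv]
    exact mul_ne_zero (h.deriv_ne _ (cycle_mem ht)) (pow_ne_zero 2
      (cycle_ne_zero (ne_one_of_mem ht)))
  · have he : nonlin (fun t => Z (Chazy.cycle t)) =ᶠ[𝓝 t]
        fun t => nonlin Z (Chazy.cycle t) * Chazy.cycle t ^ 2 + 2 * Chazy.cycle t := by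
      filter_upwards [isOpen_uhp.mem_nhds ht] with x hx using h.nonlin_cycle hx
    have hc := Chazy.hasDerivAt_cycle (ne_one_of_mem ht)
    have h1 : HasDerivAt (fun t => nonlin Z (Chazy.cycle t)) _ t :=
      (h.eqn _ (cycle_mem ht)).comp t hc
    refine (((h1.mul (hc.pow 2)).add (hc.const_mul 2)).congr_of_eventuallyEq he).congr_deriv ?_
    rw [h.nonlin_cycle ht, ← V_cycle α β γ (ne_zero_of_mem ht) (ne_one_of_mem ht)]
    simp only [Pi.pow_apply, Nat.cast_ofNat, Nat.add_one_sub_one, pow_one]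
    ring

lemma HasSide.cycle {Z : ℂ → ℂ} {I J : Set ℝ} {A B C : ℝ} (h : HasSide Z I A B C)
    (hJ : ∀ x ∈ J, x ≠ 1 ∧ 1 / (1 - x) ∈ I) : HasSide (fun t => Z (cycle t)) J A B C := by
  intro x hx
  obtain ⟨hx1, hxI⟩ := hJ x hx
  obtain ⟨p, hp, hpL, ht⟩ := h _ hxI
  refine ⟨p, hp, hpL, ht.comp ?_⟩
  have e : ((1 / (1 - x) : ℝ) : ℂ) = Chazy.cycle x := by rw [Chazy.cycle]; push_cast; rfl
  rw [e]
  exact tendsto_nhdsWithin_iff.2 ⟨(hasDerivAt_cycle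
    (by exact_mod_cast hx1)).continuousAt.mono_left nhdsWithin_le_nhds,
    eventually_mem_nhdsWithin.mono fun t ht => cycle_mem ht⟩

lemma IsTriangleMap.cycle {α β γ : ℝ} {Z : ℂ → ℂ} (h : IsTriangleMap (V α β γ) Z) :
    IsTriangleMap (V β γ α) (fun t => Z (cycle t)) := by
  refine ⟨h.schwarzian.cycle, fun t ht => h.mapsTo (cycle_mem ht), fun J hJ => ?_⟩
  have key : ∃ I ∈ ({Iio 0, Ioo 0 1, Ioi 1} : Set (Set ℝ)),
      ∀ x ∈ J, x ≠ 1 ∧ 1 / (1 - x) ∈ I := by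
    simp only [mem_insert_iff, mem_singleton_iff] at hJ
    rcases hJ with rfl | rfl | rfl
    · refine ⟨Ioo 0 1, by simp, fun x (hx : x < 0) => ⟨by linarith, ?_, ?_⟩⟩
      · have : 0 < 1 - x := by linarith
        positivity
      · rw [div_lt_one] <;> linarith
    · refine ⟨Ioi 1, by simp, fun x hx => ⟨hx.2.ne, ?_⟩⟩
      have h1 := hx.1
      have h2 := hx.2
      rw [mem_Ioi, lt_div_iff₀] <;> linarith
    · refine ⟨Iio 0, by simp, fun x (hx : 1 < x) => ⟨hx.ne', ?_⟩⟩
      exact mem_Iio.2 (div_neg_of_pos_of_neg one_pos (sub_neg.2 hx))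
  obtain ⟨I, hI, hIJ⟩ := key
  obtain ⟨A, B, C, hd, hs⟩ := h.sides I hI
  exact ⟨A, B, C, hd, hs.cycle hIJ⟩

lemma q_cycle {a₁ a₂ a₃ : ℂ} (hp : a₁ + a₂ + a₃ = 6) {t : ℂ} (h0 : t ≠ 0) (h1 : t ≠ 1) :
    q (1 - a₃ / 6) (1 - a₁ / 6) t + 2 * cycle t =
      q (1 - a₁ / 6) (1 - a₂ / 6) (cycle t) * cycle t ^ 2 := by
  have h1' : 1 - t ≠ 0 := sub_ne_zero.2 h1.symm
  have hc : cycle t - 1 = t / (1 - t) := by rw [cycle]; field_simp; ring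
  obtain rfl : a₃ = 6 - a₁ - a₂ := by linear_combination hp
  rw [q, q, hc, cycle, show t - 1 = -(1 - t) by ring]
  field_simp
  ring

/-- The substitution adds 2 `cycle` to the pre-Schwarzian derivative, and q changes by the opposite
amount because a₁ + a₂ + a₃ = 6. So the same M serves both placements of the vertices. -/
lemma IsLiftMatrix.of_cycle {a₁ a₂ a₃ : ℂ} (hp : a₁ + a₂ + a₃ = 6) {M : GL (Fin 2) ℂ}
    {W Z : ℂ → ℂ} (hZ : IsTriangleMap W Z)
    (h : IsLiftMatrix (1 - a₃ / 6) (1 - a₁ / 6) M fun t => Z (cycle t)) :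
    IsLiftMatrix (1 - a₁ / 6) (1 - a₂ / 6) M Z := by
  refine ⟨h.1, fun s hs => ?_⟩
  obtain ⟨t, ht, rfl⟩ : ∃ t ∈ upperHalfPlaneSet, s = cycle t := by
    refine ⟨1 + -1 / (s - (0 : ℝ)), ?_, ?_⟩
    · have := im_neg_one_div hs 0
      change 0 < (1 + -1 / (s - (0 : ℝ))).im
      rwa [Complex.add_im, Complex.one_im, zero_add]
    · have := ne_zero_of_mem hs
      rw [cycle]
      simp
      ring_nf
  have hT := hZ.schwarzian.moebius_comp isOpen_uhp M fun s hs => (h.1 _ (hZ.mapsTo hs)).1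
  have h1 := h.2 t ht
  simp only at h1
  rw [hT.nonlin_cycle ht, (hT.hasDerivAt_cycle ht).deriv] at h1
  have hc := pow_ne_zero 2 (cycle_ne_zero (ne_one_of_mem ht))
  refine mul_right_cancel₀ hc ?_
  linear_combination h1 - 3 * q_cycle hp (ne_zero_of_mem ht) (ne_one_of_mem ht)

lemma InTable.exists_isLiftMatrix {α β γ : ℝ} {a₁ a₂ a₃ : ℂ} (h : InTable α β γ a₁ a₂ a₃)
    (hp : a₁ + a₂ + a₃ = 6) {Z : ℂ → ℂ} (hZ : IsTriangleMap (V α β γ) Z) :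
    ∃ M : GL (Fin 2) ℂ, IsLiftMatrix (1 - a₁ / 6) (1 - a₂ / 6) M Z := by
  obtain ⟨k, n, K, h | h | h⟩ := h.exists_cuspData
  · exact h.exists_isLiftMatrix hZ
  · obtain ⟨M, hM⟩ := h.exists_isLiftMatrix hZ.cycle
    exact ⟨M, hM.of_cycle hp hZ⟩
  · obtain ⟨M, hM⟩ := h.exists_isLiftMatrix hZ.cycle.cycle
    exact ⟨M, (hM.of_cycle (by linear_combination hp) hZ.cycle).of_cycle hp hZ⟩


/-! ### The equivalences -/

lemma denom_mul (M g : GL (Fin 2) ℂ) {z : ℂ} (hz : g 1 0 * z + g 1 1 ≠ 0) :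
    (M * g) 1 0 * z + (M * g) 1 1 =
      (M 1 0 * moebius g z + M 1 1) * (g 1 0 * z + g 1 1) := by
  simp only [moebius, Units.val_mul, Matrix.mul_apply, Fin.sum_univ_two]
  field_simp
  ring

lemma moebius_mul (M g : GL (Fin 2) ℂ) {z : ℂ} (hz : g 1 0 * z + g 1 1 ≠ 0) :
    moebius (M * g) z = moebius M (moebius g z) := by
  have h : (M * g) 0 0 * z + (M * g) 0 1 =
      (M 0 0 * moebius g z + M 0 1) * (g 1 0 * z + g 1 1) := by
    simp only [moebius, Units.val_mul, Matrix.mul_apply, Fin.sum_univ_two]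
    field_simp
    ring
  rw [moebius, denom_mul M g hz, h, mul_div_mul_right _ _ hz]
  rfl

lemma moebiusDeriv_mul (M g : GL (Fin 2) ℂ) {z : ℂ} (hz : g 1 0 * z + g 1 1 ≠ 0) :
    moebiusDeriv (M * g) z = moebiusDeriv M (moebius g z) * moebiusDeriv g z := by
  rw [moebiusDeriv, denom_mul M g hz, moebiusDeriv, moebiusDeriv, Units.val_mul, Matrix.det_mul,
    mul_pow, mul_div_mul_comm]

lemma triangleT_nonempty {α β γ : ℝ} {Z : ℂ → ℂ} (hZ : IsSchwarzMap α β γ Z)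
    (g : GL (Fin 2) ℂ) : (triangleT g Z).Nonempty := by
  have ho : IsOpen (Z '' upperHalfPlaneSet) :=
    isOpen_image_of_hasSchwarzian isOpen_uhp hZ.hasSchwarzian
  have hne : (Z '' upperHalfPlaneSet).Nonempty := ⟨Z Complex.I, Complex.I, by simp, rfl⟩
  -- The excluded point is the image of ∞ under g, whose preimage is not a finite point. If g 1 0 =
  -- 0, then ∞ is fixed and the excluded value is merely the default 0.
  obtain ⟨w, hw, hwne⟩ : ∃ w ∈ Z '' upperHalfPlaneSet, w ≠ g 0 0 / g 1 0 := by
    obtain ⟨w, hw, hw'⟩ := (dense_compl_singleton (g 0 0 / g 1 0)).inter_open_nonempty _ ho hne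
    exact ⟨w, hw, hw'⟩
  have hdet := det_ne_zero g
  rw [Matrix.det_fin_two] at hdet
  have hd : g 0 0 - g 1 0 * w ≠ 0 := by
    intro h
    by_cases h10 : g 1 0 = 0
    · rw [h10, zero_mul, sub_zero] at h
      rw [h, h10] at hdet
      simp at hdet
    · exact hwne (by rw [eq_div_iff h10]; linear_combination -h)
  have e1 : g 1 0 * ((g 1 1 * w - g 0 1) / (g 0 0 - g 1 0 * w)) + g 1 1 =
      (g 0 0 * g 1 1 - g 0 1 * g 1 0) / (g 0 0 - g 1 0 * w) := by
    field_simp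
    ring
  have e2 : g 0 0 * ((g 1 1 * w - g 0 1) / (g 0 0 - g 1 0 * w)) + g 0 1 =
      w * (g 0 0 * g 1 1 - g 0 1 * g 1 0) / (g 0 0 - g 1 0 * w) := by
    rw [eq_div_iff hd, add_mul, mul_assoc, div_mul_cancel₀ _ hd]
    ring
  refine ⟨(g 1 1 * w - g 0 1) / (g 0 0 - g 1 0 * w), ?_, ?_⟩
  · rw [e1]; exact div_ne_zero hdet hd
  · rw [moebius, e1, e2, div_div_div_cancel_right₀ hd, mul_div_cancel_right₀ _ hdet]
    exact hw

/-- Since s' ≠ 0, s is an open map, so the polynomial form of the identity holds on an open set and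
hence everywhere. -/
lemma VSeq_identity_of_triangleT {α β γ : ℝ} {a₁ a₂ : ℂ} {g : GL (Fin 2) ℂ} {Z s : ℂ → ℂ}
    (hs : IsTriangleFunction α β γ g Z s)
    (h : ∀ z ∈ triangleT g Z, VSeq α β γ (1 - a₁ / 6) (1 - a₂ / 6) 2 (s z) =
      12 * VSeq α β γ (1 - a₁ / 6) (1 - a₂ / 6) 0 (s z) ^ 2) {x : ℂ} (h0 : x ≠ 0) (h1 : x ≠ 1) :
    VSeq α β γ (1 - a₁ / 6) (1 - a₂ / 6) 2 x =
      12 * VSeq α β γ (1 - a₁ / 6) (1 - a₂ / 6) 0 x ^ 2 := by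
  rw [VSeq_identity_iff α β γ a₁ a₂ h0 h1]
  set F : ℂ → ℂ := fun x =>
    numer₄ (a₂ / 6) (a₁ / 6) (coeffZero α a₂) (coeffOne α β γ a₁ a₂) (coeffTwo γ a₁ a₂) x -
      12 * numer₂ (coeffZero α a₂) (coeffOne α β γ a₁ a₂) (coeffTwo γ a₁ a₂) x ^ 2 with hF
  have hFd : Differentiable ℂ F := by
    simp only [hF, numer₂, numer₃, numer₄]
    fun_prop
  have hinv := hs.isInverseOn
  obtain ⟨z, hz⟩ := triangleT_nonempty hs.1 g
  have hsd : DifferentiableOn ℂ s (triangleT g Z) := fun z hz =>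
    (hinv.hasDerivAt z hz).differentiableAt.differentiableWithinAt
  have hstrict : HasStrictDerivAt s (deriv s z) z :=
    (hsd.analyticAt (hinv.isOpen.mem_nhds hz)).hasStrictDerivAt
  have hev : ∀ᶠ x in 𝓝 (s z), F x = 0 := by
    rw [← hstrict.map_nhds_eq (hinv.deriv_ne hs.1.hasSchwarzian hz), eventually_map]
    filter_upwards [hinv.isOpen.mem_nhds hz] with y hy
    have hm := hinv.mem y hy
    exact (VSeq_identity_iff α β γ a₁ a₂ (ne_zero_of_mem hm) (ne_one_of_mem hm)).1 (h y hy)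
  have hFa : AnalyticOnNhd ℂ F univ := hFd.differentiableOn.analyticOnNhd isOpen_univ
  exact hFa.eqOn_zero_of_preconnected_of_eventuallyEq_zero isPreconnected_univ
    (mem_univ (s z)) hev (mem_univ x)

/-- The continuation is the transform of `modE` under M g. It is holomorphic on all of D because g
maps D into the upper half-plane and M maps that into itself. -/
lemma IsLiftMatrix.exists_chazy {α β γ : ℝ} {a₁ a₂ a₃ : ℂ} (hp : a₁ + a₂ + a₃ = 6)
    {M g : GL (Fin 2) ℂ} {Z s : ℂ → ℂ} (hs : IsTriangleFunction α β γ g Z s)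
    (hM : IsLiftMatrix (1 - a₁ / 6) (1 - a₂ / 6) M Z) :
    ∃ Y : ℂ → ℂ, IsChazySolutionOn Y (domainD g) ∧ EqOn Y (y a₁ a₂ a₃ s) (triangleT g Z) := by
  have hinv := hs.isInverseOn
  have hZ := hs.1.hasSchwarzian
  have hden : ∀ x ∈ upperHalfPlaneSet, M 1 0 * Z x + M 1 1 ≠ 0 := fun x hx =>
    (hM.1 _ (hs.1.mapsTo hx)).1
  have hMZ := hZ.moebius_comp isOpen_uhp M hden
  refine ⟨chazyTransform (M * g) modE, ?_, fun z hz => ?_⟩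
  · have hopen : IsOpen (domainD g) := isOpen_pullback g isOpen_uhp
    have hsub : domainD g ⊆ pullback (M * g) upperHalfPlaneSet := by
      rintro z ⟨hz, hzH⟩
      obtain ⟨h1, h2⟩ := hM.1 _ hzH
      refine ⟨?_, ?_⟩
      · rw [denom_mul M g hz]; exact mul_ne_zero h1 hz
      · rw [moebius_mul M g hz]; exact h2
    have hsys := covariantSystem_modE.transform (M * g)
    refine CovariantSystem.isChazySolutionOn hopen (fun z hz => hsys z (hsub hz)) fun z _ => ?_
    ring
  · have hinv' : IsInverseOn (M * g) (fun x => moebius M (Z x)) s (triangleT g Z) := by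
      refine ⟨hinv.isOpen, fun z hz => ?_, hinv.mem, fun z hz => ?_⟩
      · have h1 := hinv.denom_ne z hz
        rw [denom_mul M g h1]
        refine mul_ne_zero ?_ h1
        rw [← (hs.2 z hz).2]
        exact hden _ (hinv.mem z hz)
      · have h1 := hinv.denom_ne z hz
        have hm := hinv.mem z hz
        refine (hinv.hasDerivAt z hz).congr_deriv ?_
        have h2 : HasDerivAt (fun x => moebius M (Z x))
            (moebiusDeriv M (Z (s z)) * deriv Z (s z)) (s z) :=
          (hasDerivAt_moebius M (hden _ hm)).comp _ (hZ.hasDerivAt isOpen_uhp hm)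
        rw [h2.deriv, moebiusDeriv_mul M g h1, ← (hs.2 z hz).2,
          mul_div_mul_left _ _ (moebiusDeriv_ne_zero M (hden _ hm))]
    refine (hinv'.y_eq_chazyTransform hMZ hp hz ?_).symm
    rw [moebius_mul M g (hinv.denom_ne z hz), ← (hs.2 z hz).2]
    exact hM.2 _ (hinv.mem z hz)

end Chazy

end

theorem mainTheorem2 (α β γ : ℝ) (hα : 0 ≤ α) (hβ : 0 ≤ β) (hγ : 0 ≤ γ)
    (hhyp : α + β + γ < 1)
    (a₁ a₂ a₃ : ℂ) (hp : a₁ + a₂ + a₃ = 6)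
    (g : GL (Fin 2) ℂ) (Z s : ℂ → ℂ) (hs : Chazy.IsTriangleFunction α β γ g Z s) :
    -- `y = 3 φ' / φ` on the triangle
    (∀ z ∈ Chazy.triangleT g Z,
      Chazy.y a₁ a₂ a₃ s z = 3 * logDeriv (Chazy.φ (1 - a₁ / 6) (1 - a₂ / 6) s) z) ∧
    List.TFAE [
      -- `y` is (continues to) a holomorphic solution of the Chazy equation on `D`
      ∃ Y : ℂ → ℂ, Chazy.IsChazySolutionOn Y (Chazy.domainD g) ∧
        Set.EqOn Y (Chazy.y a₁ a₂ a₃ s) (Chazy.triangleT g Z),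
      -- `V₄ = 12 V₂²` identically, and the residues of `y` at the elliptic vertices vanish
      (∀ x : ℂ, x ≠ 0 → x ≠ 1 →
        Chazy.VSeq α β γ (1 - a₁ / 6) (1 - a₂ / 6) 2 x =
          12 * Chazy.VSeq α β γ (1 - a₁ / 6) (1 - a₂ / 6) 0 x ^ 2) ∧
        (α ≠ 0 → a₂ = 6 * (α : ℂ)) ∧ (β ≠ 0 → a₁ = 6 * (β : ℂ)) ∧ (γ ≠ 0 → a₃ = 6 * (γ : ℂ)),
      -- the parameters are listed in the table, up to a permutation of the vertices
      Chazy.InTable α β γ a₁ a₂ a₃] := by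
  refine ⟨fun z hz => hs.isInverseOn.y_eq_logDeriv hs.1.hasSchwarzian hp hz, ?_⟩
  have table : (∀ x : ℂ, x ≠ 0 → x ≠ 1 →
      Chazy.VSeq α β γ (1 - a₁ / 6) (1 - a₂ / 6) 2 x =
        12 * Chazy.VSeq α β γ (1 - a₁ / 6) (1 - a₂ / 6) 0 x ^ 2) →
      Chazy.InTable α β γ a₁ a₂ a₃ := fun h => by
    have := Chazy.inTable_of_vertexSystem hα hβ hγ hhyp (by linear_combination hp / 6)
      ((Chazy.vertexSystem_iff hp).2 h)
    have e : ∀ a : ℂ, 6 * (a / 6) = a := fun a => by ring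
    rwa [e, e, e] at this
  tfae_have 1 → 3 := fun ⟨Y, hY, hYy⟩ => table fun x h0 h1 =>
    Chazy.VSeq_identity_of_triangleT hs (Chazy.VSeq_identity_of_chazy hp hs hY hYy) h0 h1
  tfae_have 3 → 1 := fun h => by
    obtain ⟨M, hM⟩ := h.exists_isLiftMatrix hp hs.1.isTriangleMap
    exact hM.exists_chazy hp hs
  tfae_have 2 → 3 := fun h => table h.1
  tfae_have 3 → 2 := fun h => ⟨(Chazy.vertexSystem_iff hp).1 h.vertexSystem, h.residues⟩
  tfae_finish
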